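/- **Conventions.** Let $\mathbb D$ be the set of dyadic rationals. Each $d\in\mathbb D$ is written in lowest form over the symbols $0,1,-,.$ (no superfluous zeros; the integer part $0$ is written as $0$) and coded as a binary word by $0\mapsto 00$, $1\mapsto 11$, $-\mapsto 01$, $.\mapsto 10$; $|d|$ is the length of this word. For $x\in\mathbb R$ let $CF_x$ be the set of all $\varphi:\mathbb N\to\mathbb D$ with $|x-\varphi(n)|\le 2^{-n}$ for all $n$. Machines are deterministic multitape Turing machines, possibly with function oracles. Precision arguments $n\in\mathbb N$ are given in unary; an oracle $\varphi:\mathbb N\to\mathbb D$ is asked for $\varphi(j)$ by writing $j$ in unary on a query tape, and in one step the code of $\varphi(j)$ replaces the contents of an answer tape. Let $a\in\mathbb R$ and $f:[a,\infty)\to\mathbb R$. The function $f$ is *polynomial-time computable* if there are a two-oracle Turing machine $M$ and a polynomial $p$ such that for all $\varphi_a\in CF_a$, $x\in[a,\infty)$, $\varphi_x\in CF_x$ and $n\in\mathbb N$, the computation $M^{\varphi_x,\varphi_a}(n)$ halts within $p(k,n)$ steps, where $k=\min\{j\in\mathbb N: x\in[a,a+2^j]\}$, and outputs some $e\in\mathbb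 D$ with $|e-f(x)|\le 2^{-n}$. A *modulus* for $f$ is a function $m:\mathbb N^2\to\mathbb N$ such that for all $k,n$ and all $x,y\in[a,a+2^k]$, $|x-y|\le 2^{-m(k,n)}$ implies $|f(x)-f(y)|\le 2^{-n}$; it is *polynomial* if $m(k,n)$ is a polynomial in $k$ and $n$ with coefficients in $\mathbb N$. An *approximation function* for $f$ is a function $\psi:(\mathbb D\cap[a,\infty))\times\mathbb N\to\mathbb D$ with $|\psi(d,n)-f(d)|\le 2^{-n}$ for all $d,n$. **Theorem.** Let $a\in\mathbb R$ and $f:[a,\infty)\to\mathbb R$. 1. $f$ is polynomial-time computable if and only if $f$ has a polynomial modulus $m$ and there are approximation functions $\psi_{\varphi_a}$ for $f$, one for each $\varphi_a\in CF_a$, such that a single Turing machine with oracle $\varphi_a$ computes $\psi_{\varphi_a}(d,n)$ in time $p(|d|+n)$, for some polynomial $p$ independent of $\varphi_a$, $d$ and $n$. 2. If $a\in\mathbb D$, the oracle can be dispensed with: $f$ is polynomial-time computable if and only if $f$ has a polynomial modulus $m$ and an approximation function $\psi$ such that $\psi(d,n)$ is computable by an ordinary Turing machine in time $p(|d|+n)$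 for some polynomial $p$. -/

import Mathlib

namespace PTimeReal

/-! ### Dyadic numbers and their binary words -/

/-- The real number denoted by a dyadic rational. -/
noncomputable def toReal (d : Dyadic) : ℝ := (d.toRat : ℝ)

/-- The four symbols `0`, `1`, `-`, `.` in which dyadic numbers are written. -/
inductive DSym where
  | zero
  | one
  | minus
  | point

/-- The two-bit code of a symbol: `0 ↦ 00`, `1 ↦ 11`, `- ↦ 01`, `. ↦ 10`. -/
def DSym.code : DSym → List Bool
  | .zero => [false, false]
  | .one => [true, true]
  | .minus => [false, true]
  | .point => [true, false]

/-- The symbol of a binary digit. -/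
def DSym.ofBit (b : Bool) : DSym := if b then .one else .zero

/-- The binary digits of a natural number, most significant first and without leading zeros; the
number zero is written `0`. -/
def intDigits (n : ℕ) : List DSym :=
  if n = 0 then [.zero] else n.bits.reverse.map DSym.ofBit

/-- The `j` lowest binary digits of `r`, most significant first, leading zeros included. -/
def fracDigits (j r : ℕ) : List DSym :=
  (List.range j).map fun i => DSym.ofBit (r.testBit (j - 1 - i))

/-- The lowest-form binary expansion of a dyadic number `± N / 2 ^ j` (a fraction in lowest terms):
a minus sign if the number is negative, the digits of the integer part, and, if the number is not
an integer, a point and the `j` digits of the fractional part (the last of which is `1`). -/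
def expansion (d : Dyadic) : List DSym :=
  (if d.toRat.num < 0 then [DSym.minus] else []) ++
    intDigits (d.toRat.num.natAbs / d.toRat.den) ++
    (if d.toRat.den = 1 then [] else
      DSym.point :: fracDigits (Nat.log 2 d.toRat.den) (d.toRat.num.natAbs % d.toRat.den))

/-- The binary word of a dyadic number: the two-bit codes of the symbols of its expansion. -/
def word (d : Dyadic) : List Bool := (expansion d).flatMap DSym.code

/-- The length `|d|` of a dyadic number. -/
def len (d : Dyadic) : ℕ := (word d).length

/-- The word `1ⁿ`: natural numbers given to machines as precisions are written in unary. -/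
def unary (n : ℕ) : List Bool := List.replicate n true

/-- The Cauchy functions of a real number `x`: those `φ : ℕ → 𝔻` with `|x - φ(n)| ≤ 2⁻ⁿ`. -/
def CauchyFun (x : ℝ) : Set (ℕ → Dyadic) :=
  {φ | ∀ n : ℕ, |x - toReal (φ n)| ≤ (2 : ℝ) ^ (-(n : ℤ))}

/-! ### Multitape oracle Turing machines over the alphabet `{0, 1}` -/

/-- The tapes of a machine with `s` arguments, `r` oracles and `w` work tapes. -/
inductive TapeIx (s r w : ℕ) where
  | input (i : Fin s)
  | output
  | query (j : Fin r)
  | answer (j : Fin r)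
  | work (i : Fin w)
  deriving DecidableEq

/-- What a machine does in one step: halt; ask oracle `j` and go to a state; or go to a state and,
on every tape, write a symbol (`none` is the blank) and then move the head by one cell or not. -/
inductive Instr (Q : Type) (s r w : ℕ) where
  | halt
  | ask (j : Fin r) (q : Q)
  | act (q : Q) (a : TapeIx s r w → Option Bool × Option Turing.Dir)

/-- A deterministic multitape Turing machine with tape symbols `0`, `1` and blank, which takes `s`
words as arguments and has access to `r` function oracles. With `r = 0` it is an ordinary
Turing machine. -/
structure OracleTM (s r : ℕ) where
  /-- the states -/
  Q : Type
  /-- there are finitely many states -/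
  [fin : Fintype Q]
  /-- the initial state -/
  start : Q
  /-- the number of work tapes -/
  w : ℕ
  /-- the transition function, from the state and the scanned symbols -/
  δ : Q → (TapeIx s r w → Option Bool) → Instr Q s r w

namespace OracleTM

variable {s r : ℕ}

/-- A configuration: the state, and the tapes with the positions of their heads. -/
structure Cfg (M : OracleTM s r) where
  state : M.Q
  tape : TapeIx s r M.w → Turing.Tape (Option Bool)

/-- A tape that holds just the word `u`, with its head on the first symbol. -/
def tapeOf (u : List Bool) : Turing.Tape (Option Bool) := Turing.Tape.mk₁ (u.map some)

/-- From its head on, the tape holds the word `u` followed by blanks only. -/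
def Holds (T : Turing.Tape (Option Bool)) (u : List Bool) : Prop :=
  ∀ i : ℕ, T.nth (i : ℤ) = u[i]?

/-- The number written in unary on a tape from its head on. -/
noncomputable def readUnary (T : Turing.Tape (Option Bool)) : ℕ :=
  sInf {i : ℕ | T.nth (i : ℤ) ≠ some true}

/-- The instruction that a configuration is about to carry out. -/
def instr (M : OracleTM s r) (c : M.Cfg) : Instr M.Q s r M.w :=
  M.δ c.state fun t => (c.tape t).head

/-- The initial configuration: the arguments are on the input tapes, all other tapes are blank. -/
def init (M : OracleTM s r) (args : Fin s → List Bool) : M.Cfg where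
  state := M.start
  tape
    | .input i => tapeOf (args i)
    | _ => tapeOf []

/-- Write a symbol and move. -/
def actTape (a : Option Bool × Option Turing.Dir) (T : Turing.Tape (Option Bool)) :
    Turing.Tape (Option Bool) :=
  match a.2 with
  | none => T.write a.1
  | some dir => (T.write a.1).move dir

/-- One step with oracles `φ`. Asking oracle `j` when the query tape `j` holds `n` in unary replaces
the answer tape `j` by the word of the dyadic number `φ j n`, with the head on its first symbol.
A configuration that halts is left as it is. -/
noncomputable def step (M : OracleTM s r) (φ : Fin r → ℕ → Dyadic) (c : M.Cfg) : M.Cfg :=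
  match M.instr c with
  | .halt => c
  | .ask j q =>
    { state := q
      tape := Function.update c.tape (.answer j)
        (tapeOf (word (φ j (readUnary (c.tape (.query j)))))) }
  | .act q a => { state := q, tape := fun t => actTape (a t) (c.tape t) }

/-- On the given arguments and with oracles `φ`, the machine halts after at most `T` steps with the
word `u` on its output tape. -/
def OutputsWithin (M : OracleTM s r) (φ : Fin r → ℕ → Dyadic) (args : Fin s → List Bool)
    (T : ℕ) (u : List Bool) : Prop :=
  M.instr ((M.step φ)^[T] (M.init args)) = .halt ∧
    Holds (((M.step φ)^[T] (M.init args)).tape .output) u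

end OracleTM

/-! ### Real functions on `[a, ∞)` -/

/-- The value at `(k, n)` of a polynomial with natural coefficients in two variables. -/
noncomputable def eval₂ (p : MvPolynomial (Fin 2) ℕ) (k n : ℕ) : ℕ := MvPolynomial.eval ![k, n] p

/-- The extension parameter of `x ∈ [a, ∞)`: the least `j` with `x ∈ [a, a + 2 ^ j]`. -/
noncomputable def extension (a x : ℝ) : ℕ := sInf {j : ℕ | x ∈ Set.Icc a (a + 2 ^ j)}

/-- Polynomial-time computability of `f : [a, ∞) → ℝ` by a machine with two oracles, a Cauchy
function of the argument and a Cauchy function of `a`. -/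
def PolyTimeComputable (a : ℝ) (f : Set.Ici a → ℝ) : Prop :=
  ∃ (M : OracleTM 1 2) (p : MvPolynomial (Fin 2) ℕ),
    ∀ φa ∈ CauchyFun a, ∀ x : Set.Ici a, ∀ φx ∈ CauchyFun (x : ℝ), ∀ n : ℕ,
      ∃ e : Dyadic,
        M.OutputsWithin ![φx, φa] ![unary n] (eval₂ p (extension a x) n) (word e) ∧
          |toReal e - f x| ≤ (2 : ℝ) ^ (-(n : ℤ))

/-- `m` is a modulus of continuity of `f : [a, ∞) → ℝ`. -/
def IsModulus (a : ℝ) (f : Set.Ici a → ℝ) (m : ℕ → ℕ → ℕ) : Prop :=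
  ∀ k n : ℕ, ∀ x y : Set.Ici a, (x : ℝ) ∈ Set.Icc a (a + 2 ^ k) → (y : ℝ) ∈ Set.Icc a (a + 2 ^ k) →
    |(x : ℝ) - y| ≤ (2 : ℝ) ^ (-(m k n : ℤ)) → |f x - f y| ≤ (2 : ℝ) ^ (-(n : ℤ))

/-- `m` is a polynomial in both arguments. -/
def IsPolynomial (m : ℕ → ℕ → ℕ) : Prop :=
  ∃ p : MvPolynomial (Fin 2) ℕ, ∀ k n : ℕ, m k n = eval₂ p k n

/-- The dyadic numbers in `[a, ∞)`. -/
abbrev DyadicIci (a : ℝ) : Type := {d : Dyadic // toReal d ∈ Set.Ici a}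

/-- `ψ` is an approximation function for `f`. -/
def IsApproximation (a : ℝ) (f : Set.Ici a → ℝ) (ψ : DyadicIci a → ℕ → Dyadic) : Prop :=
  ∀ (d : DyadicIci a) (n : ℕ), |toReal (ψ d n) - f ⟨toReal d.1, d.2⟩| ≤ (2 : ℝ) ^ (-(n : ℤ))

/-- `ψ(d, n)` is computed by an ordinary Turing machine in time polynomial in `|d| + n`. -/
def PolyTimeApprox (a : ℝ) (ψ : DyadicIci a → ℕ → Dyadic) : Prop :=
  ∃ (N : OracleTM 2 0) (p : Polynomial ℕ), ∀ (d : DyadicIci a) (n : ℕ),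
    N.OutputsWithin ![] ![word d.1, unary n] (p.eval (len d.1 + n)) (word (ψ d n))

/-- One Turing machine computes `ψ φ (d, n)` in time polynomial in `|d| + n`, when it is given as
an oracle the Cauchy function `φ` of `a`, for every such `φ`. -/
def PolyTimeApproxFrom (a : ℝ) (ψ : CauchyFun a → DyadicIci a → ℕ → Dyadic) : Prop :=
  ∃ (N : OracleTM 2 1) (p : Polynomial ℕ), ∀ (φ : CauchyFun a) (d : DyadicIci a) (n : ℕ),
    N.OutputsWithin ![φ.1] ![word d.1, unary n] (p.eval (len d.1 + n)) (word (ψ φ d n))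

end PTimeReal

open PTimeReal

/-! A machine that runs for `T` steps asks its oracles only for precisions up to `T`, because
questions are written in unary. Let `T = p(k, n + 1)` be its time bound on `[a, a + 2^k]`. If `x`
and `y` in this interval are at distance at most `2^-(T+1)`, then `y` has a Cauchy function that
agrees up to `T` with one of `x`. The two runs coincide, their common output is within `2^-(n+1)` of
both `f x` and `f y`, and so `p(k, n + 1) + 1` is a modulus (`exists_modulus`). Approximation
functions arise because the constant function `d` is a Cauchy function of a dyadic `d`: a machine
with `d` as input answers the questions to this oracle itself, by copying its input
(`exists_approximation`). The time is polynomial in `|d| + n` since the extension parameter of `d`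
is at most `|d|` plus a constant.

Conversely, let `x` be given by `φ`. The approximation function is evaluated with precision `n + 1`
at a dyadic `d` so close to `x` that the modulus puts `f d` within `2^-(n+1)` of `f x`. Three
obstacles arise. The point `d` must lie in `[a, ∞)`, although `a` is known only approximately:
`roundUp` truncates `φ j` after `j` fractional digits and adds enough to land in `[x, x + 4 * 2^-j]`
(`roundUp_mem`). The extension parameter `k` of `x` is unknown: the number `L` of integer digits of
`φ 0` replaces it, since `x ≤ 2^L + 1` and `L` exceeds `k` by at most a constant
(`intLen_cauchyFun_le`). Oracle answers may be arbitrarily long: only their integer digits and `j`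
fractional digits are read, and `|d|` is linear in these numbers (`len_roundUp_le`). All this is
assembled in `polyTimeComputable_of_modulus`.

For dyadic `a`, the oracle for `a` may be the constant function, whose single word is built into the
machine (`polyTimeApprox_of_const`); in the other direction, an ordinary machine is one that ignores
its oracle.

Most of the work is to realise these constructions by Turing machines with explicit time bounds.
Flowcharts (`Frag`) are composed by sequence, branching and loops. `Frag.Embedding.runs_outputs`
runs a given machine inside a flowchart, with quadratic overhead, and supplies an oracle all of
whose answers are one word by copying that word. Treating tapes as stacks, and these as registers,
gives the unary arithmetic (`exists_rruns_mulPow`) and the digit arithmetic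
(`exists_rruns_writeRounded`). -/

namespace PTimeReal

open Turing

/-! ### Tapes as pairs of lists -/

/-- The tape with the cells `R` from its head on and the cells `L`, read from right to left, to the
left of its head. -/
def tp (L R : List (Option Bool)) : Tape (Option Bool) := Tape.mk₂ L R

theorem tapeOf_eq_tp (u : List Bool) : OracleTM.tapeOf u = tp [] (u.map some) := rfl

@[simp] theorem tp_move_right_cons (L R : List (Option Bool)) (x : Option Bool) :
    (tp L (x :: R)).move Dir.right = tp (x :: L) R := by
  simp [tp, Tape.mk₂, Tape.move_right_mk']

@[simp] theorem tp_move_left_cons (L R : List (Option Bool)) (x : Option Bool) :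
    (tp (x :: L) R).move Dir.left = tp L (x :: R) := by
  simp [tp, Tape.mk₂, Tape.move_left_mk']

@[simp] theorem tp_move_right_nil (L : List (Option Bool)) :
    (tp L []).move Dir.right = tp (none :: L) [] := by
  simp [tp, Tape.mk₂, Tape.move_right_mk']
  rfl

@[simp] theorem tp_move_left_nil (R : List (Option Bool)) :
    (tp [] R).move Dir.left = tp [] (none :: R) := by
  simp [tp, Tape.mk₂, Tape.move_left_mk']
  rfl

@[simp] theorem tp_write_cons (L R : List (Option Bool)) (x b : Option Bool) :
    (tp L (x :: R)).write b = tp L (b :: R) := by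
  simp [tp, Tape.mk₂, Tape.write_mk']

@[simp] theorem tp_write_nil (L : List (Option Bool)) (b : Option Bool) :
    (tp L []).write b = tp L [b] := by
  simp [tp, Tape.mk₂, Tape.write_mk']

@[simp] theorem tp_head_cons (L R : List (Option Bool)) (x : Option Bool) :
    (tp L (x :: R)).head = x := by
  simp [tp, Tape.mk₂]

@[simp] theorem tp_head_nil (L : List (Option Bool)) : (tp L []).head = none := by
  simp [tp, Tape.mk₂]
  rfl

theorem listBlank_mk_append_none (L : List (Option Bool)) (k : ℕ) :
    ListBlank.mk (L ++ List.replicate k none) = ListBlank.mk L :=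
  (Quotient.sound' (Or.inl ⟨k, rfl⟩)).symm

theorem tp_append_left (L R : List (Option Bool)) (k : ℕ) :
    tp (L ++ List.replicate k none) R = tp L R := by
  simp [tp, Tape.mk₂, listBlank_mk_append_none]

theorem tp_append_right (L R : List (Option Bool)) (k : ℕ) :
    tp L (R ++ List.replicate k none) = tp L R := by
  simp [tp, Tape.mk₂, listBlank_mk_append_none]

@[simp] theorem tp_none_right (L : List (Option Bool)) : tp L [none] = tp L [] :=
  tp_append_right L [] 1

@[simp] theorem tp_none_left (R : List (Option Bool)) : tp [none] R = tp [] R :=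
  tp_append_left [] R 1

theorem tp_nth (L R : List (Option Bool)) (i : ℕ) : (tp L R).nth (i : ℤ) = R.getI i := by
  rw [tp, Tape.mk₂, Tape.mk'_nth_nat, ListBlank.nth_mk]

theorem tape_write_head (T : Tape (Option Bool)) : T.write T.head = T := Tape.write_self T

theorem tapeOf_nth (u : List Bool) (i : ℕ) : (OracleTM.tapeOf u).nth (i : ℤ) = u[i]? := by
  rw [tapeOf_eq_tp, tp_nth, List.getI_eq_getElem?_getD]
  cases h : u[i]? <;> simp [h]
  rfl

theorem tapeOf_head (u : List Bool) : (OracleTM.tapeOf u).head = u.head? := by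
  cases u <;> simp [tapeOf_eq_tp]

/-- A word contains no blank, so the blanks behind it determine where it ends. -/
theorem holds_unique {T : Tape (Option Bool)} {u v : List Bool} (hu : OracleTM.Holds T u)
    (hv : OracleTM.Holds T v) : u = v :=
  List.ext_getElem? fun i => (hu i).symm.trans (hv i)

theorem readUnary_unary (n : ℕ) : OracleTM.readUnary (OracleTM.tapeOf (unary n)) = n := by
  have h : {i : ℕ | (OracleTM.tapeOf (unary n)).nth (i : ℤ) ≠ some true} = {i | n ≤ i} := by
    ext i
    rw [Set.mem_ofPred_eq, tapeOf_nth, unary, List.getElem?_replicate]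
    by_cases h : i < n <;> simp [h]
    omega
  rw [OracleTM.readUnary, h]
  exact le_antisymm (Nat.sInf_le (by simp)) (le_csInf ⟨n, by simp⟩ fun _ h => by simpa using h)

/-! ### Machine fragments -/

/-- The tapes of a machine with `s` arguments, `r` oracles and work tapes indexed by `κ`. -/
inductive Ix (s r : ℕ) (κ : Type) where
  | input (i : Fin s)
  | output
  | query (j : Fin r)
  | answer (j : Fin r)
  | work (k : κ)
  deriving DecidableEq

/-- The contents of the tapes of a machine. -/
abbrev Tapes (s r : ℕ) (κ : Type) := Ix s r κ → Tape (Option Bool)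

/-- The symbols that the heads of a machine scan. -/
abbrev Scan (s r : ℕ) (κ : Type) := Ix s r κ → Option Bool

/-- What a step does to the tapes: a question to an oracle, or a write and a move on every tape. -/
abbrev Deed (s r : ℕ) (κ : Type) := Fin r ⊕ (Ix s r κ → Option Bool × Option Dir)

/-- The deed that changes nothing, for given scanned symbols. -/
def Deed.idle {s r : ℕ} {κ : Type} (c : Scan s r κ) : Deed s r κ := .inr fun t => (c t, none)

/-- The tapes after a deed. -/
noncomputable def Deed.effect {s r : ℕ} {κ : Type} [DecidableEq κ] (φ : Fin r → ℕ → Dyadic)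
    (T : Tapes s r κ) : Deed s r κ → Tapes s r κ
  | .inl j => Function.update T (.answer j)
      (OracleTM.tapeOf (word (φ j (OracleTM.readUnary (T (.query j))))))
  | .inr a => fun t => OracleTM.actTape (a t) (T t)

/-- A flowchart with finitely many control points and a memory of type `σ`; `none` is its exit. -/
structure Frag (s r : ℕ) (κ σ : Type) where
  Q : Type
  [fin : Fintype Q]
  start : Q
  δ : Q → σ → Scan s r κ → Option Q × σ × Deed s r κ

attribute [instance] Frag.fin

namespace Frag

set_option linter.unusedSectionVars false

variable {s r : ℕ} {κ σ : Type} [DecidableEq κ]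

/-- One step of a fragment. -/
noncomputable def step (F : Frag s r κ σ) (φ : Fin r → ℕ → Dyadic) :
    Option F.Q × σ × Tapes s r κ → Option F.Q × σ × Tapes s r κ
  | (none, c) => (none, c)
  | (some q, v, T) =>
    let x := F.δ q v fun t => (T t).head
    (x.1, x.2.1, x.2.2.effect φ T)

/-- A fragment leads from `c` to its exit with `c'` in at most `t` steps. -/
def Runs (F : Frag s r κ σ) (φ : Fin r → ℕ → Dyadic) (c : σ × Tapes s r κ) (t : ℕ)
    (c' : σ × Tapes s r κ) : Prop :=
  ∃ t' ≤ t, (F.step φ)^[t'] (some F.start, c) = (none, c')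

variable {φ : Fin r → ℕ → Dyadic}

theorem Runs.mono {F : Frag s r κ σ} {c c' : σ × Tapes s r κ} {t t' : ℕ} (h : F.Runs φ c t c')
    (ht : t ≤ t') : F.Runs φ c t' c' :=
  let ⟨u, hu, e⟩ := h
  ⟨u, hu.trans ht, e⟩

theorem iterate_step_none (F : Frag s r κ σ) (c : σ × Tapes s r κ) (t : ℕ) :
    (F.step φ)^[t] (none, c) = (none, c) :=
  Function.iterate_fixed rfl t

/-- A fragment `F` inside a fragment `G`, whose exit is made to lead to `e`. -/
theorem exists_iterate_of_embedding (F G : Frag s r κ σ) (i : F.Q → G.Q) (e : Option G.Q)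
    (h : ∀ q v c, G.δ (i q) v c =
      ((F.δ q v c).1.elim e fun q' => some (i q'), (F.δ q v c).2))
    {t : ℕ} {q : F.Q} {c c' : σ × Tapes s r κ}
    (hF : (F.step φ)^[t] (some q, c) = (none, c')) :
    ∃ t' ≤ t, (G.step φ)^[t'] (some (i q), c) = (e, c') := by
  induction t generalizing q c with
  | zero => simp at hF
  | succ t ih =>
    obtain ⟨v, T⟩ := c
    rw [Function.iterate_succ_apply] at hF
    have hG : G.step φ (some (i q), v, T) =
        ((F.step φ (some q, v, T)).1.elim e fun q' => some (i q'),
          (F.step φ (some q, v, T)).2) := by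
      simp only [step, h]
    rcases hx : F.step φ (some q, v, T) with ⟨q₁, c₁⟩
    rw [hx] at hF hG
    cases q₁ with
    | none =>
      rw [iterate_step_none] at hF
      -- `F` has left through its exit and merely idles from here on, while `G` is already at `e`;
      -- so `G` may need fewer steps.
      refine ⟨1, by omega, ?_⟩
      rw [Function.iterate_one, hG, show c₁ = c' from (Prod.ext_iff.1 hF).2]
      rfl
    | some q₁ =>
      obtain ⟨t', ht', h'⟩ := ih hF
      exact ⟨t' + 1, by omega, by rw [Function.iterate_succ_apply, hG]; exact h'⟩

/-- A single step. -/
def prim (f : σ → Scan s r κ → σ × Deed s r κ) : Frag s r κ σ where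
  Q := Unit
  start := ()
  δ _ v c := (none, f v c)

theorem runs_prim (f : σ → Scan s r κ → σ × Deed s r κ) (v : σ) (T : Tapes s r κ) :
    (prim f).Runs φ (v, T) 1
      ((f v fun t => (T t).head).1, (f v fun t => (T t).head).2.effect φ T) :=
  ⟨1, le_rfl, rfl⟩

/-- One fragment after the other. -/
def seq (F G : Frag s r κ σ) : Frag s r κ σ where
  Q := F.Q ⊕ G.Q
  start := .inl F.start
  δ
    | .inl q, v, c => ((F.δ q v c).1.elim (some (.inr G.start)) fun q' => some (.inl q'),
        (F.δ q v c).2)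
    | .inr q, v, c => ((G.δ q v c).1.elim none fun q' => some (.inr q'), (G.δ q v c).2)

theorem Runs.seq {F G : Frag s r κ σ} {c c₁ c₂ : σ × Tapes s r κ} {t₁ t₂ : ℕ}
    (hF : F.Runs φ c t₁ c₁) (hG : G.Runs φ c₁ t₂ c₂) : (F.seq G).Runs φ c (t₁ + t₂) c₂ := by
  obtain ⟨u₁, hu₁, e₁⟩ := hF
  obtain ⟨u₂, hu₂, e₂⟩ := hG
  obtain ⟨w₁, hw₁, f₁⟩ := exists_iterate_of_embedding F (F.seq G) Sum.inl _
    (fun _ _ _ => rfl) e₁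
  obtain ⟨w₂, hw₂, f₂⟩ := exists_iterate_of_embedding G (F.seq G) Sum.inr _
    (fun _ _ _ => rfl) e₂
  exact ⟨w₂ + w₁, by omega, by rw [Function.iterate_add_apply]; exact (congrArg _ f₁).trans f₂⟩

/-- Repeat a fragment while a condition on the memory and the scanned symbols holds. -/
def loop (b : σ → Scan s r κ → Bool) (F : Frag s r κ σ) : Frag s r κ σ where
  Q := Option F.Q
  start := none
  δ
    | none, v, c => (if b v c then some (some F.start) else none, v, Deed.idle c)
    | some q, v, c => ((F.δ q v c).1.elim (some none) fun q' => some (some q'), (F.δ q v c).2)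

theorem effect_idle (T : Tapes s r κ) :
    (Deed.idle fun t => (T t).head).effect φ T = T := by
  funext t
  exact tape_write_head (T t)

theorem runs_loop_exit {b : σ → Scan s r κ → Bool} {F : Frag s r κ σ} {v : σ} {T : Tapes s r κ}
    (hb : b v (fun t => (T t).head) = false) : (loop b F).Runs φ (v, T) 1 (v, T) :=
  ⟨1, le_rfl, by simp [loop, step, hb, effect_idle]⟩

theorem runs_loop_step {b : σ → Scan s r κ → Bool} {F : Frag s r κ σ} {v : σ} {T : Tapes s r κ}
    {c₁ c₂ : σ × Tapes s r κ} {t₁ t₂ : ℕ} (hb : b v (fun t => (T t).head) = true)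
    (hF : F.Runs φ (v, T) t₁ c₁) (hl : (loop b F).Runs φ c₁ t₂ c₂) :
    (loop b F).Runs φ (v, T) (1 + t₁ + t₂) c₂ := by
  obtain ⟨u₁, hu₁, e₁⟩ := hF
  obtain ⟨u₂, hu₂, e₂⟩ := hl
  obtain ⟨w₁, hw₁, f₁⟩ := exists_iterate_of_embedding F (loop b F) some _
    (fun _ _ _ => rfl) e₁
  refine ⟨u₂ + (w₁ + 1), by omega, ?_⟩
  rw [Function.iterate_add_apply, Function.iterate_succ_apply]
  have h : (loop b F).step φ (some (loop b F).start, v, T) =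
      (some (some F.start), v, T) := by
    simp [loop, step, hb, effect_idle]
  rw [h]
  exact (congrArg _ f₁).trans e₂

/-- Run the first fragment if a condition holds and the second one otherwise. -/
def ite (b : σ → Scan s r κ → Bool) (F G : Frag s r κ σ) : Frag s r κ σ where
  Q := Option (F.Q ⊕ G.Q)
  start := none
  δ
    | none, v, c => (some (some (if b v c then .inl F.start else .inr G.start)), v, Deed.idle c)
    | some (.inl q), v, c =>
      ((F.δ q v c).1.elim none fun q' => some (some (.inl q')), (F.δ q v c).2)
    | some (.inr q), v, c =>
      ((G.δ q v c).1.elim none fun q' => some (some (.inr q')), (G.δ q v c).2)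

theorem runs_ite_true {b : σ → Scan s r κ → Bool} {F G : Frag s r κ σ} {v : σ}
    {T : Tapes s r κ} {c₁ : σ × Tapes s r κ} {t : ℕ} (hb : b v (fun t => (T t).head) = true)
    (hF : F.Runs φ (v, T) t c₁) : (ite b F G).Runs φ (v, T) (t + 1) c₁ := by
  obtain ⟨u₁, hu₁, e₁⟩ := hF
  obtain ⟨w₁, hw₁, f₁⟩ := exists_iterate_of_embedding F (ite b F G) (fun q => some (.inl q)) _
    (fun _ _ _ => rfl) e₁
  refine ⟨w₁ + 1, by omega, ?_⟩
  rw [Function.iterate_succ_apply]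
  refine Eq.trans (congrArg _ ?_) f₁
  simp [ite, step, hb, effect_idle]

theorem runs_ite_false {b : σ → Scan s r κ → Bool} {F G : Frag s r κ σ} {v : σ}
    {T : Tapes s r κ} {c₁ : σ × Tapes s r κ} {t : ℕ} (hb : b v (fun t => (T t).head) = false)
    (hG : G.Runs φ (v, T) t c₁) : (ite b F G).Runs φ (v, T) (t + 1) c₁ := by
  obtain ⟨u₁, hu₁, e₁⟩ := hG
  obtain ⟨w₁, hw₁, f₁⟩ := exists_iterate_of_embedding G (ite b F G) (fun q => some (.inr q)) _
    (fun _ _ _ => rfl) e₁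
  refine ⟨w₁ + 1, by omega, ?_⟩
  rw [Function.iterate_succ_apply]
  refine Eq.trans (congrArg _ ?_) f₁
  simp [ite, step, hb, effect_idle]

/-! ### From fragments to machines -/

/-- The tapes of a fragment, numbered. -/
noncomputable def toIx [Fintype κ] : TapeIx s r (Fintype.card κ) → Ix s r κ
  | .input i => .input i
  | .output => .output
  | .query j => .query j
  | .answer j => .answer j
  | .work k => .work ((Fintype.equivFin κ).symm k)

/-- The number of a tape of a fragment. -/
noncomputable def ofIx [Fintype κ] : Ix s r κ → TapeIx s r (Fintype.card κ)
  | .input i => .input i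
  | .output => .output
  | .query j => .query j
  | .answer j => .answer j
  | .work k => .work (Fintype.equivFin κ k)

theorem ofIx_toIx [Fintype κ] (t : TapeIx s r (Fintype.card κ)) : ofIx (toIx (κ := κ) t) = t := by
  cases t <;> simp [ofIx, toIx]

theorem toIx_ofIx [Fintype κ] (t : Ix s r κ) : toIx (ofIx t) = t := by
  cases t <;> simp [ofIx, toIx]

/-- The machine that runs a fragment with a given initial memory. -/
noncomputable def toMachine [Fintype κ] [Fintype σ] (F : Frag s r κ σ) (v₀ : σ) :
    OracleTM s r where
  Q := Option F.Q × σ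
  start := (some F.start, v₀)
  w := Fintype.card κ
  δ
    | (none, _), _ => .halt
    | (some q, v), c =>
      let x := F.δ q v fun t => c (ofIx t)
      match x.2.2 with
      | .inl j => .ask j (x.1, x.2.1)
      | .inr a => .act (x.1, x.2.1) fun t => a (toIx t)

/-- The tapes at the beginning. -/
def initTapes (args : Fin s → List Bool) : Tapes s r κ
  | .input i => OracleTM.tapeOf (args i)
  | _ => OracleTM.tapeOf []

/-- The configuration of the machine of a fragment. -/
noncomputable def toCfg [Fintype κ] [Fintype σ] (F : Frag s r κ σ) (v₀ : σ)
    (c : Option F.Q × σ × Tapes s r κ) : (F.toMachine v₀).Cfg where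
  state := (c.1, c.2.1)
  tape := fun t => c.2.2 (toIx t)

/-- Being a semiconjugacy, `toCfg` carries whole runs of the fragment to runs of the machine. -/
theorem step_toCfg [Fintype κ] [Fintype σ] (F : Frag s r κ σ) (v₀ : σ)
    (c : Option F.Q × σ × Tapes s r κ) :
    (F.toMachine v₀).step φ (F.toCfg v₀ c) = F.toCfg v₀ (F.step φ c) := by
  obtain ⟨q, v, T⟩ := c
  cases q with
  | none => rfl
  | some q =>
    have hs : (fun t : Ix s r κ => ((F.toCfg v₀ (some q, v, T)).tape (ofIx t)).head) =
        fun t => (T t).head := by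
      funext t
      simp [toCfg, toIx_ofIx]
    have hi : (F.toMachine v₀).instr (F.toCfg v₀ (some q, v, T)) =
        match (F.δ q v fun t => (T t).head).2.2 with
        | .inl j => .ask j ((F.δ q v fun t => (T t).head).1,
            (F.δ q v fun t => (T t).head).2.1)
        | .inr a => .act ((F.δ q v fun t => (T t).head).1,
            (F.δ q v fun t => (T t).head).2.1) fun t => a (toIx t) := by
      rw [← hs]
      rfl
    rw [OracleTM.step, hi]
    simp only [step]
    rcases hx : F.δ q v (fun t => (T t).head) with ⟨q', v', d⟩
    cases d with
    | inl j =>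
      simp only [toCfg, Deed.effect]
      congr 1
      funext t
      by_cases ht : t = .answer j
      · subst ht
        simp [toIx]
      · rw [Function.update_of_ne ht, Function.update_of_ne]
        intro h
        apply ht
        rw [← ofIx_toIx (κ := κ) t, h]
        rfl
    | inr a => rfl

/-- A fragment at its exit stays there, so the time may be rounded up to any later bound `t'`. -/
theorem outputsWithin_toMachine [Fintype κ] [Fintype σ] {F : Frag s r κ σ} {v₀ v : σ}
    {args : Fin s → List Bool} {T : Tapes s r κ} {t t' : ℕ} {u : List Bool}
    (h : F.Runs φ (v₀, initTapes args) t (v, T)) (ht : t ≤ t')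
    (hu : OracleTM.Holds (T .output) u) :
    (F.toMachine v₀).OutputsWithin φ args t' u := by
  obtain ⟨t₁, ht₁, e⟩ := h
  have h₀ : (F.toMachine v₀).init args = F.toCfg v₀ (some F.start, v₀, initTapes args) := by
    simp only [OracleTM.init, toCfg]
    congr 1
    funext t
    cases t <;> rfl
  have h₁ : ((F.toMachine v₀).step φ)^[t'] ((F.toMachine v₀).init args) =
      F.toCfg v₀ (none, v, T) := by
    obtain ⟨m, rfl⟩ := Nat.exists_eq_add_of_le (ht₁.trans ht)
    rw [h₀, ← (Function.Semiconj.iterate_right (f := F.toCfg v₀)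
      (fun c => (F.step_toCfg v₀ c).symm) _).eq, add_comm, Function.iterate_add_apply, e,
      iterate_step_none]
  exact ⟨by rw [h₁]; rfl, by rw [h₁]; exact hu⟩

end Frag


open Turing

namespace Frag

set_option linter.unusedSectionVars false

variable {s r : ℕ} {κ σ : Type} [DecidableEq κ] {φ : Fin r → ℕ → Dyadic}

/-! ### Refreshing a tape from a source -/

/-- `n` marked cells. -/
def marks (n : ℕ) : List (Option Bool) := List.replicate n (some true)

@[simp] theorem marks_zero : marks 0 = [] := rfl

theorem marks_succ (n : ℕ) : marks (n + 1) = some true :: marks n := rfl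

/-- Three tapes `A`, `mk` and `src` of a machine are distinct. -/
structure Distinct3 (A mk src : Ix s r κ) : Prop where
  am : mk ≠ A
  as : src ≠ A
  ms : src ≠ mk

/-- Set the contents of three tapes. -/
def upd3 (A mk src : Ix s r κ) (T : Tapes s r κ) (a m u : Tape (Option Bool)) : Tapes s r κ :=
  fun t => if t = A then a else if t = mk then m else if t = src then u else T t

theorem upd3_self (A mk src : Ix s r κ) (T : Tapes s r κ) :
    upd3 A mk src T (T A) (T mk) (T src) = T := by
  funext t
  unfold upd3
  split_ifs with h₁ h₂ h₃ <;> simp [*]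

/-- A step that acts on three tapes. -/
def tri (A mk src : Ix s r κ) (g : Option Bool → Option Bool → Option Bool →
    (Option Bool × Option Dir) × (Option Bool × Option Dir) × (Option Bool × Option Dir)) :
    Frag s r κ σ :=
  prim fun v c => (v, .inr fun t =>
    if t = A then (g (c A) (c mk) (c src)).1 else
    if t = mk then (g (c A) (c mk) (c src)).2.1 else
    if t = src then (g (c A) (c mk) (c src)).2.2 else (c t, none))

/-- Repeat while the scanned symbols on `mk` and `src` satisfy a condition. -/
def loop3 (mk src : Ix s r κ) (b : Option Bool → Option Bool → Bool) (F : Frag s r κ σ) :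
    Frag s r κ σ :=
  loop (fun _ c => b (c mk) (c src)) F

section Refresh

variable {A mk src : Ix s r κ}

theorem runs_tri (h : Distinct3 A mk src) {g : Option Bool → Option Bool → Option Bool →
    (Option Bool × Option Dir) × (Option Bool × Option Dir) × (Option Bool × Option Dir)}
    (v : σ) (T : Tapes s r κ) (a m u : Tape (Option Bool)) {a' m' u' : Tape (Option Bool)}
    (ha : OracleTM.actTape (g a.head m.head u.head).1 a = a')
    (hm : OracleTM.actTape (g a.head m.head u.head).2.1 m = m')
    (hu : OracleTM.actTape (g a.head m.head u.head).2.2 u = u') :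
    (tri A mk src g).Runs φ (v, upd3 A mk src T a m u) 1 (v, upd3 A mk src T a' m' u') := by
  have := runs_prim (φ := φ) (fun (v : σ) c => (v, (.inr fun t =>
    if t = A then (g (c A) (c mk) (c src)).1 else
    if t = mk then (g (c A) (c mk) (c src)).2.1 else
    if t = src then (g (c A) (c mk) (c src)).2.2 else (c t, none) : Deed s r κ))) v
    (upd3 A mk src T a m u)
  have e : Deed.effect φ (upd3 A mk src T a m u) (.inr fun t =>
      if t = A then (g a.head m.head u.head).1 else
      if t = mk then (g a.head m.head u.head).2.1 else
      if t = src then (g a.head m.head u.head).2.2 else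
        ((upd3 A mk src T a m u t).head, none)) = upd3 A mk src T a' m' u' := by
    funext t
    simp only [Deed.effect, upd3]
    split_ifs
    · exact ha
    · exact hm
    · exact hu
    · exact tape_write_head _
  rw [← e]
  unfold tri
  simpa [upd3, h.am, h.as, h.ms] using this

theorem runs_loop3_exit (h : Distinct3 A mk src) {b : Option Bool → Option Bool → Bool}
    {F : Frag s r κ σ} (v : σ) (T : Tapes s r κ) (a m u : Tape (Option Bool))
    (hb : b m.head u.head = false) :
    (loop3 mk src b F).Runs φ (v, upd3 A mk src T a m u) 1 (v, upd3 A mk src T a m u) :=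
  runs_loop_exit (by simpa [upd3, h.am, h.as, h.ms] using hb)

theorem runs_loop3_step (h : Distinct3 A mk src) {b : Option Bool → Option Bool → Bool}
    {F : Frag s r κ σ} {v : σ} {T : Tapes s r κ} {a m u : Tape (Option Bool)} {t₁ t₂ : ℕ}
    {c₁ c₂ : σ × Tapes s r κ} (hb : b m.head u.head = true)
    (hF : F.Runs φ (v, upd3 A mk src T a m u) t₁ c₁)
    (hl : (loop3 mk src b F).Runs φ c₁ t₂ c₂) :
    (loop3 mk src b F).Runs φ (v, upd3 A mk src T a m u) (1 + t₁ + t₂) c₂ :=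
  runs_loop_step (by simpa [upd3, h.am, h.as, h.ms] using hb) hF hl

/-- Move the heads of `A` and `mk`, and that of `src` as said. -/
def move3 (A mk src : Ix s r κ) (d : Dir) (d' : Option Dir) : Frag s r κ σ :=
  tri A mk src fun a m u => ((a, some d), (m, some d), (u, d'))

theorem runs_move3 (h : Distinct3 A mk src) (d : Dir) (d' : Option Dir) (v : σ)
    (T : Tapes s r κ) (a m u : Tape (Option Bool)) :
    (move3 A mk src d d').Runs φ (v, upd3 A mk src T a m u) 1
      (v, upd3 A mk src T (Tape.move d a) (Tape.move d m) (d'.elim u fun d => Tape.move d u)) := by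
  refine runs_tri h v T a m u ?_ ?_ ?_
  · simp [OracleTM.actTape]
  · simp [OracleTM.actTape]
  · cases d' <;> simp [OracleTM.actTape]

/-- Move `A` and `mk` to the left as long as `mk` is marked. -/
def rewind2 (A mk src : Ix s r κ) : Frag s r κ σ :=
  loop3 mk src (fun m _ => m = some true) (move3 A mk src .left none)

/-- The tape `A` may contain blanks between symbols, so its own contents do not show how far it has
been visited; `mk`, whose head moves in parallel, does. Each of the `L.length + 1` marked cells
costs a test and a move, and a last test finds the blank to the left of the marks. -/
theorem runs_rewind2 (h : Distinct3 A mk src) (v : σ) (T : Tapes s r κ)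
    (L : List (Option Bool)) (x : Option Bool) (R : List (Option Bool))
    (u : Tape (Option Bool)) :
    (rewind2 A mk src).Runs φ
      (v, upd3 A mk src T (tp L (x :: R)) (tp (marks L.length) (marks (x :: R).length)) u)
      (2 * L.length + 3)
      (v, upd3 A mk src T (tp [] (none :: (L.reverse ++ x :: R)))
        (tp [] (none :: marks (L.length + (x :: R).length))) u) := by
  unfold rewind2
  induction L generalizing x R with
  | nil =>
    have H := runs_loop3_step h (b := fun m _ => m = some true) (by simp [marks_succ])
      (runs_move3 (φ := φ) h .left none v T (tp [] (x :: R)) (tp [] (marks (x :: R).length)) u)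
      (runs_loop3_exit h v T _ _ _ (by simp))
    simpa using H
  | cons y L ih =>
    have H := runs_loop3_step h (b := fun m _ => m = some true) (by simp [marks_succ])
      (runs_move3 (φ := φ) h .left none v T (tp (y :: L) (x :: R))
        (tp (marks (y :: L).length) (marks (x :: R).length)) u) (t₂ := 2 * L.length + 3)
      (c₂ := (v, upd3 A mk src T (tp [] (none :: (L.reverse ++ y :: x :: R)))
        (tp [] (none :: marks (L.length + (y :: x :: R).length))) u)) (by
          simpa [marks_succ] using ih y (x :: R))
    refine Runs.mono (t := 1 + 1 + (2 * L.length + 3)) ?_ (by simp; omega)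
    have e : (y :: L).length + (x :: R).length = L.length + (y :: x :: R).length := by
      simp; omega
    rw [e]
    simpa using H

/-- Erase `A` and `mk` to the right as long as `mk` is marked. -/
def erase2 (A mk src : Ix s r κ) : Frag s r κ σ :=
  loop3 mk src (fun m _ => m = some true)
    (tri A mk src fun _ _ u => ((none, some .right), (none, some .right), (u, none)))

theorem runs_erase2 (h : Distinct3 A mk src) (v : σ) (T : Tapes s r κ)
    (R : List (Option Bool)) (u : Tape (Option Bool)) :
    (erase2 A mk src).Runs φ (v, upd3 A mk src T (tp [] R) (tp [] (marks R.length)) u)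
      (2 * R.length + 1) (v, upd3 A mk src T (tp [] []) (tp [] []) u) := by
  induction R with
  | nil => exact runs_loop3_exit h v T _ _ _ (by simp)
  | cons y R ih =>
    refine (runs_loop3_step h (by simp [marks_succ])
      (runs_tri h v T _ _ u (a' := tp [] R) (m' := tp [] (marks R.length)) (u' := u) ?_ ?_ ?_)
      ih).mono (by simp; omega)
    · simp [OracleTM.actTape]
    · simp [OracleTM.actTape, marks_succ]
    · simp [OracleTM.actTape]

/-- Copy `src` to `A` and mark the copied cells. -/
def copy3 (A mk src : Ix s r κ) : Frag s r κ σ :=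
  loop3 mk src (fun _ u => u.isSome)
    (tri A mk src fun _ _ u => ((u, some .right), (some true, some .right), (u, some .right)))

/-- The source holds a word, so its first blank ends the copy. The marks are rebuilt along the way,
so that the copied cells can be erased again later. -/
theorem runs_copy3 (h : Distinct3 A mk src) (v : σ) (T : Tapes s r κ)
    (K : List (Option Bool)) (u : List Bool) :
    (copy3 A mk src).Runs φ
      (v, upd3 A mk src T (tp K []) (tp (marks K.length) []) (tp K (u.map some)))
      (2 * u.length + 1)
      (v, upd3 A mk src T (tp ((u.map some).reverse ++ K) [])
        (tp (marks (u.length + K.length)) []) (tp ((u.map some).reverse ++ K) [])) := by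
  unfold copy3
  induction u generalizing K with
  | nil => simpa using runs_loop3_exit h v T _ _ _ (by simp)
  | cons y u ih =>
    have H := runs_loop3_step h (φ := φ) (b := fun _ u => u.isSome) (by simp)
      (runs_tri h v T (tp K []) (tp (marks K.length) []) (tp K ((y :: u).map some))
        (g := fun _ _ u => ((u, some .right), (some true, some .right), (u, some .right)))
        (a' := tp (some y :: K) []) (m' := tp (marks (some y :: K).length) [])
        (u' := tp (some y :: K) (u.map some))
        (by simp [OracleTM.actTape]) (by simp [OracleTM.actTape, marks_succ])
        (by simp [OracleTM.actTape])) (ih (some y :: K))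
    refine Runs.mono (t := 1 + 1 + (2 * u.length + 1)) ?_ (by simp; omega)
    have e : (y :: u).length + K.length = u.length + (some y :: K).length := by simp; omega
    rw [e]
    simpa using H

/-- Move `A`, `mk` and `src` to the left as long as `mk` is marked. -/
def rewind3 (A mk src : Ix s r κ) : Frag s r κ σ :=
  loop3 mk src (fun m _ => m = some true) (move3 A mk src .left (some .left))

theorem runs_rewind3 (h : Distinct3 A mk src) (v : σ) (T : Tapes s r κ)
    (L : List (Option Bool)) (x : Option Bool) (R : List (Option Bool)) :
    (rewind3 A mk src).Runs φ
      (v, upd3 A mk src T (tp L (x :: R)) (tp (marks L.length) (marks (x :: R).length))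
        (tp L (x :: R)))
      (2 * L.length + 3)
      (v, upd3 A mk src T (tp [] (none :: (L.reverse ++ x :: R)))
        (tp [] (none :: marks (L.length + (x :: R).length)))
        (tp [] (none :: (L.reverse ++ x :: R)))) := by
  unfold rewind3
  induction L generalizing x R with
  | nil =>
    have H := runs_loop3_step h (b := fun m _ => m = some true) (by simp [marks_succ])
      (runs_move3 (φ := φ) h .left (some .left) v T (tp [] (x :: R))
        (tp [] (marks (x :: R).length)) (tp [] (x :: R)))
      (runs_loop3_exit h v T _ _ _ (by simp))
    simpa using H
  | cons y L ih =>
    have H := runs_loop3_step h (b := fun m _ => m = some true) (by simp [marks_succ])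
      (runs_move3 (φ := φ) h .left (some .left) v T (tp (y :: L) (x :: R))
        (tp (marks (y :: L).length) (marks (x :: R).length)) (tp (y :: L) (x :: R)))
      (t₂ := 2 * L.length + 3)
      (c₂ := (v, upd3 A mk src T (tp [] (none :: (L.reverse ++ y :: x :: R)))
        (tp [] (none :: marks (L.length + (y :: x :: R).length)))
        (tp [] (none :: (L.reverse ++ y :: x :: R))))) (by
          simpa [marks_succ] using ih y (x :: R))
    refine Runs.mono (t := 1 + 1 + (2 * L.length + 3)) ?_ (by simp; omega)
    have e : (y :: L).length + (x :: R).length = L.length + (y :: x :: R).length := by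
      simp; omega
    rw [e]
    simpa using H

/-- Replace the contents of `A`, whose visited cells are marked on `mk`, by those of `src`. -/
def refresh (A mk src : Ix s r κ) : Frag s r κ σ :=
  (tri A mk src fun a _ u => ((a, none), (some true, none), (u, none))).seq <|
  (rewind2 A mk src).seq <| (move3 A mk src .right none).seq <| (erase2 A mk src).seq <|
  (copy3 A mk src).seq <| (move3 A mk src .left (some .left)).seq <|
  (rewind3 A mk src).seq (move3 A mk src .right (some .right))

/-- The mark under the head may be missing, if the head has just arrived there; hence `hm` speaks of
`mk` after a mark has been written, which is what the first step does. Erasing all marked cells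
makes the result exactly `tapeOf u`, with no remains of earlier contents. -/
theorem runs_refresh (h : Distinct3 A mk src) (v : σ) (T : Tapes s r κ)
    {L R : List (Option Bool)} {u : List Bool} (hR : R ≠ []) (hA : T A = tp L R)
    (hm : (T mk).write (some true) = tp (marks L.length) (marks R.length))
    (hu : T src = OracleTM.tapeOf u) :
    (refresh A mk src).Runs φ (v, T) (4 * (L.length + R.length + u.length) + 16)
      (v, upd3 A mk src T (OracleTM.tapeOf u) (tp [] (marks u.length)) (OracleTM.tapeOf u)) := by
  obtain ⟨x, R, rfl⟩ := List.exists_cons_of_ne_nil hR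
  have h₁ : (tri A mk src fun a _ u => ((a, none), (some true, none), (u, none))).Runs φ (v, T) 1
      (v, upd3 A mk src T (tp L (x :: R)) (tp (marks L.length) (marks (x :: R).length))
        (tp [] (u.map some))) := by
    have := runs_tri (φ := φ) h (g := fun a _ u => ((a, none), (some true, none), (u, none)))
      v T (T A) (T mk) (T src) (a' := tp L (x :: R))
      (m' := tp (marks L.length) (marks (x :: R).length)) (u' := tp [] (u.map some))
      (by simp [OracleTM.actTape, hA])
      (by simpa [OracleTM.actTape] using hm)
      (by simp [OracleTM.actTape, hu, tapeOf_eq_tp])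
    rwa [upd3_self] at this
  have h₂ := runs_rewind2 (φ := φ) h v T L x R (tp [] (u.map some))
  have h₃ := runs_move3 (φ := φ) h .right none v T (tp [] (none :: (L.reverse ++ x :: R)))
    (tp [] (none :: marks (L.length + (x :: R).length))) (tp [] (u.map some))
  have h₄ := runs_erase2 (φ := φ) h v T (L.reverse ++ x :: R) (tp [] (u.map some))
  have h₅ := runs_copy3 (φ := φ) h v T [] u
  simp only [tp_move_right_cons, tp_none_left, Option.elim_none] at h₃
  rw [List.length_append, List.length_reverse] at h₄
  simp only [List.append_nil, List.length_nil, marks_zero, add_zero] at h₅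
  obtain ⟨K, hK⟩ : ∃ K, K = (u.map some).reverse := ⟨_, rfl⟩
  have hl : u.length = K.length := by simp [hK]
  have e : u.map some = K.reverse := by simp [hK]
  rw [tapeOf_eq_tp, hl, e]
  rw [← hK, hl] at h₅
  have h₆ := runs_move3 (φ := φ) h .left (some .left) v T (tp K []) (tp (marks K.length) [])
    (tp K [])
  have h₇ : ((rewind3 A mk src).seq (move3 A mk src .right (some .right))).Runs φ
      (v, upd3 A mk src T (Tape.move .left (tp K [])) (Tape.move .left (tp (marks K.length) []))
        (Tape.move .left (tp K []))) (2 * K.length + 3 + 1)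
      (v, upd3 A mk src T (tp [] K.reverse) (tp [] (marks K.length)) (tp [] K.reverse)) := by
    have h₈ := fun a m w => runs_move3 (φ := φ) h .right (some .right) v T a m w
    rcases K with _ | ⟨k, K⟩
    · have := (runs_loop3_exit h (φ := φ) (F := move3 A mk src .left (some .left))
        (b := fun m _ => m = some true) v T (tp [] []) (tp [] []) (tp [] []) (by simp)).seq
        (h₈ (tp [] []) (tp [] []) (tp [] []))
      simpa [rewind3] using this.mono (t' := 4) (by omega)
    · have := (runs_rewind3 (φ := φ) h v T K k []).seq (h₈ _ _ _)
      simp only [tp_move_right_cons, tp_none_left, Option.elim_some] at this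
      simpa [marks_succ] using this.mono (t' := 2 * (K.length + 1) + 3 + 1) (by omega)
  rw [e] at h₁ h₂ h₃ h₄ h₅
  refine (h₁.seq <| h₂.seq <| h₃.seq <| h₄.seq <| h₅.seq <| h₆.seq h₇).mono ?_
  simp only [List.length_cons]
  omega

end Refresh

/-! ### Running a machine inside a fragment -/

section Simulation

variable {s₀ r₀ : ℕ}

/-- How the machine `M` is run inside a fragment: the place `e` of its tapes, the place `ρ` of its
oracles, and two further tapes. A question to an oracle without a place is answered with the word
on the tape `src`; the visited cells of the answer tape `ans` of this oracle are marked on the tape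
`mk`. -/
structure Embedding (M : OracleTM s₀ r₀) (s r : ℕ) (κ : Type) where
  e : TapeIx s₀ r₀ M.w → Ix s r κ
  inj : Function.Injective e
  ρ : Fin r₀ → Option (Fin r)
  ans : TapeIx s₀ r₀ M.w
  mark : Ix s r κ
  src : Ix s r κ
  mark_ne : ∀ t, e t ≠ mark
  src_ne : ∀ t, e t ≠ src
  src_ne_mark : src ≠ mark
  query_eq : ∀ j i, ρ j = some i → e (.query j) = .query i
  answer_eq : ∀ j i, ρ j = some i → e (.answer j) = .answer i
  ans_eq : ∀ j, ρ j = none ↔ ans = .answer j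

variable {M : OracleTM s₀ r₀} (E : Embedding M s r κ)

namespace Embedding

/-- The instruction of the embedded machine. -/
def instr (q : M.Q) (c : Scan s r κ) : Instr M.Q s₀ r₀ M.w := M.δ q fun t => c (E.e t)

/-- The embedded machine has not halted. -/
def active (q : M.Q) (c : Scan s r κ) : Bool :=
  match E.instr q c with
  | .halt => false
  | _ => true

/-- The embedded machine asks an oracle without a place. -/
def asksSource (q : M.Q) (c : Scan s r κ) : Bool :=
  match E.instr q c with
  | .ask j _ => (E.ρ j).isNone
  | _ => false

/-- A step of the embedded machine, except for the new contents of the tape `ans`. -/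
noncomputable def stepFrag : Frag s r κ M.Q :=
  prim fun q c =>
    match E.instr q c with
    | .halt => (q, .idle c)
    | .ask j q' => (q', (E.ρ j).elim (.idle c) .inl)
    | .act q' a => (q', .inr fun t =>
        if t = E.mark then (some true, (a E.ans).2) else
          Function.extend E.e a (fun t => (c t, none)) t)

/-- Run the embedded machine. -/
noncomputable def run : Frag s r κ M.Q :=
  loop E.active
    (ite E.asksSource (E.stepFrag.seq (refresh (E.e E.ans) E.mark E.src)) E.stepFrag)

theorem distinct : Distinct3 (E.e E.ans) E.mark E.src :=
  ⟨(E.mark_ne _).symm, (E.src_ne _).symm, E.src_ne_mark⟩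

/-- The tapes hold the configuration `c` of the embedded machine; at most `B` cells of the tape
`ans` have been visited. -/
structure Inv (u : List Bool) (B : ℕ) (c : M.Cfg) (T : Tapes s r κ) : Prop where
  tape : ∀ t, T (E.e t) = c.tape t
  src : T E.src = OracleTM.tapeOf u
  visited : ∃ L R, R ≠ [] ∧ c.tape E.ans = tp L R ∧
    (T E.mark).write (some true) = tp (marks L.length) (marks R.length) ∧ L.length + R.length ≤ B

/-- The visited cells form an interval that contains the head (`R ≠ []`). A step lengthens it by at
most one cell, and only at an end; a mark tape that makes the same moves keeps in line with it. -/
theorem act_marks (w : Option Bool) (d : Option Dir) {L R : List (Option Bool)} (hR : R ≠ [])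
    {m : Tape (Option Bool)}
    (hm : m.write (some true) = tp (marks L.length) (marks R.length)) :
    ∃ L' R', R' ≠ [] ∧ OracleTM.actTape (w, d) (tp L R) = tp L' R' ∧
      (OracleTM.actTape (some true, d) m).write (some true) =
        tp (marks L'.length) (marks R'.length) ∧
      L'.length + R'.length ≤ L.length + R.length + 1 := by
  obtain ⟨x, R, rfl⟩ := List.exists_cons_of_ne_nil hR
  rcases d with _ | d
  · exact ⟨L, w :: R, by simp, by simp [OracleTM.actTape],
      by simp [OracleTM.actTape, hm, marks_succ], by simp⟩
  cases d with
  | left =>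
    rcases L with _ | ⟨y, L⟩
    · exact ⟨[], none :: w :: R, by simp, by simp [OracleTM.actTape],
        by simp [OracleTM.actTape, hm, marks_succ], by simp⟩
    · exact ⟨L, y :: w :: R, by simp, by simp [OracleTM.actTape],
        by simp [OracleTM.actTape, hm, marks_succ], by simp; omega⟩
  | right =>
    rcases R with _ | ⟨y, R⟩
    · exact ⟨w :: L, [none], by simp, by simp [OracleTM.actTape],
        by simp [OracleTM.actTape, hm, marks_succ], by simp⟩
    · exact ⟨w :: L, y :: R, by simp, by simp [OracleTM.actTape],
        by simp [OracleTM.actTape, hm, marks_succ], by simp; omega⟩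

theorem instr_eq {u : List Bool} {B : ℕ} {c : M.Cfg} {T : Tapes s r κ} (h : E.Inv u B c T) :
    (E.instr c.state fun t => (T t).head) = M.instr c := by
  simp only [instr, OracleTM.instr, h.tape]

variable {φ₀ : Fin r₀ → ℕ → Dyadic} {u : List Bool}

/-- The body of the loop carries out a step. -/
theorem runs_body (hφ : ∀ j i, E.ρ j = some i → φ₀ j = φ i)
    (hu : ∀ j, E.ρ j = none → ∀ n, word (φ₀ j n) = u) {B : ℕ} {c : M.Cfg} {T : Tapes s r κ}
    (h : E.Inv u B c T) (hB : u.length ≤ B) (hc : M.instr c ≠ .halt) :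
    ∃ T', (ite E.asksSource (E.stepFrag.seq (refresh (E.e E.ans) E.mark E.src)) E.stepFrag).Runs φ
      (c.state, T) (8 * B + 20) ((M.step φ₀ c).state, T') ∧ E.Inv u (B + 1) (M.step φ₀ c) T' := by
  have hi := E.instr_eq h
  obtain ⟨L, R, hR, hA, hm, hl⟩ := h.visited
  have hp := runs_prim (φ := φ) (fun (q : M.Q) c =>
    match E.instr q c with
    | .halt => (q, .idle c)
    | .ask j q' => (q', (E.ρ j).elim (.idle c) .inl)
    | .act q' a => (q', (.inr fun t =>
        if t = E.mark then (some true, (a E.ans).2) else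
          Function.extend E.e a (fun t => (c t, none)) t : Deed s r κ))) c.state T
  rw [hi] at hp
  rcases hx : M.instr c with _ | ⟨j, q⟩ | ⟨q, a⟩
  · exact absurd hx hc
  · rw [hx] at hp hi
    have hs : M.step φ₀ c = ⟨q, Function.update c.tape (.answer j)
        (OracleTM.tapeOf (word (φ₀ j (OracleTM.readUnary (c.tape (.query j))))))⟩ := by
      rw [OracleTM.step, hx]
    rcases hj : E.ρ j with _ | i
    -- All answers of an oracle without a place are the same word `u`, so the question itself is not
    -- read: only the state changes, and `refresh` then installs `u`.
    · simp only [hj, Option.elim_none, effect_idle] at hp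
      have ha : E.ans = .answer j := (E.ans_eq j).1 hj
      have hb : E.asksSource c.state (fun t => (T t).head) = true := by
        simp [asksSource, hi, hj]
      have H := (runs_ite_true (G := E.stepFrag) hb (hp.seq (runs_refresh E.distinct q T hR
        ((h.tape _).trans hA) hm h.src))).mono (t' := 8 * B + 20) (by omega)
      rw [hs]
      refine ⟨_, H, ?_⟩
      refine ⟨fun t => ?_, ?_, ?_⟩
      · by_cases ht : t = .answer j
        · subst ht
          simp [upd3, ha, hu j hj]
        · have : E.e t ≠ E.e E.ans := fun he => ht ((E.inj he).trans ha)
          simp [upd3, this, E.mark_ne, E.src_ne, Function.update_of_ne ht, h.tape]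
      · simp [upd3, (E.src_ne _).symm, E.src_ne_mark]
      -- The padding matters only for `u = []`: the cell under the head counts as visited, so the
      -- right part must have at least one cell.
      · refine ⟨[], (u.map some) ++ List.replicate (1 - u.length) none, ?_, ?_, ?_, ?_⟩
        · cases u <;> simp
        · rw [tp_append_right, ha]
          simp [hu j hj, tapeOf_eq_tp]
        · cases u <;> simp [upd3, (E.mark_ne _).symm, marks_succ]
        · cases u
          · simp
          · simpa using hB.trans (Nat.le_succ B)
    · simp only [hj, Option.elim_some] at hp
      have ha : E.ans ≠ .answer j := fun h => by simp [(E.ans_eq j).2 h] at hj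
      have hb : E.asksSource c.state (fun t => (T t).head) = false := by
        simp [asksSource, hi, hj]
      have H := (runs_ite_false (F := E.stepFrag.seq (refresh (E.e E.ans) E.mark E.src)) hb hp).mono
        (t' := 8 * B + 20) (by omega)
      rw [hs]
      refine ⟨_, H, ?_⟩
      have hne : ∀ t, (∀ t', E.e t' ≠ t) → t ≠ .answer i := fun t ht h' =>
        ht (.answer j) ((E.answer_eq j i hj).trans h'.symm)
      refine ⟨fun t => ?_, ?_, L, R, hR, ?_, ?_, by omega⟩
      · by_cases ht : t = .answer j
        · subst ht
          simp [Deed.effect, E.answer_eq j i hj, ← E.query_eq j i hj, h.tape, hφ j i hj]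
        · have : E.e t ≠ .answer i := fun he =>
            ht (E.inj (he.trans (E.answer_eq j i hj).symm))
          simp [Deed.effect, Function.update_of_ne ht, Function.update_of_ne this, h.tape]
      · simpa [Deed.effect, Function.update_of_ne (hne _ E.src_ne)] using h.src
      · simpa [Function.update_of_ne ha] using hA
      · simpa [Deed.effect, Function.update_of_ne (hne _ E.mark_ne)] using hm
  · rw [hx] at hp hi
    have hs : M.step φ₀ c = ⟨q, fun t => OracleTM.actTape (a t) (c.tape t)⟩ := by
      rw [OracleTM.step, hx]
    have hb : E.asksSource c.state (fun t => (T t).head) = false := by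
      simp [asksSource, hi]
    have H := (runs_ite_false (F := E.stepFrag.seq (refresh (E.e E.ans) E.mark E.src)) hb hp).mono
      (t' := 8 * B + 20) (by omega)
    rw [hs]
    refine ⟨_, H, ?_⟩
    refine ⟨fun t => ?_, ?_, ?_⟩
    · simp [Deed.effect, E.mark_ne, E.inj.extend_apply, h.tape]
    · have : ¬ ∃ t, E.e t = E.src := fun ⟨t, ht⟩ => E.src_ne t ht
      simp [Deed.effect, E.src_ne_mark, Function.extend_apply' _ _ _ this, OracleTM.actTape, h.src]
    · obtain ⟨L', R', hR', h₁, h₂, h₃⟩ := act_marks (a E.ans).1 (a E.ans).2 hR hm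
      refine ⟨L', R', hR', ?_, ?_, by omega⟩
      · simpa [hA] using h₁
      · simpa [Deed.effect] using h₂

/-- The visited part of `ans` grows by at most one cell per simulated step, so `K` bounds it
throughout the run. Each round then costs at most `8 * K + 20` steps and one for the loop test. -/
theorem runs_run (hφ : ∀ j i, E.ρ j = some i → φ₀ j = φ i)
    (hu : ∀ j, E.ρ j = none → ∀ n, word (φ₀ j n) = u) {B K : ℕ} (t : ℕ) {c : M.Cfg}
    {T : Tapes s r κ} (h : E.Inv u B c T) (hB : u.length ≤ B) (hK : B + t ≤ K)
    (hc : M.instr ((M.step φ₀)^[t] c) = .halt) :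
    ∃ q T', E.run.Runs φ (c.state, T) (t * (8 * K + 21) + 1) (q, T') ∧
      ∀ t', T' (E.e t') = ((M.step φ₀)^[t] c).tape t' := by
  induction t generalizing B c T with
  | zero =>
    refine ⟨c.state, T, (runs_loop_exit ?_).mono (by omega), h.tape⟩
    rw [active, E.instr_eq h]
    simp only [Function.iterate_zero, id_eq] at hc
    rw [hc]
  | succ t ih =>
    by_cases hx : M.instr c = .halt
    · have hs : (M.step φ₀)^[t + 1] c = c :=
        Function.iterate_fixed (by rw [OracleTM.step, hx]) _
      refine ⟨c.state, T, (runs_loop_exit ?_).mono (by omega), by rw [hs]; exact h.tape⟩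
      rw [active, E.instr_eq h, hx]
    · obtain ⟨T₁, h₁, i₁⟩ := E.runs_body hφ hu h hB hx
      rw [Function.iterate_succ_apply] at hc ⊢
      obtain ⟨q, T₂, h₂, i₂⟩ := ih i₁ (by omega) (by omega) hc
      refine ⟨q, T₂, (runs_loop_step ?_ h₁ h₂).mono ?_, i₂⟩
      · rw [active, E.instr_eq h]
        cases hi : M.instr c <;> simp_all
      · have : 1 + (8 * B + 20) + (t * (8 * K + 21) + 1) ≤ (t + 1) * (8 * K + 21) + 1 := by
          rw [add_mul]; omega
        exact this

/-- An embedded machine yields its output. -/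
theorem runs_outputs (hφ : ∀ j i, E.ρ j = some i → φ₀ j = φ i)
    (hu : ∀ j, E.ρ j = none → ∀ n, word (φ₀ j n) = u) {t : ℕ} {args : Fin s₀ → List Bool}
    {v : List Bool} (hM : M.OutputsWithin φ₀ args t v) {T : Tapes s r κ}
    (hT : ∀ t', T (E.e t') = (M.init args).tape t') (hsrc : T E.src = OracleTM.tapeOf u)
    (hmk : T E.mark = OracleTM.tapeOf []) (hans : ∀ i, E.ans ≠ .input i) :
    ∃ q T', E.run.Runs φ (M.start, T) (t * (8 * (u.length + t + 1) + 21) + 1) (q, T') ∧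
      OracleTM.Holds (T' (E.e .output)) v := by
  have hi : E.Inv u (u.length + 1) (M.init args) T := by
    refine ⟨hT, hsrc, [], [none], by simp, ?_, ?_, by simp⟩
    · have : (M.init args).tape E.ans = OracleTM.tapeOf [] := by
        rcases hx : E.ans with i | _ | _ | _ | _
        · exact absurd hx (hans i)
        all_goals rfl
      simp [this, tapeOf_eq_tp]
    · simp [hmk, tapeOf_eq_tp, marks_succ]
  obtain ⟨q, T', h₁, h₂⟩ := E.runs_run hφ hu t hi (by omega) (K := u.length + t + 1)
    (by omega) hM.1
  exact ⟨q, T', h₁, by rw [h₂]; exact hM.2⟩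

end Embedding

end Simulation

end Frag


/-! ### Binary digits -/

/-- The number with the given binary digits, least significant first. -/
def val : List Bool → ℕ
  | [] => 0
  | b :: l => b.toNat + 2 * val l

@[simp] theorem val_nil : val [] = 0 := rfl

@[simp] theorem val_cons (b : Bool) (l : List Bool) : val (b :: l) = b.toNat + 2 * val l := rfl

theorem val_lt (l : List Bool) : val l < 2 ^ l.length := by
  induction l with
  | nil => simp
  | cons b l ih => cases b <;> simp [pow_succ] <;> omega

theorem val_append (l m : List Bool) : val (l ++ m) = val l + 2 ^ l.length * val m := by
  induction l with
  | nil => simp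
  | cons b l ih => simp [ih, pow_succ]; ring

theorem testBit_val (l : List Bool) (i : ℕ) : (val l).testBit i = l[i]?.getD false := by
  induction l generalizing i with
  | nil => simp
  | cons b l ih =>
    have h : val (b :: l) = Nat.bit b (val l) := by cases b <;> simp [Nat.bit]; omega
    cases i with
    | zero => rw [h, Nat.testBit_bit_zero]; simp
    | succ i => rw [h, Nat.testBit_bit_succ, ih]; simp

theorem val_bits (n : ℕ) : val n.bits = n := by
  induction n using Nat.binaryRec' with
  | zero => simp
  | bit b n h ih =>
    rw [Nat.bits_append_bit n b h, val_cons, ih]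
    cases b <;> simp [Nat.bit]; omega

/-- The word in which every bit is doubled. -/
def dbl (l : List Bool) : List Bool := l.flatMap fun b => [b, b]

@[simp] theorem dbl_nil : dbl [] = [] := rfl

@[simp] theorem dbl_cons (b : Bool) (l : List Bool) : dbl (b :: l) = b :: b :: dbl l := rfl

theorem length_dbl (l : List Bool) : (dbl l).length = 2 * l.length := by
  induction l with
  | nil => rfl
  | cons b l ih => simp [ih]; ring

theorem dbl_append (l m : List Bool) : dbl (l ++ m) = dbl l ++ dbl m := by simp [dbl]

/-- The digits of a natural number, most significant first. -/
def intBits (n : ℕ) : List Bool := if n = 0 then [false] else n.bits.reverse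

theorem intBits_ne_nil (n : ℕ) : intBits n ≠ [] := by
  unfold intBits
  split_ifs with h
  · simp
  · intro h'
    have := val_bits n
    rw [List.reverse_eq_nil_iff.1 h'] at this
    exact h this.symm

theorem val_reverse_intBits (n : ℕ) : val (intBits n).reverse = n := by
  unfold intBits
  split_ifs with h
  · simp [h]
  · simp [val_bits]

theorem bits_val (l : List Bool) (h : l.getLast? = some true) : (val l).bits = l := by
  induction l with
  | nil => simp at h
  | cons b l ih =>
    have hb : val (b :: l) = Nat.bit b (val l) := by cases b <;> simp [Nat.bit]; omega
    cases l with
    | nil =>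
      have : b = true := by simpa using h
      subst this
      simp
    | cons c l =>
      have ih := ih (by simpa using h)
      rw [hb, Nat.bits_append_bit, ih]
      intro h0
      rw [h0] at ih
      simp at ih

/-- The digits of a number without its leading zeros. -/
theorem intBits_val (l : List Bool) : intBits (val l) =
    if l.reverse.dropWhile (! ·) = [] then [false] else l.reverse.dropWhile (! ·) := by
  induction l using List.reverseRecOn with
  | nil => simp [intBits]
  | append_singleton l b ih =>
    cases b with
    | false => simpa [val_append] using ih
    | true =>
      have h : val (l ++ [true]) ≠ 0 := by simp [val_append]
      rw [intBits, if_neg h, bits_val _ (by simp)]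
      simp

/-- The `q` lowest digits of a number, most significant first. -/
def fracBits (q A : ℕ) : List Bool := (List.range q).map fun i => A.testBit (q - 1 - i)

@[simp] theorem fracBits_zero (A : ℕ) : fracBits 0 A = [] := rfl

theorem fracBits_succ (q A : ℕ) : fracBits (q + 1) A = A.testBit q :: fracBits q A := by
  simp only [fracBits, List.range_succ_eq_map, List.map_cons, List.map_map]
  congr 1
  apply List.map_congr_left
  intro i _
  simp only [Function.comp]
  congr 1
  omega

theorem fracBits_val (l h : List Bool) : fracBits l.length (val (l ++ h)) = l.reverse := by
  apply List.ext_getElem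
  · simp [fracBits]
  · intro i h₁ h₂
    have hi : i < l.length := by simpa using h₂
    have : l.length - 1 - i < l.length := by omega
    simp [fracBits, testBit_val, List.getElem?_append_left this, this]

/-! ### The word of a dyadic number -/

/-- The numerator of the absolute value. -/
def absNum (d : Dyadic) : ℕ := d.toRat.num.natAbs

/-- The number of fractional digits. -/
def fracLen (d : Dyadic) : ℕ := Nat.log 2 d.toRat.den

/-- The reduced denominator divides the power of two in the given representation, and the divisors
of a power of two are powers of two. -/
theorem den_eq (d : Dyadic) : d.toRat.den = 2 ^ fracLen d := by
  have : ∃ q, d.toRat.den = 2 ^ q := by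
    cases d with
    | zero => exact ⟨0, rfl⟩
    | ofOdd n k hn =>
      rw [Dyadic.toRat_ofOdd_eq_mkRat, Nat.one_shiftLeft]
      have h := Rat.den_dvd (n <<< (-k).toNat) ((2 ^ k.toNat : ℕ) : ℤ)
      rw [← Rat.mkRat_eq_divInt, Int.natCast_dvd_natCast, Nat.dvd_prime_pow Nat.prime_two] at h
      obtain ⟨q, -, hq⟩ := h
      exact ⟨q, hq⟩
  obtain ⟨q, hq⟩ := this
  rw [fracLen, hq, Nat.log_pow (by norm_num)]

theorem den_eq_one_iff (d : Dyadic) : d.toRat.den = 1 ↔ fracLen d = 0 := by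
  rw [den_eq]
  simp

/-- The end of the word of a number with the given fractional digits. -/
def fracWord (l : List Bool) : List Bool := if l = [] then [] else true :: false :: dbl l

/-- The beginning of the word of a number with the given sign. -/
def signWord (neg : Bool) : List Bool := if neg then [false, true] else []

theorem flatMap_code_map_ofBit (l : List Bool) :
    (l.map DSym.ofBit).flatMap DSym.code = dbl l := by
  induction l with
  | nil => rfl
  | cons b l ih => cases b <;> simp [DSym.ofBit, DSym.code, ih]

/-- In this form every digit is a pair of equal bits, whereas the sign and the point are pairs of
unequal bits. The fractional digits may be taken from the whole numerator, because reduction modulo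
`2 ^ fracLen d` does not affect its lowest `fracLen d` bits. -/
theorem word_eq (d : Dyadic) : word d = signWord (d.toRat.num < 0) ++
    (dbl (intBits (absNum d / 2 ^ fracLen d)) ++ fracWord (fracBits (fracLen d) (absNum d))) := by
  have h₁ : (intDigits (absNum d / 2 ^ fracLen d)).flatMap DSym.code =
      dbl (intBits (absNum d / 2 ^ fracLen d)) := by
    rw [← flatMap_code_map_ofBit]
    unfold intDigits intBits
    split_ifs <;> simp [DSym.ofBit]
  have h₂ : fracDigits (fracLen d) (absNum d % 2 ^ fracLen d) =
      (fracBits (fracLen d) (absNum d)).map DSym.ofBit := by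
    simp only [fracDigits, fracBits, List.map_map]
    apply List.map_congr_left
    intro i hi
    have : fracLen d - 1 - i < fracLen d := by have := List.mem_range.1 hi; omega
    simp [Nat.testBit_mod_two_pow, this]
  rw [word, expansion, List.flatMap_append, List.flatMap_append, List.append_assoc]
  congr 1
  · by_cases h : d.toRat.num < 0 <;> simp [signWord, h, DSym.code]
  · congr 1
    · rw [den_eq]
      exact h₁
    · by_cases h : fracLen d = 0
      · simp [(den_eq_one_iff d).2 h, h, fracWord]
      · rw [if_neg (fun h' => h ((den_eq_one_iff d).1 h')), fracWord, if_neg]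
        · rw [List.flatMap_cons, ← flatMap_code_map_ofBit, ← h₂, ← fracLen, ← den_eq]
          rfl
        · simpa [fracBits] using h

/-- The pair `10` of the point has unequal bits and cannot be mistaken for a digit, so it shows
where the integer part ends. -/
theorem dbl_append_inj {l l' m m' : List Bool}
    (h : dbl l ++ fracWord m = dbl l' ++ fracWord m') : l = l' ∧ fracWord m = fracWord m' := by
  induction l generalizing l' with
  | nil =>
    cases l' with
    | nil => exact ⟨rfl, h⟩
    | cons b l' => unfold fracWord at h; split_ifs at h <;> simp at h <;> grind
  | cons b l ih =>
    cases l' with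
    | nil => unfold fracWord at h; split_ifs at h <;> simp at h <;> grind
    | cons b' l' =>
      simp only [dbl_cons, List.cons_append, List.cons.injEq] at h
      obtain ⟨rfl, h₂⟩ := ih h.2.2
      exact ⟨by rw [h.1], h₂⟩

theorem dbl_injective : Function.Injective dbl := fun l l' h =>
  (dbl_append_inj (m := []) (m' := []) (by simpa using h)).1

/-- This turns equal output words of two runs into equal dyadic numbers. The integer part is never
empty, so the first pair is `01` exactly for negative numbers; the high bits of the numerator come
from the integer part, the low ones from the fractional part. -/
theorem word_injective : Function.Injective word := by
  intro d d' h
  rw [word_eq, word_eq] at h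
  obtain ⟨b, l, hb⟩ := List.exists_cons_of_ne_nil (intBits_ne_nil (absNum d / 2 ^ fracLen d))
  obtain ⟨b', l', hb'⟩ := List.exists_cons_of_ne_nil (intBits_ne_nil (absNum d' / 2 ^ fracLen d'))
  have hs : d.toRat.num < 0 ↔ d'.toRat.num < 0 := by
    rw [hb, hb'] at h
    by_cases h₁ : d.toRat.num < 0 <;> by_cases h₂ : d'.toRat.num < 0 <;>
      simp [signWord, h₁, h₂] at h ⊢ <;> grind
  rw [decide_eq_decide.2 hs] at h
  obtain ⟨h₁, h₂⟩ := dbl_append_inj (List.append_cancel_left h)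
  have h₃ : fracBits (fracLen d) (absNum d) = fracBits (fracLen d') (absNum d') := by
    unfold fracWord at h₂
    split_ifs at h₂ with h₃ h₄ h₄
    · rw [h₃, h₄]
    · simp only [List.cons.injEq, true_and] at h₂
      exact dbl_injective h₂
  have hq : fracLen d = fracLen d' := by simpa [fracBits] using congrArg List.length h₃
  have hA : absNum d / 2 ^ fracLen d = absNum d' / 2 ^ fracLen d := by
    have := congrArg (fun l => val l.reverse) h₁
    simpa [val_reverse_intBits, hq] using this
  have hA' : absNum d = absNum d' := by
    apply Nat.eq_of_testBit_eq
    intro i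
    by_cases hi : i < fracLen d
    · rw [← hq] at h₃
      have := congrArg (fun l => l[fracLen d - 1 - i]?) h₃
      have hi' : fracLen d - 1 - i < fracLen d := by omega
      have e : fracLen d - 1 - (fracLen d - 1 - i) = i := by omega
      simpa [fracBits, hi', e] using this
    · have := congrArg (fun n => n.testBit (i - fracLen d)) hA
      simpa [Nat.testBit_div_two_pow, Nat.sub_add_cancel (not_lt.1 hi)] using this
  apply Dyadic.toRat_inj.1
  apply Rat.ext
  · unfold absNum at hA'
    omega
  · rw [den_eq, den_eq, hq]

theorem toReal_eq (d : Dyadic) : toReal d = (d.toRat.num : ℝ) / 2 ^ fracLen d := by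
  rw [toReal, Rat.cast_def, den_eq]
  simp

theorem abs_toReal (d : Dyadic) : |toReal d| = (absNum d : ℝ) / 2 ^ fracLen d := by
  rw [toReal_eq, abs_div, abs_of_pos (by positivity : (0 : ℝ) < 2 ^ fracLen d), absNum,
    Nat.cast_natAbs, Int.cast_abs]

theorem toReal_neg_iff (d : Dyadic) : toReal d < 0 ↔ d.toRat.num < 0 := by
  rw [toReal_eq, div_neg_iff]
  have : (0 : ℝ) < 2 ^ fracLen d := by positivity
  constructor
  · rintro (h | h)
    · linarith
    · exact_mod_cast h.1
  · intro h
    exact Or.inr ⟨by exact_mod_cast h, this⟩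

theorem abs_toReal_lt (d : Dyadic) :
    |toReal d| < 2 ^ (intBits (absNum d / 2 ^ fracLen d)).length := by
  have h := val_lt (intBits (absNum d / 2 ^ fracLen d)).reverse
  rw [val_reverse_intBits, List.length_reverse, Nat.div_lt_iff_lt_mul (by positivity)] at h
  rw [abs_toReal, div_lt_iff₀ (by positivity)]
  exact_mod_cast h

theorem abs_toReal_lt_len (d : Dyadic) : |toReal d| < 2 ^ len d := by
  refine (abs_toReal_lt d).trans_le (pow_le_pow_right₀ (by norm_num) ?_)
  rw [len, word_eq]
  simp only [List.length_append, length_dbl]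
  omega

theorem length_intBits_le (n k : ℕ) (h : n < 2 ^ k) : (intBits n).length ≤ k + 1 := by
  unfold intBits
  split_ifs with h0
  · simp
  · rw [List.length_reverse, Nat.size_eq_bits_len]
    exact (Nat.size_le.2 h).trans (Nat.le_succ k)

/-! ### Truncation, and words of fractions that need not be in lowest terms -/

/-- The first `j` digits of a list, which is continued by zeros. -/
def padTo : ℕ → List Bool → List Bool
  | 0, _ => []
  | j + 1, [] => false :: padTo j []
  | j + 1, b :: l => b :: padTo j l

theorem length_padTo (j : ℕ) (l : List Bool) : (padTo j l).length = j := by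
  induction j generalizing l with
  | zero => rfl
  | succ j ih => cases l <;> simp [padTo, ih]

/-- Truncation after `j` fractional digits. -/
theorem val_padTo (j q A : ℕ) (D : List Bool) (hD : val D = A / 2 ^ q) :
    val ((padTo j (fracBits q A)).reverse ++ D) = A * 2 ^ j / 2 ^ q := by
  -- Each step moves the leading fractional digit, or a zero if none is left, to the lowest place of
  -- the integer part `D`; this is why `D` is general.
  induction j generalizing q A D with
  | zero => simpa [padTo] using hD
  | succ j ih =>
    cases q with
    | zero =>
      have := ih 0 (2 * A) (false :: D) (by simpa using hD)
      simp only [fracBits_zero, padTo, List.reverse_cons, List.append_assoc] at this ⊢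
      rw [List.singleton_append, this]
      simp [pow_succ]
      ring
    | succ q =>
      rw [fracBits_succ]
      simp only [padTo, List.reverse_cons, List.append_assoc]
      rw [List.singleton_append, ih q A]
      · rw [pow_succ, pow_succ, ← mul_assoc, Nat.mul_div_mul_right _ _ (by norm_num)]
      · rw [val_cons, hD, Nat.toNat_testBit, pow_succ, ← Nat.div_div_eq_div_mul]
        omega

/-- The word of the number with numerator `± val (l ++ h)` and denominator `2 ^ l.length`. -/
theorem word_eq_of_toRat (neg : Bool) (l h : List Bool) (d : Dyadic)
    (hn : neg = true → val (l ++ h) ≠ 0)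
    (hd : d.toRat = (if neg then -1 else 1) * (val (l ++ h) : ℚ) / 2 ^ l.length) :
    word d = signWord neg ++ (dbl (intBits (val h)) ++ fracWord (l.dropWhile (! ·)).reverse) := by
  -- If there are no fractional digits or the lowest one is `1`, the numerator is coprime to the
  -- power of two, so numerator and denominator can be read off.
  have key : ∀ l' : List Bool, (l' = [] ∨ ∃ m, l' = true :: m) →
      (neg = true → val (l' ++ h) ≠ 0) →
      d.toRat = (if neg then -1 else 1) * (val (l' ++ h) : ℚ) / 2 ^ l'.length →
      word d = signWord neg ++ (dbl (intBits (val h)) ++ fracWord l'.reverse) := by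
    intro l' hl' hn hd
    obtain ⟨z, hz⟩ : ∃ z : ℤ, z = (if neg then -1 else 1) * (val (l' ++ h) : ℤ) := ⟨_, rfl⟩
    have hza : z.natAbs = val (l' ++ h) := by rw [hz]; cases neg <;> simp
    have hd' : d.toRat = (z : ℚ) / ((2 ^ l'.length : ℤ) : ℚ) := by
      rw [hd, hz]
      cases neg <;> simp
    have hc : z.natAbs.Coprime (2 ^ l'.length : ℤ).natAbs := by
      rw [hza]
      rcases hl' with rfl | ⟨m, rfl⟩
      · simp
      · rw [Int.natAbs_pow]
        apply Nat.Coprime.pow_right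
        rw [show (2 : ℤ).natAbs = 2 from rfl, Nat.coprime_two_right]
        simp
    have hpos : (0 : ℤ) < 2 ^ l'.length := by positivity
    have hnum : d.toRat.num = z := by rw [hd']; exact Rat.num_div_eq_of_coprime hpos hc
    have hden : (d.toRat.den : ℤ) = 2 ^ l'.length := by
      rw [hd']; exact Rat.den_div_eq_of_coprime hpos hc
    have hq : fracLen d = l'.length := by
      rw [den_eq] at hden
      exact Nat.pow_right_injective le_rfl (by exact_mod_cast hden)
    have hA : absNum d = val (l' ++ h) := by rw [absNum, hnum, hza]
    have hneg : decide (d.toRat.num < 0) = neg := by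
      rw [hnum, hz]
      cases neg with
      | false => simp
      | true => have := hn rfl; simp; omega
    rw [word_eq, hneg, hq, hA, fracBits_val, val_append, Nat.add_mul_div_left _ _ (by positivity),
      Nat.div_eq_of_lt (val_lt l'), zero_add]
  induction l with
  | nil => simpa using key [] (Or.inl rfl) hn hd
  | cons b l ih =>
    cases b with
    | true => simpa using key (true :: l) (Or.inr ⟨l, rfl⟩) hn hd
    -- A trailing zero cancels against one factor of two in the denominator.
    | false =>
      have := ih (fun h' => by simpa using hn h') (by
        rw [hd]
        simp only [List.cons_append, val_cons, List.length_cons, pow_succ]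
        push_cast
        simp
        field_simp
        split_ifs <;> ring)
      simpa using this


open Turing

namespace Frag

set_option linter.unusedSectionVars false

variable {s r : ℕ} {κ σ : Type} [DecidableEq κ] {φ : Fin r → ℕ → Dyadic}

/-! ### Tapes as stacks -/

/-- Tapes that hold words, with the heads on the first symbols: stacks. -/
def store (S : Ix s r κ → List Bool) : Tapes s r κ := fun t => OracleTM.tapeOf (S t)

/-- `Runs` for stacks. -/
def SRuns (F : Frag s r κ σ) (φ : Fin r → ℕ → Dyadic) (v : σ) (S : Ix s r κ → List Bool) (t : ℕ)
    (v' : σ) (S' : Ix s r κ → List Bool) : Prop :=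
  F.Runs φ (v, store S) t (v', store S')

theorem SRuns.seq {F G : Frag s r κ σ} {v v₁ v₂ : σ} {S S₁ S₂ : Ix s r κ → List Bool}
    {t₁ t₂ : ℕ} (hF : F.SRuns φ v S t₁ v₁ S₁) (hG : G.SRuns φ v₁ S₁ t₂ v₂ S₂) :
    (F.seq G).SRuns φ v S (t₁ + t₂) v₂ S₂ :=
  Runs.seq hF hG

theorem SRuns.mono {F : Frag s r κ σ} {v v' : σ} {S S' : Ix s r κ → List Bool} {t t' : ℕ}
    (h : F.SRuns φ v S t v' S') (ht : t ≤ t') : F.SRuns φ v S t' v' S' :=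
  Runs.mono h ht

/-- A step on one tape. -/
def onTape (t : Ix s r κ) (m : σ → Option Bool → σ)
    (g : σ → Option Bool → Option Bool × Option Dir) : Frag s r κ σ :=
  prim fun v c => (m v (c t), .inr fun t' => if t' = t then g v (c t) else (c t', none))

theorem runs_onTape (t : Ix s r κ) (m : σ → Option Bool → σ)
    (g : σ → Option Bool → Option Bool × Option Dir) (v : σ) (T : Tapes s r κ) :
    (onTape t m g).Runs φ (v, T) 1
      (m v (T t).head, Function.update T t (OracleTM.actTape (g v (T t).head) (T t))) := by
  have h := runs_prim (φ := φ) (fun (v : σ) (c : Scan s r κ) => (m v (c t),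
    (.inr fun t' => if t' = t then g v (c t) else (c t', none) : Deed s r κ))) v T
  convert h using 2
  congr 1
  funext t'
  by_cases ht : t' = t
  · subst ht
    simp [Deed.effect]
  · simp [Deed.effect, ht, OracleTM.actTape]

theorem store_update (S : Ix s r κ → List Bool) (t : Ix s r κ) (l : List Bool) :
    store (Function.update S t l) = Function.update (store S) t (OracleTM.tapeOf l) := by
  funext t'
  by_cases ht : t' = t
  · subst ht
    simp [store]
  · simp [store, ht]

theorem store_head (S : Ix s r κ → List Bool) (t : Ix s r κ) :
    (store S t).head = (S t).head? :=
  tapeOf_head _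

/-- Remove the top of a stack and take note of it. -/
def pop (t : Ix s r κ) (m : σ → Option Bool → σ) : Frag s r κ σ :=
  onTape t m fun _ _ => (none, some .right)

/-- Since the cell is erased before the head moves on, only blanks remain to its left and the tape
is again that of a word. -/
theorem sruns_pop (t : Ix s r κ) (m : σ → Option Bool → σ) (v : σ) (S : Ix s r κ → List Bool) :
    (pop t m).SRuns φ v S 1 (m v (S t).head?) (Function.update S t (S t).tail) := by
  have h := runs_onTape (φ := φ) t m (fun _ _ => (none, some .right)) v (store S)
  rw [store_head] at h
  have e : OracleTM.actTape (none, some .right) (store S t) = OracleTM.tapeOf (S t).tail := by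
    cases hS : S t <;> simp [store, hS, tapeOf_eq_tp, OracleTM.actTape]
  rw [e, ← store_update] at h
  exact h

/-- Put a bit on a stack. -/
def push (t : Ix s r κ) (b : σ → Bool) : Frag s r κ σ :=
  (onTape t (fun v _ => v) fun _ x => (x, some .left)).seq
    (onTape t (fun v _ => v) fun v _ => (some (b v), none))

theorem sruns_push (t : Ix s r κ) (b : σ → Bool) (v : σ) (S : Ix s r κ → List Bool) :
    (push t b).SRuns φ v S 2 v (Function.update S t (b v :: S t)) := by
  have h := (runs_onTape (φ := φ) t (fun v _ => v) (fun _ x => (x, some .left)) v (store S)).seq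
    (runs_onTape t (fun v _ => v) (fun v _ => (some (b v), none)) v _)
  rw [Function.update_idem, Function.update_self] at h
  have e : OracleTM.actTape (some (b v), none) (OracleTM.actTape ((store S t).head, some .left)
      (store S t)) = OracleTM.tapeOf (b v :: S t) := by
    simp [store, tapeOf_eq_tp, OracleTM.actTape]
  rw [e, ← store_update] at h
  exact h

/-- Change the memory. -/
def mem (m : σ → σ) : Frag s r κ σ := prim fun v c => (m v, .idle c)

theorem sruns_mem (m : σ → σ) (v : σ) (S : Ix s r κ → List Bool) :
    (mem m).SRuns φ v S 1 (m v) S := by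
  have h := runs_prim (φ := φ) (fun (v : σ) (c : Scan s r κ) => (m v, Deed.idle c)) v (store S)
  rwa [effect_idle] at h

/-- Ask an oracle. -/
def askOracle (j : Fin r) : Frag s r κ σ := prim fun v _ => (v, .inl j)

theorem sruns_askOracle (j : Fin r) (n : ℕ) (v : σ) (S : Ix s r κ → List Bool)
    (hS : S (.query j) = unary n) :
    (askOracle j).SRuns φ v S 1 v (Function.update S (.answer j) (word (φ j n))) := by
  have h := runs_prim (φ := φ) (fun (v : σ) (_ : Scan s r κ) => (v, (.inl j : Deed s r κ))) v
    (store S)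
  have e : Deed.effect φ (store S) (.inl j) =
      store (Function.update S (.answer j) (word (φ j n))) := by
    rw [store_update]
    simp [Deed.effect, store, hS, readUnary_unary]
  rw [e] at h
  exact h

/-- Repeat while the memory and the top of a stack satisfy a condition. -/
def loopTop (t : Ix s r κ) (b : σ → Option Bool → Bool) (F : Frag s r κ σ) : Frag s r κ σ :=
  loop (fun v c => b v (c t)) F

theorem sruns_loopTop_exit {t : Ix s r κ} {b : σ → Option Bool → Bool} {F : Frag s r κ σ} {v : σ}
    {S : Ix s r κ → List Bool} (hb : b v (S t).head? = false) :
    (loopTop t b F).SRuns φ v S 1 v S :=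
  runs_loop_exit (by simpa only [store_head] using hb)

theorem sruns_loopTop_step {t : Ix s r κ} {b : σ → Option Bool → Bool} {F : Frag s r κ σ}
    {v v₁ v₂ : σ} {S S₁ S₂ : Ix s r κ → List Bool} {t₁ t₂ : ℕ} (hb : b v (S t).head? = true)
    (hF : F.SRuns φ v S t₁ v₁ S₁) (hl : (loopTop t b F).SRuns φ v₁ S₁ t₂ v₂ S₂) :
    (loopTop t b F).SRuns φ v S (1 + t₁ + t₂) v₂ S₂ :=
  runs_loop_step (by simpa only [store_head] using hb) hF hl

/-- Branch according to the memory and the top of a stack. -/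
def iteTop (t : Ix s r κ) (b : σ → Option Bool → Bool) (F G : Frag s r κ σ) : Frag s r κ σ :=
  ite (fun v c => b v (c t)) F G

theorem sruns_iteTop_true {t : Ix s r κ} {b : σ → Option Bool → Bool} {F G : Frag s r κ σ}
    {v v₁ : σ} {S S₁ : Ix s r κ → List Bool} {t₁ : ℕ} (hb : b v (S t).head? = true)
    (hF : F.SRuns φ v S t₁ v₁ S₁) : (iteTop t b F G).SRuns φ v S (t₁ + 1) v₁ S₁ :=
  runs_ite_true (by simpa only [store_head] using hb) hF

theorem sruns_iteTop_false {t : Ix s r κ} {b : σ → Option Bool → Bool} {F G : Frag s r κ σ}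
    {v v₁ : σ} {S S₁ : Ix s r κ → List Bool} {t₁ : ℕ} (hb : b v (S t).head? = false)
    (hG : G.SRuns φ v S t₁ v₁ S₁) : (iteTop t b F G).SRuns φ v S (t₁ + 1) v₁ S₁ :=
  runs_ite_false (by simpa only [store_head] using hb) hG

/-- Put a fixed word on a stack. -/
def pushWord (t : Ix s r κ) : List Bool → Frag s r κ σ
  | [] => mem id
  | b :: u => (pushWord t u).seq (push t fun _ => b)

theorem sruns_pushWord (t : Ix s r κ) (u : List Bool) (v : σ) (S : Ix s r κ → List Bool) :
    (pushWord t u).SRuns φ v S (2 * u.length + 1) v (Function.update S t (u ++ S t)) := by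
  induction u with
  | nil => simpa [pushWord] using sruns_mem (φ := φ) id v S
  | cons b u ih =>
    refine ((ih.seq (sruns_push t (fun _ => b) v _)).mono (t' := 2 * (b :: u).length + 1)
      (by simp; omega)) |> fun H => ?_
    simpa [pushWord] using H

/-- The words on the tapes at the beginning. -/
def initStore (args : Fin s → List Bool) : Ix s r κ → List Bool
  | .input i => args i
  | _ => []

theorem initTapes_eq (args : Fin s → List Bool) :
    (initTapes args : Tapes s r κ) = store (initStore args) := by
  funext t
  cases t <;> rfl

end Frag

/-! ### Polynomial bounds -/

theorem mvPolynomial_eval_mono {ι : Type*} (p : MvPolynomial ι ℕ) {v w : ι → ℕ}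
    (h : ∀ i, v i ≤ w i) : MvPolynomial.eval v p ≤ MvPolynomial.eval w p := by
  induction p using MvPolynomial.induction_on with
  | C c => simp
  | add p q hp hq => simpa using add_le_add hp hq
  | mul_X p i hp => simpa using Nat.mul_le_mul hp (h i)

theorem eval₂_mono (p : MvPolynomial (Fin 2) ℕ) {k k' n n' : ℕ} (hk : k ≤ k') (hn : n ≤ n') :
    eval₂ p k n ≤ eval₂ p k' n' := by
  apply mvPolynomial_eval_mono
  intro i
  fin_cases i <;> simpa

theorem polynomial_eval_mono (p : Polynomial ℕ) {k k' : ℕ} (hk : k ≤ k') :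
    p.eval k ≤ p.eval k' := by
  induction p using Polynomial.induction_on' with
  | add p q hp hq => simpa using add_le_add hp hq
  | monomial n a => simpa using Nat.mul_le_mul_left a (Nat.pow_le_pow_left hk n)

/-- Together with monotonicity, this bounds a polynomial in `k` and `n` by a polynomial in one
quantity that dominates both, up to constants. -/
theorem exists_polynomial_diag (p : MvPolynomial (Fin 2) ℕ) (c c' : ℕ) :
    ∃ P : Polynomial ℕ, ∀ N, P.eval N = eval₂ p (N + c) (N + c') := by
  refine ⟨MvPolynomial.aeval ![Polynomial.X + Polynomial.C c, Polynomial.X + Polynomial.C c'] p,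
    fun N => ?_⟩
  unfold eval₂
  induction p using MvPolynomial.induction_on with
  | C c => simp
  | add p q hp hq => simp only [map_add, Polynomial.eval_add, hp, hq]
  | mul_X p i hp =>
    simp only [map_mul, Polynomial.eval_mul, hp, MvPolynomial.aeval_X, MvPolynomial.eval_X]
    fin_cases i <;> simp

theorem exists_mvPolynomial_sum (P : Polynomial ℕ) :
    ∃ p : MvPolynomial (Fin 2) ℕ, ∀ k n, eval₂ p k n = P.eval (k + n) := by
  refine ⟨Polynomial.aeval (MvPolynomial.X 0 + MvPolynomial.X 1) P, fun k n => ?_⟩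
  unfold eval₂
  induction P using Polynomial.induction_on' with
  | add p q hp hq => simp [hp, hq]
  | monomial n a => simp

theorem exists_mvPolynomial_shift (p : MvPolynomial (Fin 2) ℕ) (c : ℕ) :
    ∃ q : MvPolynomial (Fin 2) ℕ, ∀ k n, eval₂ q k n = eval₂ p k (n + c) + c := by
  refine ⟨MvPolynomial.aeval ![MvPolynomial.X 0, MvPolynomial.X 1 + MvPolynomial.C c] p +
    MvPolynomial.C c, fun k n => ?_⟩
  unfold eval₂
  rw [map_add, MvPolynomial.eval_C]
  congr 1
  induction p using MvPolynomial.induction_on with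
  | C c => simp
  | add p q hp hq => simp only [map_add, hp, hq]
  | mul_X p i hp =>
    simp only [map_mul, hp, MvPolynomial.aeval_X, MvPolynomial.eval_X]
    fin_cases i <;> simp

/-- A polynomial is dominated by a multiple of a power. -/
theorem exists_polynomial_le (P : Polynomial ℕ) : ∃ C D : ℕ, ∀ n, P.eval n ≤ C * (n + 1) ^ D := by
  induction P using Polynomial.induction_on' with
  | add p q hp hq =>
    obtain ⟨C, D, h⟩ := hp
    obtain ⟨C', D', h'⟩ := hq
    refine ⟨C + C', D + D', fun n => ?_⟩
    rw [Polynomial.eval_add, add_mul]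
    exact add_le_add
      ((h n).trans (Nat.mul_le_mul_left _ (Nat.pow_le_pow_right (by omega) (by omega))))
      ((h' n).trans (Nat.mul_le_mul_left _ (Nat.pow_le_pow_right (by omega) (by omega))))
  | monomial k a =>
    exact ⟨a, k, fun n => by
      simpa using Nat.mul_le_mul_left a (Nat.pow_le_pow_left (Nat.le_succ n) k)⟩


open Turing

instance {s r : ℕ} (M : OracleTM s r) : Fintype M.Q := M.fin

/-! ### Cauchy functions -/

theorem toReal_ofIntWithPrec (z : ℤ) (j : ℕ) :
    toReal (Dyadic.ofIntWithPrec z j) = z / 2 ^ j := by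
  rw [toReal, Dyadic.toRat_ofIntWithPrec_eq_mul_two_pow]
  push_cast
  rw [zpow_neg, zpow_natCast, div_eq_mul_inv]

theorem exists_dyadic_near (x : ℝ) (n : ℕ) :
    ∃ d : Dyadic, |x - toReal d| ≤ (2 : ℝ) ^ (-(n : ℤ)) := by
  refine ⟨Dyadic.ofIntWithPrec ⌊x * 2 ^ n⌋ n, ?_⟩
  have h : (0 : ℝ) < 2 ^ n := by positivity
  have e : x - ⌊x * 2 ^ n⌋ / 2 ^ n = Int.fract (x * 2 ^ n) / 2 ^ n := by
    rw [Int.fract]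
    field_simp
  rw [toReal_ofIntWithPrec, e, abs_of_nonneg (div_nonneg (Int.fract_nonneg _) h.le), zpow_neg,
    zpow_natCast, ← one_div]
  exact div_le_div_of_nonneg_right (Int.fract_lt_one _).le h.le

/-- This is what lets a dyadic number that is given as a word stand in for an oracle. -/
theorem const_mem_cauchyFun (d : Dyadic) : (fun _ => d) ∈ CauchyFun (toReal d) := fun n => by
  simp only [sub_self, abs_zero]
  positivity

theorem extension_le {a x : ℝ} {k : ℕ} (h : x ∈ Set.Icc a (a + 2 ^ k)) : extension a x ≤ k :=
  Nat.sInf_le h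

theorem mem_Icc_extension {a x : ℝ} (h : a ≤ x) : x ∈ Set.Icc a (a + 2 ^ extension a x) := by
  have hne : {j : ℕ | x ∈ Set.Icc a (a + 2 ^ j)}.Nonempty := by
    obtain ⟨j, hj⟩ := pow_unbounded_of_one_lt (x - a) (one_lt_two (α := ℝ))
    exact ⟨j, h, by linarith⟩
  exact Nat.sInf_mem hne

/-- The extension parameter of a dyadic number is at most its length plus a constant. -/
theorem exists_extension_le_len (a : ℝ) :
    ∃ c : ℕ, ∀ d : DyadicIci a, extension a (toReal d.1) ≤ len d.1 + c := by
  obtain ⟨c, hc⟩ := pow_unbounded_of_one_lt (|a| + 1) (one_lt_two (α := ℝ))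
  refine ⟨c, fun d => extension_le ⟨d.2, ?_⟩⟩
  have h₁ := (le_abs_self _).trans_lt (abs_toReal_lt_len d.1)
  have h₂ : (1 : ℝ) ≤ 2 ^ len d.1 := one_le_pow₀ (by norm_num)
  have h₃ := neg_abs_le a
  rw [pow_add]
  nlinarith [abs_nonneg a, mul_le_mul_of_nonneg_left hc.le (zero_le_one.trans h₂)]

/-! ### Machines ask short questions -/

namespace OracleTM

variable {s r : ℕ} {M : OracleTM s r} {φ φ' : Fin r → ℕ → Dyadic}

theorem readUnary_tp_le (L R : List (Option Bool)) : readUnary (tp L R) ≤ R.length :=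
  Nat.sInf_le (by
    show (tp L R).nth (R.length : ℤ) ≠ some true
    rw [tp_nth, List.getI_eq_default R le_rfl]
    exact (Option.some_ne_none true).symm)

/-- A unary question is no longer than the visited part of the query tape, which grows by at most
one cell per step. -/
theorem exists_span_query (args : Fin s → List Bool) (t : ℕ) (j : Fin r) :
    ∃ L R, R ≠ [] ∧ ((M.step φ)^[t] (M.init args)).tape (.query j) = tp L R ∧
      L.length + R.length ≤ t + 1 := by
  induction t with
  | zero => exact ⟨[], [none], by simp, by simp [init, tapeOf_eq_tp], by simp⟩
  | succ t ih =>
    obtain ⟨L, R, hR, h, hl⟩ := ih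
    rw [Function.iterate_succ_apply']
    generalize (M.step φ)^[t] (M.init args) = c at h ⊢
    unfold step
    split
    · exact ⟨L, R, hR, h, by omega⟩
    · exact ⟨L, R, hR, by simpa using h, by omega⟩
    · rename_i q a _
      obtain ⟨L', R', hR', h₁, -, h₂⟩ := Frag.Embedding.act_marks (a (.query j)).1
        (a (.query j)).2 (L := L) hR (m := tp (Frag.marks L.length) (Frag.marks R.length)) (by
          obtain ⟨x, R, rfl⟩ := List.exists_cons_of_ne_nil hR
          simp [Frag.marks_succ])
      exact ⟨L', R', hR', by simpa [h] using h₁, by omega⟩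

/-- A machine that runs for at most `T` steps does not notice what its oracles answer to questions
above `T`. -/
theorem iterate_step_congr (args : Fin s → List Bool) {T : ℕ}
    (h : ∀ j, ∀ i ≤ T, φ j i = φ' j i) {t : ℕ} (ht : t ≤ T) :
    (M.step φ)^[t] (M.init args) = (M.step φ')^[t] (M.init args) := by
  induction t with
  | zero => rfl
  | succ t ih =>
    rw [Function.iterate_succ_apply', Function.iterate_succ_apply', ← ih (by omega)]
    have hq : ∀ j, readUnary (((M.step φ)^[t] (M.init args)).tape (.query j)) ≤ T := fun j => by
      obtain ⟨L, R, -, e, hl⟩ := M.exists_span_query (φ := φ) args t j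
      rw [e]
      have := readUnary_tp_le L R
      omega
    generalize (M.step φ)^[t] (M.init args) = c at hq ⊢
    unfold step
    split
    · rfl
    · rename_i j q _
      rw [h j _ (hq j)]
    · rfl

end OracleTM

/-! ### From machines for real functions to moduli and approximation functions -/

/-- A Cauchy function of `y` that agrees with one of `x` on all questions that can be asked makes
the machine give both arguments the same output. -/
theorem exists_modulus {a : ℝ} {f : Set.Ici a → ℝ} (hf : PolyTimeComputable a f) :
    ∃ m, IsModulus a f m ∧ IsPolynomial m := by
  obtain ⟨M, p, hM⟩ := hf
  obtain ⟨q, hq⟩ := exists_mvPolynomial_shift p 1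
  refine ⟨fun k n => eval₂ p k (n + 1) + 1, ?_, q, fun k n => (hq k n).symm⟩
  intro k n x y hx hy hxy
  choose near hnear using exists_dyadic_near
  obtain ⟨T, hT⟩ : ∃ T, T = eval₂ p k (n + 1) := ⟨_, rfl⟩
  simp only [← hT] at hxy
  -- The index `j + 1` uses up only half of the tolerance `2^-j`. For `j ≤ T` the other half absorbs
  -- `|x - y| ≤ 2^-(T+1)`, so that these values serve `y` as well.
  let φx : ℕ → Dyadic := fun j => near x (j + 1)
  let φy : ℕ → Dyadic := fun j => if j ≤ T then near x (j + 1) else near y j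
  have hφx : φx ∈ CauchyFun (x : ℝ) := fun j =>
    (hnear x (j + 1)).trans (zpow_le_zpow_right₀ (by norm_num) (by push_cast; omega))
  have hφy : φy ∈ CauchyFun (y : ℝ) := fun j => by
    by_cases hj : j ≤ T
    · have h₁ := hnear x (j + 1)
      have h₂ : (2 : ℝ) ^ (-((T + 1 : ℕ) : ℤ)) ≤ 2 ^ (-((j + 1 : ℕ) : ℤ)) :=
        zpow_le_zpow_right₀ (by norm_num) (by push_cast; omega)
      have h₃ : (2 : ℝ) ^ (-((j + 1 : ℕ) : ℤ)) + 2 ^ (-((j + 1 : ℕ) : ℤ)) = 2 ^ (-(j : ℤ)) := by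
        rw [← mul_two, ← zpow_add_one₀ (by norm_num)]
        congr 1
        push_cast
        ring
      simp only [φy, if_pos hj]
      calc |(y : ℝ) - toReal (near x (j + 1))|
          = |((x : ℝ) - toReal (near x (j + 1))) - (x - y)| := by congr 1; ring
        _ ≤ |(x : ℝ) - toReal (near x (j + 1))| + |(x : ℝ) - y| := abs_sub _ _
        _ ≤ 2 ^ (-(j : ℤ)) := by rw [← h₃]; exact add_le_add h₁ (hxy.trans h₂)
    · simp only [φy, if_neg hj]
      exact hnear y j
  have hφa : (fun j => near a j) ∈ CauchyFun a := fun j => hnear a j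
  have hmono : ∀ z : Set.Ici a, (z : ℝ) ∈ Set.Icc a (a + 2 ^ k) →
      eval₂ p (extension a z) (n + 1) ≤ T := fun z hz => by
    rw [hT]
    exact eval₂_mono p (extension_le hz) le_rfl
  obtain ⟨e, ⟨he₁, he₂⟩, he⟩ := hM _ hφa x φx hφx (n + 1)
  obtain ⟨e', ⟨he₁', he₂'⟩, he'⟩ := hM _ hφa y φy hφy (n + 1)
  -- The extension parameters of `x` and `y` may differ, and with them the time bounds; halted
  -- configurations persist, so the runs are compared at the common time `T`.
  have final : ∀ (ψ : Fin 2 → ℕ → Dyadic) (t : ℕ), t ≤ T →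
      M.instr ((M.step ψ)^[t] (M.init ![unary (n + 1)])) = .halt →
      (M.step ψ)^[T] (M.init ![unary (n + 1)]) =
        (M.step ψ)^[t] (M.init ![unary (n + 1)]) := by
    intro ψ t ht h
    obtain ⟨u, rfl⟩ := Nat.exists_eq_add_of_le ht
    rw [add_comm, Function.iterate_add_apply]
    exact Function.iterate_fixed (by rw [OracleTM.step, h]) u
  have hsame : (M.step ![φx, fun j => near a j])^[T] (M.init ![unary (n + 1)]) =
      (M.step ![φy, fun j => near a j])^[T] (M.init ![unary (n + 1)]) := by
    refine OracleTM.iterate_step_congr _ (T := T) (fun j i hi => ?_) le_rfl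
    fin_cases j
    · simp [φx, φy, hi]
    · rfl
  rw [final _ _ (hmono x hx) he₁, final _ _ (hmono y hy) he₁'] at hsame
  rw [hsame] at he₂
  obtain rfl := word_injective (holds_unique he₂ he₂')
  have h₃ : (2 : ℝ) ^ (-((n + 1 : ℕ) : ℤ)) + 2 ^ (-((n + 1 : ℕ) : ℤ)) = 2 ^ (-(n : ℤ)) := by
    rw [← mul_two, ← zpow_add_one₀ (by norm_num)]
    congr 1
    push_cast
    ring
  calc |f x - f y| = |(toReal e - f y) - (toReal e - f x)| := by congr 1; ring
    _ ≤ |toReal e - f y| + |toReal e - f x| := abs_sub _ _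
    _ ≤ 2 ^ (-(n : ℤ)) := by rw [← h₃]; exact add_le_add he' he

/-- The embedding of a machine with a real argument into one with a dyadic argument, whose word
serves as the source of the answers of the first oracle. -/
def argumentEmbedding (M : OracleTM 1 2) : Frag.Embedding M 2 1 (Fin M.w ⊕ Fin 3) where
  e
    | .input _ => .input 1
    | .output => .output
    | .query j => if j = 0 then .work (.inr 0) else .query 0
    | .answer j => if j = 0 then .work (.inr 1) else .answer 0
    | .work i => .work (.inl i)
  inj := by
    intro t t' h
    cases t with
    | input i =>
      cases t' <;> simp at h <;> first | grind | exact congrArg _ (Subsingleton.elim _ _)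
    | output => cases t' <;> simp at h <;> grind
    | query j => cases t' <;> fin_cases j <;> simp at h <;> grind
    | answer j => cases t' <;> fin_cases j <;> simp at h <;> grind
    | work k => cases t' <;> simp at h <;> grind
  ρ := ![none, some 0]
  ans := .answer 0
  mark := .work (.inr 2)
  src := .input 0
  mark_ne t := by cases t <;> grind
  src_ne t := by cases t <;> grind
  src_ne_mark := by simp
  query_eq j i h := by fin_cases j <;> simp at h ⊢; grind
  answer_eq j i h := by fin_cases j <;> simp at h ⊢; grind
  ans_eq j := by fin_cases j <;> simp

/-- The machine for `f` is run at `x = d` with the constant Cauchy function `d`; the word of `d` on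
the input tape provides every answer. The oracle for `a` is passed on. -/
theorem exists_approximation {a : ℝ} {f : Set.Ici a → ℝ} (hf : PolyTimeComputable a f) :
    ∃ ψ : CauchyFun a → DyadicIci a → ℕ → Dyadic,
      (∀ φ, IsApproximation a f (ψ φ)) ∧ PolyTimeApproxFrom a ψ := by
  obtain ⟨M, p, hM⟩ := hf
  choose ψ hψ using fun (φ : CauchyFun a) (d : DyadicIci a) (n : ℕ) =>
    hM φ.1 φ.2 ⟨toReal d.1, d.2⟩ _ (const_mem_cauchyFun d.1) n
  refine ⟨ψ, fun φ d n => (hψ φ d n).2, ?_⟩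
  obtain ⟨c, hc⟩ := exists_extension_le_len a
  obtain ⟨P, hP⟩ := exists_polynomial_diag p c 0
  -- The time bound is that of `runs_outputs`, with `P` for the time of `M` and `X` for the length
  -- of the copied word.
  refine ⟨(argumentEmbedding M).run.toMachine M.start,
    P * (8 * (Polynomial.X + P + 1) + 21) + 1, fun φ d n => ?_⟩
  obtain ⟨q, T', hr, ho⟩ := (argumentEmbedding M).runs_outputs (φ := ![φ.1]) (u := word d.1)
    (T := Frag.initTapes ![word d.1, unary n])
    (fun j i h => by fin_cases j <;> simp [argumentEmbedding] at h ⊢)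
    (fun j h i => by fin_cases j <;> simp [argumentEmbedding] at h ⊢) (hψ φ d n).1
    (fun t => by
      cases t with
      | input i => fin_cases i; rfl
      | output => rfl
      | query j => fin_cases j <;> rfl
      | answer j => fin_cases j <;> rfl
      | work k => rfl)
    rfl rfl (by simp [argumentEmbedding])
  refine Frag.outputsWithin_toMachine hr ?_ ho
  have h₁ : eval₂ p (extension a (toReal d.1)) n ≤ P.eval (len d.1 + n) := by
    rw [hP]
    exact eval₂_mono p ((hc d).trans (by omega)) (by omega)
  have h₂ : (word d.1).length ≤ len d.1 + n := Nat.le_add_right _ _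
  simp only [Polynomial.eval_add, Polynomial.eval_mul, Polynomial.eval_X, Polynomial.eval_one,
    Polynomial.eval_ofNat]
  gcongr

/-! ### Removing and adding the oracle for `a` -/

/-- The embedding of a machine with one oracle into one without, where all questions are answered
with the same word. -/
def constantEmbedding (N : OracleTM 2 1) : Frag.Embedding N 2 0 (Fin N.w ⊕ Fin 4) where
  e
    | .input i => .input i
    | .output => .output
    | .query _ => .work (.inr 0)
    | .answer _ => .work (.inr 1)
    | .work i => .work (.inl i)
  inj := by
    intro t t' h
    cases t <;> cases t' <;> simp at h <;>
      first | grind | exact congrArg _ (Subsingleton.elim _ _)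
  ρ _ := none
  ans := .answer 0
  mark := .work (.inr 2)
  src := .work (.inr 3)
  mark_ne t := by cases t <;> simp
  src_ne t := by cases t <;> simp
  src_ne_mark := by simp
  query_eq j i h := by simp at h
  answer_eq j i h := by simp at h
  ans_eq j := by fin_cases j; simp

/-- The word of `c` is fixed, so a fixed piece of program writes it on the source tape, from which
all questions are answered. -/
theorem polyTimeApprox_of_const {a : ℝ} {ψ : CauchyFun a → DyadicIci a → ℕ → Dyadic}
    (h : PolyTimeApproxFrom a ψ) (φ : CauchyFun a) {c : Dyadic} (hφ : ∀ n, φ.1 n = c) :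
    PolyTimeApprox a (ψ φ) := by
  obtain ⟨N, p, hN⟩ := h
  let E := constantEmbedding N
  refine ⟨((Frag.pushWord E.src (word c)).seq E.run).toMachine N.start,
    Polynomial.C (2 * (word c).length + 1) +
      (p * (8 * (Polynomial.C (word c).length + p + 1) + 21) + 1), fun d n => ?_⟩
  have hw := Frag.sruns_pushWord (φ := ![]) E.src (word c) N.start
    (Frag.initStore ![word d.1, unary n])
  obtain ⟨q, T', hr, ho⟩ := E.runs_outputs (φ := ![]) (u := word c)
    (T := Frag.store (Function.update (Frag.initStore ![word d.1, unary n]) E.src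
      (word c ++ Frag.initStore ![word d.1, unary n] E.src)))
    (fun j i h => by simp [E, constantEmbedding] at h)
    (fun j h i => by fin_cases j; simp [hφ]) (hN φ d n)
    (fun t => by
      rw [Frag.store, Function.update_of_ne (E.src_ne t)]
      cases t <;> rfl)
    (by simp [Frag.store, E, constantEmbedding, Frag.initStore])
    (by
      rw [Frag.store, Function.update_of_ne E.src_ne_mark.symm]
      rfl)
    (by simp [E, constantEmbedding])
  have hs := Frag.Runs.seq hw hr
  rw [← Frag.initTapes_eq] at hs
  refine Frag.outputsWithin_toMachine hs ?_ ho
  simp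

/-- The embedding of an ordinary machine into one with an oracle. -/
def plainEmbedding (N : OracleTM 2 0) : Frag.Embedding N 2 1 (Fin N.w ⊕ Fin 2) where
  e
    | .input i => .input i
    | .output => .output
    | .query j => j.elim0
    | .answer j => j.elim0
    | .work i => .work (.inl i)
  inj := by
    intro t t' h
    cases t with
    | query j => exact j.elim0
    | answer j => exact j.elim0
    | _ =>
      cases t' with
      | query j => exact j.elim0
      | answer j => exact j.elim0
      | _ => simp at h <;> grind
  ρ j := j.elim0
  ans := .output
  mark := .work (.inr 0)
  src := .work (.inr 1)
  mark_ne t := by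
    cases t with
    | query j => exact j.elim0
    | answer j => exact j.elim0
    | _ => simp
  src_ne t := by
    cases t with
    | query j => exact j.elim0
    | answer j => exact j.elim0
    | _ => simp
  src_ne_mark := by simp
  query_eq j := j.elim0
  answer_eq j := j.elim0
  ans_eq j := j.elim0

theorem PolyTimeApprox.polyTimeApproxFrom {a : ℝ} {ψ : DyadicIci a → ℕ → Dyadic}
    (h : PolyTimeApprox a ψ) : PolyTimeApproxFrom a fun _ => ψ := by
  obtain ⟨N, p, hN⟩ := h
  refine ⟨(plainEmbedding N).run.toMachine N.start, p * (8 * (p + 1) + 21) + 1,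
    fun φ d n => ?_⟩
  obtain ⟨q, T', hr, ho⟩ := (plainEmbedding N).runs_outputs (φ := ![φ.1]) (u := [])
    (T := Frag.initTapes ![word d.1, unary n]) (fun j => j.elim0) (fun j => j.elim0) (hN d n)
    (fun t => by
      cases t with
      | query j => exact j.elim0
      | answer j => exact j.elim0
      | _ => rfl)
    rfl rfl (by simp [plainEmbedding])
  refine Frag.outputsWithin_toMachine hr ?_ ho
  simp


open Turing

namespace Frag

set_option linter.unusedSectionVars false

/-! ### Fragments acting on a component of the memory -/

section Lift

variable {s r : ℕ} {κ σ τ : Type} [DecidableEq κ] {φ : Fin r → ℕ → Dyadic}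

/-- Let a fragment use a part of a larger memory. -/
def lift (get : τ → σ) (set : τ → σ → τ) (F : Frag s r κ σ) : Frag s r κ τ where
  Q := F.Q
  start := F.start
  δ q v c := ((F.δ q (get v) c).1, set v (F.δ q (get v) c).2.1, (F.δ q (get v) c).2.2)

/-- The three laws say that `get` and `set` access an independent component. This allows the
preparation of the arguments and the embedded machine, whose memories differ, to be put in sequence.
-/
theorem Runs.lift {get : τ → σ} {set : τ → σ → τ} (h₁ : ∀ v x, get (set v x) = x)
    (h₂ : ∀ v x y, set (set v x) y = set v y) (h₃ : ∀ v, set v (get v) = v)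
    {F : Frag s r κ σ} {v : τ} {x : σ} {T T' : Tapes s r κ} {t : ℕ}
    (h : F.Runs φ (get v, T) t (x, T')) :
    (F.lift get set).Runs φ (v, T) t (set v x, T') := by
  obtain ⟨t', ht', e⟩ := h
  refine ⟨t', ht', ?_⟩
  have hs : Function.Semiconj (fun c : Option F.Q × σ × Tapes s r κ =>
      ((c.1, set v c.2.1, c.2.2) : Option (F.lift get set).Q × τ × Tapes s r κ))
      (F.step φ) ((F.lift get set).step φ) := by
    rintro ⟨_ | q, y, T⟩
    · rfl
    · simp [step, Frag.lift, h₁, h₂]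
  have := (hs.iterate_right t').eq (some F.start, get v, T)
  rw [e, h₃] at this
  exact this.symm

end Lift

/-! ### Registers -/

/-- The work tapes that serve to prepare the arguments. -/
inductive WReg where
  | W | Y | N | N' | X | Z | D | J | K | src | mark
  deriving DecidableEq

instance : Fintype WReg where
  elems := {.W, .Y, .N, .N', .X, .Z, .D, .J, .K, .src, .mark}
  complete k := by cases k <;> decide

/-- The words on the tapes that serve to prepare the arguments. -/
structure Regs where
  inp : List Bool := []
  qry : List Bool := []
  ans : List Bool := []
  W : List Bool := []
  Y : List Bool := []
  N : List Bool := []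
  N' : List Bool := []
  X : List Bool := []
  Z : List Bool := []
  D : List Bool := []
  J : List Bool := []
  K : List Bool := []

/-- The tapes of the prepared machine, with `w` further work tapes. -/
abbrev PIx (w : ℕ) := Ix 1 2 (Fin w ⊕ WReg)

/-- The words on all tapes. -/
def Regs.toStore {w : ℕ} (R : Regs) : PIx w → List Bool
  | .input _ => R.inp
  | .output => []
  | .query j => if j = 0 then R.qry else []
  | .answer j => if j = 0 then R.ans else []
  | .work (.inl _) => []
  | .work (.inr .W) => R.W
  | .work (.inr .Y) => R.Y
  | .work (.inr .N) => R.N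
  | .work (.inr .N') => R.N'
  | .work (.inr .X) => R.X
  | .work (.inr .Z) => R.Z
  | .work (.inr .D) => R.D
  | .work (.inr .J) => R.J
  | .work (.inr .K) => R.K
  | .work (.inr .src) => []
  | .work (.inr .mark) => []

/-- A register: its tape, and how to read and to change it. -/
structure Loc (w : ℕ) where
  tape : PIx w
  get : Regs → List Bool
  set : Regs → List Bool → Regs
  get_eq : ∀ R, R.toStore tape = get R
  set_eq : ∀ R l, Function.update R.toStore tape l = (set R l).toStore

variable {w : ℕ}

theorem update_toStore_eq {R R' : Regs} {t : PIx w} (h : ∀ t', t' ≠ t → R.toStore t' = R'.toStore t')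
    {l : List Bool} (hl : R'.toStore t = l) : Function.update R.toStore t l = R'.toStore := by
  funext t'
  by_cases ht : t' = t
  · subst ht
    simp [hl]
  · rw [Function.update_of_ne ht, h t' ht]

def lInp : Loc w where
  tape := .input 0
  get R := R.inp
  set R l := { R with inp := l }
  get_eq _ := rfl
  set_eq R l := update_toStore_eq (fun t ht => by
    rcases t with i | _ | _ | _ | _ | (_ | _)
    · exact absurd (congrArg _ (Subsingleton.elim i 0)) ht
    all_goals rfl) rfl

def lQry : Loc w where
  tape := .query 0
  get R := R.qry
  set R l := { R with qry := l }
  get_eq _ := rfl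
  set_eq R l := update_toStore_eq (fun t ht => by
    rcases t with i | _ | j | _ | _ | (_ | _)
    case query =>
      have : j ≠ 0 := fun h => ht (congrArg _ h)
      simp [Regs.toStore, this]
    all_goals rfl) rfl

def lAns : Loc w where
  tape := .answer 0
  get R := R.ans
  set R l := { R with ans := l }
  get_eq _ := rfl
  set_eq R l := update_toStore_eq (fun t ht => by
    rcases t with i | _ | _ | j | _ | (_ | _)
    case answer =>
      have : j ≠ 0 := fun h => ht (congrArg _ h)
      simp [Regs.toStore, this]
    all_goals rfl) rfl

theorem update_work_eq (R R' : Regs) (k : WReg) {l : List Bool} (h₁ : R.inp = R'.inp)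
    (h₂ : R.qry = R'.qry) (h₃ : R.ans = R'.ans)
    (h : ∀ k' ≠ k, R.toStore (w := w) (.work (.inr k')) = R'.toStore (w := w) (.work (.inr k')))
    (hl : R'.toStore (w := w) (.work (.inr k)) = l) :
    Function.update (R.toStore (w := w)) (.work (.inr k)) l = R'.toStore := by
  refine update_toStore_eq (fun t ht => ?_) hl
  rcases t with i | _ | j | j | k' | k'
  · exact h₁
  · rfl
  · simp [Regs.toStore, h₂]
  · simp [Regs.toStore, h₃]
  · rfl
  · exact h k' fun e => ht (by rw [e])

def lW : Loc w where
  tape := .work (.inr .W)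
  get R := R.W
  set R l := { R with W := l }
  get_eq _ := rfl
  set_eq R l := update_work_eq R { R with W := l } .W rfl rfl rfl
    (fun k hk => by cases k <;> first | rfl | exact absurd rfl hk) rfl

def lY : Loc w where
  tape := .work (.inr .Y)
  get R := R.Y
  set R l := { R with Y := l }
  get_eq _ := rfl
  set_eq R l := update_work_eq R { R with Y := l } .Y rfl rfl rfl
    (fun k hk => by cases k <;> first | rfl | exact absurd rfl hk) rfl

def lN : Loc w where
  tape := .work (.inr .N)
  get R := R.N
  set R l := { R with N := l }
  get_eq _ := rfl
  set_eq R l := update_work_eq R { R with N := l } .N rfl rfl rfl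
    (fun k hk => by cases k <;> first | rfl | exact absurd rfl hk) rfl

def lN' : Loc w where
  tape := .work (.inr .N')
  get R := R.N'
  set R l := { R with N' := l }
  get_eq _ := rfl
  set_eq R l := update_work_eq R { R with N' := l } .N' rfl rfl rfl
    (fun k hk => by cases k <;> first | rfl | exact absurd rfl hk) rfl

def lX : Loc w where
  tape := .work (.inr .X)
  get R := R.X
  set R l := { R with X := l }
  get_eq _ := rfl
  set_eq R l := update_work_eq R { R with X := l } .X rfl rfl rfl
    (fun k hk => by cases k <;> first | rfl | exact absurd rfl hk) rfl

def lZ : Loc w where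
  tape := .work (.inr .Z)
  get R := R.Z
  set R l := { R with Z := l }
  get_eq _ := rfl
  set_eq R l := update_work_eq R { R with Z := l } .Z rfl rfl rfl
    (fun k hk => by cases k <;> first | rfl | exact absurd rfl hk) rfl

def lD : Loc w where
  tape := .work (.inr .D)
  get R := R.D
  set R l := { R with D := l }
  get_eq _ := rfl
  set_eq R l := update_work_eq R { R with D := l } .D rfl rfl rfl
    (fun k hk => by cases k <;> first | rfl | exact absurd rfl hk) rfl

def lJ : Loc w where
  tape := .work (.inr .J)
  get R := R.J
  set R l := { R with J := l }
  get_eq _ := rfl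
  set_eq R l := update_work_eq R { R with J := l } .J rfl rfl rfl
    (fun k hk => by cases k <;> first | rfl | exact absurd rfl hk) rfl

def lK : Loc w where
  tape := .work (.inr .K)
  get R := R.K
  set R l := { R with K := l }
  get_eq _ := rfl
  set_eq R l := update_work_eq R { R with K := l } .K rfl rfl rfl
    (fun k hk => by cases k <;> first | rfl | exact absurd rfl hk) rfl

/-- The memory used to prepare the arguments: the sign, whether a digit `1` has been read, whether
the point has been read, whether a digit `1` has been written after or before the point, the digit
to be written, and the carry. -/
structure Mem where
  neg : Bool := false
  nz : Bool := false
  ended : Bool := false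
  nzF : Bool := false
  nzI : Bool := false
  o : Bool := false
  c : Fin 3 := 0

noncomputable instance : Fintype Mem :=
  Fintype.ofInjective (fun v => (v.neg, v.nz, v.ended, v.nzF, v.nzI, v.o, v.c)) fun v v' h => by
    cases v; cases v'; simpa using h

/-- `Runs` for registers. -/
def RRuns (F : Frag 1 2 (Fin w ⊕ WReg) Mem) (φ : Fin 2 → ℕ → Dyadic) (v : Mem) (R : Regs) (t : ℕ)
    (v' : Mem) (R' : Regs) : Prop :=
  F.SRuns φ v R.toStore t v' R'.toStore

variable {φ : Fin 2 → ℕ → Dyadic} {F G : Frag 1 2 (Fin w ⊕ WReg) Mem} {v v₁ v₂ : Mem}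
  {R R₁ R₂ : Regs} {t t₁ t₂ : ℕ}

theorem RRuns.seq (hF : F.RRuns φ v R t₁ v₁ R₁) (hG : G.RRuns φ v₁ R₁ t₂ v₂ R₂) :
    (F.seq G).RRuns φ v R (t₁ + t₂) v₂ R₂ :=
  Runs.seq hF hG

theorem RRuns.mono (h : F.RRuns φ v R t v₁ R₁) (ht : t ≤ t₁) : F.RRuns φ v R t₁ v₁ R₁ :=
  Runs.mono h ht

theorem rruns_pop (l : Loc w) (m : Mem → Option Bool → Mem) (v : Mem) (R : Regs) :
    (pop l.tape m).RRuns φ v R 1 (m v (l.get R).head?) (l.set R (l.get R).tail) := by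
  have h := sruns_pop (φ := φ) l.tape m v R.toStore
  rwa [l.set_eq, l.get_eq] at h

theorem rruns_push (l : Loc w) (b : Mem → Bool) (v : Mem) (R : Regs) :
    (push l.tape b).RRuns φ v R 2 v (l.set R (b v :: l.get R)) := by
  have h := sruns_push (φ := φ) l.tape b v R.toStore
  rwa [l.set_eq, l.get_eq] at h

theorem rruns_pushWord (l : Loc w) (u : List Bool) (v : Mem) (R : Regs) :
    (pushWord l.tape u).RRuns φ v R (2 * u.length + 1) v (l.set R (u ++ l.get R)) := by
  have h := sruns_pushWord (φ := φ) l.tape u v R.toStore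
  rwa [l.set_eq, l.get_eq] at h

theorem rruns_mem (m : Mem → Mem) (v : Mem) (R : Regs) :
    (mem m : Frag 1 2 (Fin w ⊕ WReg) Mem).RRuns φ v R 1 (m v) R :=
  sruns_mem m v R.toStore

theorem rruns_askOracle (n : ℕ) (v : Mem) (R : Regs) (h : R.qry = unary n) :
    (askOracle 0 : Frag 1 2 (Fin w ⊕ WReg) Mem).RRuns φ v R 1 v { R with ans := word (φ 0 n) } := by
  have h := sruns_askOracle (φ := φ) 0 n v (R.toStore (w := w)) h
  rw [show Function.update (R.toStore (w := w)) (.answer 0) (word (φ 0 n)) = _ from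
    (lAns (w := w)).set_eq R _] at h
  exact h

theorem rruns_loopTop_exit (l : Loc w) {b : Mem → Option Bool → Bool}
    (hb : b v (l.get R).head? = false) : (loopTop l.tape b F).RRuns φ v R 1 v R :=
  sruns_loopTop_exit (by rwa [l.get_eq])

theorem rruns_loopTop_step (l : Loc w) {b : Mem → Option Bool → Bool}
    (hb : b v (l.get R).head? = true) (hF : F.RRuns φ v R t₁ v₁ R₁)
    (hl : (loopTop l.tape b F).RRuns φ v₁ R₁ t₂ v₂ R₂) :
    (loopTop l.tape b F).RRuns φ v R (1 + t₁ + t₂) v₂ R₂ :=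
  sruns_loopTop_step (by rwa [l.get_eq]) hF hl

theorem rruns_iteTop_true (l : Loc w) {b : Mem → Option Bool → Bool}
    (hb : b v (l.get R).head? = true) (hF : F.RRuns φ v R t v₁ R₁) :
    (iteTop l.tape b F G).RRuns φ v R (t + 1) v₁ R₁ :=
  sruns_iteTop_true (by rwa [l.get_eq]) hF

theorem rruns_iteTop_false (l : Loc w) {b : Mem → Option Bool → Bool}
    (hb : b v (l.get R).head? = false) (hG : G.RRuns φ v R t v₁ R₁) :
    (iteTop l.tape b F G).RRuns φ v R (t + 1) v₁ R₁ :=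
  sruns_iteTop_false (by rwa [l.get_eq]) hG

/-! ### Unary arithmetic -/

/-- Put a mark on several registers. -/
def pushAll : List (Loc w) → Frag 1 2 (Fin w ⊕ WReg) Mem
  | [] => mem id
  | l :: ls => (push l.tape fun _ => true).seq (pushAll ls)

/-- Several registers after putting a mark on each of them. -/
def markAll (ls : List (Loc w)) (R : Regs) : Regs :=
  ls.foldl (fun R l => l.set R (true :: l.get R)) R

theorem rruns_pushAll (ls : List (Loc w)) (v : Mem) (R : Regs) :
    (pushAll ls).RRuns φ v R (2 * ls.length + 1) v (markAll ls R) := by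
  induction ls generalizing R with
  | nil => exact rruns_mem id v R
  | cons l ls ih => exact ((rruns_push l _ v R).seq (ih _)).mono (by simp; omega)

/-- Empty a register and put as many marks as it had entries on others. -/
def pour (l : Loc w) (ls : List (Loc w)) : Frag 1 2 (Fin w ⊕ WReg) Mem :=
  loopTop l.tape (fun _ x => x.isSome) ((pop l.tape fun v _ => v).seq (pushAll ls))

/-- The family `f` describes the intermediate states: `u` is still to be poured and `n` marks have
been transferred. With explicit registers both hypotheses hold by `rfl`. -/
theorem rruns_pour (l : Loc w) (ls : List (Loc w)) (f : List Bool → ℕ → Regs)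
    (hl : ∀ u n, l.get (f u n) = u)
    (hs : ∀ b u n, markAll ls (l.set (f (b :: u) n) u) = f u (n + 1)) (u : List Bool) (n : ℕ)
    (v : Mem) :
    (pour l ls).RRuns φ v (f u n) (u.length * (2 * ls.length + 3) + 1) v
      (f [] (n + u.length)) := by
  induction u generalizing n with
  | nil => exact (rruns_loopTop_exit l (by simp [hl])).mono (by omega)
  | cons b u ih =>
    have h₁ := (rruns_pop (φ := φ) l (fun v _ => v) v (f (b :: u) n)).seq (rruns_pushAll ls v _)
    rw [hl, List.tail_cons, hs] at h₁
    have h₂ := rruns_loopTop_step (b := fun _ x => x.isSome) l (by simp [hl]) h₁ (ih (n + 1))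
    rw [List.length_cons, ← Nat.add_assoc, Nat.add_right_comm n]
    exact h₂.mono (by rw [add_mul]; omega)

theorem length_unary (n : ℕ) : (unary n).length = n := List.length_replicate

theorem unary_add (m n : ℕ) : unary m ++ unary n = unary (m + n) := List.replicate_append_replicate

/-- Multiply `X` by `N`. -/
def mul : Frag 1 2 (Fin w ⊕ WReg) Mem :=
  (loopTop lX.tape (fun _ x => x.isSome)
    ((pop lX.tape fun v _ => v).seq ((pour lN [lN', lZ]).seq (pour lN' [lN])))).seq (pour lZ [lX])

/-- Each of the `x` rounds adds `n` to `Z`; this empties `N`, which is restored from `N'`. The terms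
of a round are `7 * n + 1` and `5 * n + 1` for the two pourings and one each for the test and the
removal; the product is finally poured back into `X`. -/
theorem rruns_mul (x n : ℕ) (v : Mem) (R : Regs) :
    (mul (w := w)).RRuns φ v { R with X := unary x, N := unary n, N' := [], Z := [] }
      (x * (12 * n + 4) + (x * n) * 5 + 2) v
      { R with X := unary (x * n), N := unary n, N' := [], Z := [] } := by
  have h₁ : ∀ z, (loopTop lX.tape (fun _ x => x.isSome)
      ((pop lX.tape fun v _ => v).seq ((pour lN [lN', lZ]).seq
        (pour (w := w) lN' [lN])))).RRuns φ v
      { R with X := unary x, N := unary n, N' := [], Z := unary z } (x * (12 * n + 4) + 1) v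
      { R with X := [], N := unary n, N' := [], Z := unary (z + x * n) } := by
    induction x with
    | zero => intro z; simpa [show unary 0 = [] from rfl] using rruns_loopTop_exit lX (by simp [lX, unary])
    | succ x ih =>
      intro z
      have p₁ := rruns_pour (φ := φ) (w := w) lN [lN', lZ] (fun u m =>
        { R with X := unary x, N := u, N' := unary m, Z := unary (z + m) })
        (fun _ _ => rfl) (fun _ _ _ => rfl) (unary n) 0 v
      have p₂ := rruns_pour (φ := φ) (w := w) lN' [lN] (fun u m =>
        { R with X := unary x, N := unary m, N' := u, Z := unary (z + n) })
        (fun _ _ => rfl) (fun _ _ _ => rfl) (unary n) 0 v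
      rw [length_unary, Nat.zero_add] at p₁ p₂
      have h₂ := rruns_loopTop_step (b := fun _ x => x.isSome) lX (by rfl)
        ((rruns_pop (φ := φ) lX (fun v _ => v) v
          { R with X := unary (x + 1), N := unary n, N' := [], Z := unary z }).seq
            (p₁.seq p₂)) (ih (z + n))
      rw [show z + n + x * n = z + (x + 1) * n by ring] at h₂
      refine h₂.mono ?_
      simp only [List.length_cons, List.length_nil]
      ring_nf
      omega
  have p₃ := rruns_pour (φ := φ) (w := w) lZ [lX] (fun u m =>
    { R with X := unary m, N := unary n, N' := [], Z := u })
    (fun _ _ => rfl) (fun _ _ _ => rfl) (unary (x * n)) 0 v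
  rw [length_unary, Nat.zero_add] at p₃
  have h₂ := h₁ 0
  rw [Nat.zero_add] at h₂
  exact (h₂.seq p₃).mono (by simp; omega)

/-- Multiply `X` by a power of `N`. -/
def mulPow : ℕ → Frag 1 2 (Fin w ⊕ WReg) Mem
  | 0 => mem id
  | D + 1 => (mulPow D).seq mul

/-- Every polynomial is dominated by some `C * (n + 1) ^ D`, so this is all the arithmetic needed to
find a sufficient precision. -/
theorem exists_rruns_mulPow (C D : ℕ) : ∃ P : Polynomial ℕ, ∀ (n : ℕ) (φ : Fin 2 → ℕ → Dyadic)
    (v : Mem) (R : Regs),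
    (mulPow (w := w) D).RRuns φ v { R with X := unary C, N := unary n, N' := [], Z := [] }
      (P.eval n) v { R with X := unary (C * n ^ D), N := unary n, N' := [], Z := [] } := by
  induction D with
  | zero =>
    refine ⟨1, fun n φ v R => ?_⟩
    simpa [mulPow] using rruns_mem (w := w) id v _
  | succ D ih =>
    obtain ⟨P, hP⟩ := ih
    refine ⟨P + (Polynomial.C C * Polynomial.X ^ D * (12 * Polynomial.X + 4) +
      (Polynomial.C C * Polynomial.X ^ D * Polynomial.X) * 5 + 2), fun n φ v R => ?_⟩
    have := (hP n φ v R).seq (rruns_mul (C * n ^ D) n v R)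
    rw [pow_succ, ← mul_assoc]
    exact this.mono (by simp)

end Frag


open Turing

/-! ### Rounding up -/

/-- The last digit of the sum or difference of a digit and a carry. -/
def digitSum (c : Fin 3) (b : Bool) : Bool := (b.toNat + c.val) % 2 = 1

/-- The carry to the next digit, for a sum or for a difference. -/
def nextCarry (neg : Bool) (c : Fin 3) (b : Bool) : Fin 3 :=
  if neg then (if b.toNat < c.val then 1 else 0) else (if 2 ≤ b.toNat + c.val then 1 else 0)

/-- The digits of the sum or difference of a number and a carry, least significant first. -/
def outDigits (neg : Bool) : Fin 3 → List Bool → List Bool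
  | _, [] => []
  | c, b :: l => digitSum c b :: outDigits neg (nextCarry neg c b) l

/-- The carry that remains. -/
def outCarry (neg : Bool) : Fin 3 → List Bool → Fin 3
  | c, [] => c
  | c, b :: l => outCarry neg (nextCarry neg c b) l

theorem length_outDigits (neg : Bool) (c : Fin 3) (l : List Bool) :
    (outDigits neg c l).length = l.length := by
  induction l generalizing c with
  | nil => rfl
  | cons b l ih => simp [outDigits, ih]

theorem outDigits_append (neg : Bool) (c : Fin 3) (l m : List Bool) :
    outDigits neg c (l ++ m) = outDigits neg c l ++ outDigits neg (outCarry neg c l) m := by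
  induction l generalizing c with
  | nil => rfl
  | cons b l ih => simp [outDigits, outCarry, ih]

theorem outCarry_append (neg : Bool) (c : Fin 3) (l m : List Bool) :
    outCarry neg c (l ++ m) = outCarry neg (outCarry neg c l) m := by
  induction l generalizing c with
  | nil => rfl
  | cons b l ih => simp [outCarry, ih]

theorem val_outDigits_add (c : Fin 3) (l : List Bool) :
    val (outDigits false c l) + 2 ^ l.length * (outCarry false c l).val = val l + c.val := by
  induction l generalizing c with
  | nil => simp [outDigits, outCarry]
  | cons b l ih =>
    have h := ih (nextCarry false c b)
    have e : ∀ (c : Fin 3) b, (digitSum c b).toNat + 2 * (nextCarry false c b).val =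
        b.toNat + c.val := by decide
    have e := e c b
    simp only [outDigits, outCarry, val_cons, List.length_cons, pow_succ]
    rw [mul_right_comm]
    omega

/-- The value `2` is needed only for the number that is added at the lowest place; after one digit
an ordinary carry remains. -/
theorem nextCarry_le (neg : Bool) (c : Fin 3) (b : Bool) : (nextCarry neg c b).val ≤ 1 := by
  revert neg c b; decide

theorem outCarry_le (neg : Bool) (c : Fin 3) (l : List Bool) (h : l ≠ [] ∨ c.val ≤ 1) :
    (outCarry neg c l).val ≤ 1 := by
  induction l generalizing c with
  | nil => simpa [outCarry] using h
  | cons b l ih => exact ih _ (Or.inr (nextCarry_le neg c b))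

theorem val_outDigits_sub (c : Fin 3) (hc : c.val ≤ 1) (l : List Bool) :
    val (outDigits true c l) + c.val = val l + 2 ^ l.length * (outCarry true c l).val := by
  induction l generalizing c with
  | nil => simp [outDigits, outCarry]
  | cons b l ih =>
    have h := ih (nextCarry true c b) (nextCarry_le true c b)
    have e : ∀ (c : Fin 3) b, c.val ≤ 1 →
        (digitSum c b).toNat + c.val = b.toNat + 2 * (nextCarry true c b).val := by decide
    have e := e c b hc
    simp only [outDigits, outCarry, val_cons, List.length_cons, pow_succ]
    rw [mul_right_comm]
    omega

theorem val_ne_zero_iff (l : List Bool) : val l ≠ 0 ↔ l.any id = true := by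
  induction l with
  | nil => simp
  | cons b l ih => cases b <;> simp at ih ⊢; exact ih

/-- The digits that a carry adds. -/
def carryDigits (c : Fin 3) : List Bool := if c = 0 then [] else [true]

theorem val_carryDigits {c : Fin 3} (hc : c.val ≤ 1) : val (carryDigits c) = c.val := by
  revert c; decide

/-- The first `j` fractional digits of the absolute value, as a natural number. -/
def mag (e : Dyadic) (j : ℕ) : ℕ := absNum e * 2 ^ j / 2 ^ fracLen e

/-- The truncation of a number is negative. -/
def negMag (e : Dyadic) (j : ℕ) : Bool := decide (e.toRat.num < 0) && decide (mag e j ≠ 0)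

/-- A dyadic number with `j` fractional digits that is a bit larger than `e`. -/
def roundUp (e : Dyadic) (j : ℕ) : Dyadic :=
  Dyadic.ofIntWithPrec (if negMag e j then 1 - (mag e j : ℤ) else mag e j + 2) j

/-- Truncation is towards zero, so in units of `2^-j` it moves a non-negative number down and a
negative one up, by less than one. Adding `2` in the first case and `1` in the second gains at least
one unit, which later makes up for the error of the oracle. -/
theorem roundUp_bounds (e : Dyadic) (j : ℕ) :
    toReal e + (2 ^ j : ℝ)⁻¹ ≤ toReal (roundUp e j) ∧
      toReal (roundUp e j) ≤ toReal e + 3 * (2 ^ j : ℝ)⁻¹ := by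
  have hj : (0 : ℝ) < 2 ^ j := by positivity
  have hf : (0 : ℝ) < 2 ^ fracLen e := by positivity
  have h₁ : (mag e j : ℝ) ≤ |toReal e| * 2 ^ j := by
    rw [abs_toReal, div_mul_eq_mul_div, le_div_iff₀ hf]
    exact_mod_cast Nat.div_mul_le_self (absNum e * 2 ^ j) (2 ^ fracLen e)
  have h₂ : |toReal e| * 2 ^ j < mag e j + 1 := by
    rw [abs_toReal, div_mul_eq_mul_div, div_lt_iff₀ hf]
    have := Nat.lt_div_mul_add (a := absNum e * 2 ^ j) (b := 2 ^ fracLen e) (by positivity)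
    rw [add_mul, one_mul]
    exact_mod_cast this
  have h₃ : toReal e + (2 ^ j : ℝ)⁻¹ = (toReal e * 2 ^ j + 1) / 2 ^ j := by field_simp
  have h₄ : toReal e + 3 * (2 ^ j : ℝ)⁻¹ = (toReal e * 2 ^ j + 3) / 2 ^ j := by field_simp
  rw [h₃, h₄, roundUp, toReal_ofIntWithPrec]
  have key : toReal e * 2 ^ j + 1 ≤
      ((if negMag e j then 1 - (mag e j : ℤ) else mag e j + 2 : ℤ) : ℝ) ∧
      ((if negMag e j then 1 - (mag e j : ℤ) else mag e j + 2 : ℤ) : ℝ) ≤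
        toReal e * 2 ^ j + 3 := by
    by_cases hs : toReal e < 0
    · rw [abs_of_neg hs] at h₁ h₂
      -- A negative number whose truncation vanishes is treated like a non-negative one. It is moved
      -- up by up to three units; in the other cases two suffice.
      by_cases hm : mag e j = 0
      · have hn : negMag e j = false := by simp [negMag, hm]
        rw [hm, Nat.cast_zero] at h₁ h₂
        rw [hn, hm, if_neg Bool.false_ne_true]
        push_cast
        constructor <;> linarith
      · simp only [negMag, (toReal_neg_iff e).1 hs, hm, ne_eq, not_false_eq_true, decide_true,
          Bool.and_true, if_true]
        push_cast
        constructor <;> linarith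
    · rw [abs_of_nonneg (not_lt.1 hs)] at h₁ h₂
      have : ¬ e.toRat.num < 0 := fun h => hs ((toReal_neg_iff e).2 h)
      simp only [negMag, this, decide_false, Bool.false_and, Bool.false_eq_true, if_false]
      push_cast
      constructor <;> linarith
  exact ⟨div_le_div_of_nonneg_right key.1 hj.le, div_le_div_of_nonneg_right key.2 hj.le⟩

/-- The fractional digits of `roundUp e j`, least significant first, and the carry. -/
def startCarry (neg : Bool) : Fin 3 := if neg then 1 else 2

/-- The word of `roundUp e j` in terms of the digits of `e`. -/
theorem word_roundUp (e : Dyadic) (j : ℕ) (l h o o' : List Bool)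
    (hl : l.length = j) (hh : h ≠ []) (hv : val (l ++ h) = mag e j)
    (ho : o = outDigits (negMag e j) (startCarry (negMag e j)) l)
    (ho' : o' = outDigits (negMag e j) (outCarry (negMag e j) (startCarry (negMag e j)) l) h ++
      carryDigits (outCarry (negMag e j) (startCarry (negMag e j)) (l ++ h))) :
    word (roundUp e j) = signWord (negMag e j && (o'.any id || o.any id)) ++
      (dbl (intBits (val o')) ++ fracWord (o.dropWhile (! ·)).reverse) := by
  have hlen : o.length = j := by rw [ho, length_outDigits, hl]
  have hoo : o ++ o' = outDigits (negMag e j) (startCarry (negMag e j)) (l ++ h) ++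
      carryDigits (outCarry (negMag e j) (startCarry (negMag e j)) (l ++ h)) := by
    rw [ho, ho', outDigits_append, List.append_assoc]
  have hc : (outCarry (negMag e j) (startCarry (negMag e j)) (l ++ h)).val ≤ 1 :=
    outCarry_le _ _ _ (Or.inl (by simp [hh]))
  have hz : (if negMag e j then 1 - (mag e j : ℤ) else mag e j + 2) =
      (if negMag e j then -1 else 1) * (val (o ++ o') : ℤ) := by
    rw [hoo, val_append, length_outDigits, val_carryDigits hc]
    cases hn : negMag e j with
    | false =>
      rw [val_outDigits_add, hv]
      simp [startCarry]
    | true =>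
      have h₁ := val_outDigits_sub 1 le_rfl (l ++ h)
      have h₀ : mag e j ≠ 0 := by
        rw [negMag] at hn
        simpa using (Bool.and_eq_true_iff.1 hn).2
      -- No borrow remains: otherwise `mag e j` plus the full power of two would be at most that
      -- power, although `mag e j ≠ 0`.
      have h₂ : (outCarry true 1 (l ++ h)).val = 0 := by
        rw [hn] at hc
        by_contra h0
        have h3 : (outCarry true 1 (l ++ h)).val = 1 := le_antisymm hc (by omega)
        have h4 := val_lt (outDigits true 1 (l ++ h))
        rw [length_outDigits] at h4
        rw [h3, hv] at h₁
        rw [show ((1 : Fin 3) : ℕ) = 1 from rfl, mul_one] at h₁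
        omega
      simp only [startCarry, if_true, h₂, mul_zero, add_zero] at h₁ ⊢
      rw [hv] at h₁
      have : (mag e j : ℤ) = val (outDigits true 1 (l ++ h)) + 1 := by
        rw [← h₁]; simp
      rw [this]
      ring
  -- The sign has to be dropped if the result is zero, which happens for a negative number with `mag
  -- e j = 1`.
  have hany : (o'.any id || o.any id) = decide (val (o ++ o') ≠ 0) := by
    rw [Bool.or_comm, ← List.any_append, Bool.eq_iff_iff, ← val_ne_zero_iff]
    simp
  refine word_eq_of_toRat _ o o' _ (fun hn => ?_) ?_
  · rw [hany] at hn
    simpa using (Bool.and_eq_true_iff.1 hn).2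
  · rw [roundUp, Dyadic.toRat_ofIntWithPrec_eq_mul_two_pow, hz, hany, hlen, zpow_neg,
      zpow_natCast, div_eq_mul_inv]
    congr 1
    cases negMag e j with
    | false => simp
    | true =>
      by_cases h0 : val (o ++ o') = 0
      · simp [h0]
      · simp [h0]

/-- The number of fractional digits of `e`, over which a machine has no control, does not enter. -/
theorem len_roundUp_le (e : Dyadic) (j : ℕ) :
    len (roundUp e j) ≤ 2 * ((intBits (absNum e / 2 ^ fracLen e)).length + j) + 10 := by
  obtain ⟨l, hl⟩ : ∃ l, l = (padTo j (fracBits (fracLen e) (absNum e))).reverse := ⟨_, rfl⟩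
  obtain ⟨h, hh⟩ : ∃ h, h = (intBits (absNum e / 2 ^ fracLen e)).reverse := ⟨_, rfl⟩
  have hl' : l.length = j := by rw [hl, List.length_reverse, length_padTo]
  have hv : val (l ++ h) = mag e j := by
    rw [hl, hh, val_padTo _ _ _ _ (val_reverse_intBits _), mag]
  rw [len, word_roundUp e j l h _ _ hl' (by simp [hh, intBits_ne_nil]) hv rfl rfl]
  obtain ⟨o', ho'⟩ : ∃ o', o' =
      outDigits (negMag e j) (outCarry (negMag e j) (startCarry (negMag e j)) l) h ++
      carryDigits (outCarry (negMag e j) (startCarry (negMag e j)) (l ++ h)) := ⟨_, rfl⟩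
  rw [← ho']
  have h₁ : o'.length ≤ (intBits (absNum e / 2 ^ fracLen e)).length + 1 := by
    rw [ho', List.length_append, length_outDigits, hh, List.length_reverse]
    unfold carryDigits
    split_ifs <;> simp
  have h₂ := length_intBits_le _ _ (val_lt o')
  have h₃ : ∀ b, (signWord b).length ≤ 2 := by decide
  have h₄ : ∀ m, (fracWord m).length ≤ 2 * m.length + 2 := fun m => by
    unfold fracWord
    split_ifs <;> simp [length_dbl]
  have h₅ := (List.dropWhile_suffix (l := outDigits (negMag e j) (startCarry (negMag e j)) l)
    (! ·)).length_le
  rw [length_outDigits, hl'] at h₅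
  have h₆ := h₄ ((outDigits (negMag e j) (startCarry (negMag e j)) l).dropWhile (! ·)).reverse
  rw [List.length_reverse] at h₆
  simp only [List.length_append, length_dbl]
  have h₇ := h₃ (negMag e j && (o'.any id ||
    (outDigits (negMag e j) (startCarry (negMag e j)) l).any id))
  omega


open Turing

namespace Frag

set_option linter.unusedSectionVars false

variable {w : ℕ} {φ : Fin 2 → ℕ → Dyadic}

/-! ### Reading a dyadic number -/

/-- Read a symbol of a word and put it, if it is a digit, on the register `D`. -/
def readSym : Frag 1 2 (Fin w ⊕ WReg) Mem :=
  iteTop lAns.tape (fun _ x => x = some true)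
    ((pop lAns.tape fun v _ => v).seq <|
      iteTop lAns.tape (fun _ x => x = some true)
        ((pop lAns.tape fun v _ => { v with nz := true }).seq (push lD.tape fun _ => true))
        (pop lAns.tape fun v _ => { v with ended := true }))
    ((pop lAns.tape fun v _ => v).seq <|
      iteTop lAns.tape (fun _ x => x = some true)
        (pop lAns.tape fun v _ => { v with neg := true })
        ((pop lAns.tape fun v _ => v).seq (push lD.tape fun _ => false)))

theorem rruns_readSym_digit (b : Bool) (u : List Bool) (v : Mem) (R : Regs) :
    (readSym (w := w)).RRuns φ v { R with ans := b :: b :: u } 6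
      { v with nz := v.nz || b } { R with ans := u, D := b :: R.D } := by
  have h₁ := fun v R => rruns_pop (φ := φ) (w := w) lAns (fun v _ => v) v R
  cases b with
  | true =>
    have H := rruns_iteTop_true (φ := φ) (v := v) (R := { R with ans := true :: true :: u })
      (F := (pop lAns.tape fun v _ => v).seq <|
        iteTop lAns.tape (fun _ x => x = some true)
          ((pop lAns.tape fun v _ => { v with nz := true }).seq (push lD.tape fun _ => true))
          (pop lAns.tape fun v _ => { v with ended := true }))
      (G := (pop lAns.tape fun v _ => v).seq <|
        iteTop lAns.tape (fun _ x => x = some true)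
          (pop lAns.tape fun v _ => { v with neg := true })
          ((pop lAns.tape fun v _ => v).seq (push lD.tape fun _ => false)))
      (b := fun _ x => x = some true) (w := w) lAns rfl
      ((h₁ _ _).seq (rruns_iteTop_true lAns rfl
        ((rruns_pop lAns (fun v _ => { v with nz := true }) _ _).seq
          (rruns_push lD (fun _ => true) _ _))))
    rw [Bool.or_true]
    exact H.mono (by norm_num)
  | false =>
    have H := rruns_iteTop_false (φ := φ) (v := v) (R := { R with ans := false :: false :: u })
      (F := (pop lAns.tape fun v _ => v).seq <|
        iteTop lAns.tape (fun _ x => x = some true)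
          ((pop lAns.tape fun v _ => { v with nz := true }).seq (push lD.tape fun _ => true))
          (pop lAns.tape fun v _ => { v with ended := true }))
      (G := (pop lAns.tape fun v _ => v).seq <|
        iteTop lAns.tape (fun _ x => x = some true)
          (pop lAns.tape fun v _ => { v with neg := true })
          ((pop lAns.tape fun v _ => v).seq (push lD.tape fun _ => false)))
      (b := fun _ x => x = some true) (w := w) lAns rfl
      ((h₁ _ _).seq (rruns_iteTop_false lAns rfl
        ((h₁ _ _).seq (rruns_push lD (fun _ => false) _ _))))
    rw [Bool.or_false]
    exact H.mono (by norm_num)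

theorem rruns_readSym_minus (u : List Bool) (v : Mem) (R : Regs) :
    (readSym (w := w)).RRuns φ v { R with ans := false :: true :: u } 6
      { v with neg := true } { R with ans := u } :=
  (rruns_iteTop_false lAns rfl ((rruns_pop lAns (fun v _ => v) v _).seq
    (rruns_iteTop_true lAns rfl
      (rruns_pop lAns (fun v _ => { v with neg := true }) _ _)))).mono (by norm_num)

theorem rruns_readSym_point (u : List Bool) (v : Mem) (R : Regs) :
    (readSym (w := w)).RRuns φ v { R with ans := true :: false :: u } 6
      { v with ended := true } { R with ans := u } :=
  (rruns_iteTop_true lAns rfl ((rruns_pop lAns (fun v _ => v) v _).seq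
    (rruns_iteTop_false lAns rfl
      (rruns_pop lAns (fun v _ => { v with ended := true }) _ _)))).mono (by norm_num)

/-- Read the sign and the integer part. -/
def readInt : Frag 1 2 (Fin w ⊕ WReg) Mem :=
  loopTop lAns.tape (fun v x => x.isSome && !v.ended) readSym

/-- Digits are stacked on `D` as they are read, so the least significant one ends on top, as the
carry requires. The loop stops behind the point or at the end of the word. -/
theorem rruns_readInt_digits (l m : List Bool) (ng z : Bool) (R : Regs) :
    (readInt (w := w)).RRuns φ { neg := ng, nz := z } { R with ans := dbl l ++ fracWord m }
      (7 * l.length + 8) { neg := ng, nz := z || l.any id, ended := m ≠ [] }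
      { R with ans := dbl m, D := l.reverse ++ R.D } := by
  induction l generalizing z R with
  | nil =>
    by_cases hm : m = []
    · subst hm
      have := rruns_loopTop_exit (φ := φ) (w := w) (F := readSym)
        (b := fun v x => x.isSome && !v.ended) (v := { neg := ng, nz := z })
        (R := { R with ans := [] }) lAns rfl
      simpa [fracWord, readInt] using this.mono (t₁ := 8) (by norm_num)
    · have h₁ := rruns_readSym_point (φ := φ) (w := w) (dbl m) { neg := ng, nz := z } R
      have := rruns_loopTop_step (b := fun v x => x.isSome && !v.ended) lAns rfl h₁
        (rruns_loopTop_exit (F := readSym) (b := fun v x => x.isSome && !v.ended) lAns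
          (by simp))
      simpa [fracWord, readInt, hm] using this.mono (t₁ := 8) (by norm_num)
  | cons b l ih =>
    have h₁ := rruns_readSym_digit (φ := φ) (w := w) b (dbl l ++ fracWord m)
      { neg := ng, nz := z } R
    have := rruns_loopTop_step (b := fun v x => x.isSome && !v.ended) lAns rfl h₁
      (ih (z || b) { R with D := b :: R.D })
    have := this.mono (t₁ := 7 * (b :: l).length + 8) (by simp; omega)
    simpa [readInt, Bool.or_assoc] using this

theorem rruns_readInt (neg : Bool) (l m : List Bool) (R : Regs) :
    (readInt (w := w)).RRuns φ {}
      { R with ans := signWord neg ++ (dbl l ++ fracWord m) } (7 * l.length + 15)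
      { neg := neg, nz := l.any id, ended := m ≠ [] }
      { R with ans := dbl m, D := l.reverse ++ R.D } := by
  cases neg with
  | false => simpa [signWord] using (rruns_readInt_digits l m false false R).mono (by omega)
  | true =>
    have := rruns_loopTop_step (b := fun v x => x.isSome && !v.ended) (w := w) (φ := φ) lAns rfl
      (rruns_readSym_minus (dbl l ++ fracWord m) {} R) (rruns_readInt_digits l m true false R)
    have := this.mono (t₁ := 7 * l.length + 15) (by omega)
    simpa [signWord, readInt] using this

/-- Read as many fractional digits as the register `J` says. -/
def readFrac : Frag 1 2 (Fin w ⊕ WReg) Mem :=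
  loopTop lJ.tape (fun _ x => x.isSome)
    ((pop lJ.tape fun v _ => v).seq <|
      iteTop lAns.tape (fun _ x => x.isSome) readSym (push lD.tape fun _ => false))

/-- Exactly `j` digits are stacked, with zeros when the word is too short; the rest of a long word
is never read, so the time depends on `j` alone. -/
theorem rruns_readFrac (j : ℕ) (m : List Bool) (v : Mem) (R : Regs) :
    (readFrac (w := w)).RRuns φ v { R with J := unary j, ans := dbl m } (9 * j + 1)
      { v with nz := v.nz || (padTo j m).any id }
      { R with J := [], ans := dbl (m.drop j), D := (padTo j m).reverse ++ R.D } := by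
  induction j generalizing m v R with
  | zero =>
    simpa [padTo, readFrac, show unary 0 = [] from rfl] using
      rruns_loopTop_exit (φ := φ) (v := v) (R := { R with J := [], ans := dbl m }) lJ rfl
  | succ j ih =>
    cases m with
    | nil =>
      have h₁ := (rruns_pop (φ := φ) (w := w) lJ (fun v _ => v) v
        { R with J := unary (j + 1), ans := [] }).seq
        (rruns_iteTop_false (F := readSym) (b := fun _ x => x.isSome) lAns rfl
          (rruns_push lD (fun _ => false) _ _))
      have := rruns_loopTop_step (b := fun _ x => x.isSome) lJ rfl h₁
        (ih [] v { R with D := false :: R.D })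
      have := this.mono (t₁ := 9 * (j + 1) + 1) (by omega)
      simpa [readFrac, padTo] using this
    | cons b m =>
      have h₁ := (rruns_pop (φ := φ) (w := w) lJ (fun v _ => v) v
        { R with J := unary (j + 1), ans := b :: b :: dbl m }).seq
        (rruns_iteTop_true (G := push lD.tape fun _ => false) (b := fun _ x => x.isSome) lAns rfl
          (rruns_readSym_digit b (dbl m) v { R with J := unary j }))
      have := rruns_loopTop_step (b := fun _ x => x.isSome) lJ rfl h₁
        (ih m { v with nz := v.nz || b } { R with D := b :: R.D })
      have := this.mono (t₁ := 9 * (j + 1) + 1) (by omega)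
      simpa [readFrac, padTo, Bool.or_assoc] using this

/-! ### Writing a dyadic number -/

/-- Write the digit in the memory. -/
def writeDigit : Frag 1 2 (Fin w ⊕ WReg) Mem :=
  (push lW.tape fun v => v.o).seq ((push lW.tape fun v => v.o).seq (mem fun v => { v with o := false }))

theorem rruns_writeDigit (v : Mem) (R : Regs) :
    (writeDigit (w := w)).RRuns φ v R 5 { v with o := false } { R with W := v.o :: v.o :: R.W } :=
  (rruns_push lW _ v R).seq ((rruns_push lW _ v _).seq (rruns_mem _ v _))

/-- Compute the next digit and the carry. -/
def nextDigit (v : Mem) (x : Option Bool) : Mem :=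
  { v with
    o := digitSum v.c (x.getD false)
    c := nextCarry v.neg v.c (x.getD false) }

/-- Compute and write the fractional digits. -/
def writeFrac : Frag 1 2 (Fin w ⊕ WReg) Mem :=
  loopTop lK.tape (fun _ x => x.isSome)
    ((pop lK.tape fun v _ => v).seq <|
      (pop lD.tape fun v x => { nextDigit v x with nzF := v.nzF || (nextDigit v x).o }).seq <|
      iteTop lW.tape (fun v _ => v.nzF) writeDigit (mem fun v => { v with o := false }))

/-- Digits appear with the least significant one first, so the trailing zeros of the fraction are
those before the first `1`; the flag `nzF` suppresses them. The induction needs it with an arbitrary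
initial value `z`. -/
theorem rruns_writeFrac (l D : List Bool) (c : Fin 3) (z : Bool) (v : Mem) (R : Regs) :
    (writeFrac (w := w)).RRuns φ { v with nzF := z, o := false, c := c }
      { R with K := unary l.length, D := l ++ D } (9 * l.length + 1)
      { v with nzF := z || (outDigits v.neg c l).any id, o := false, c := outCarry v.neg c l }
      { R with
        K := []
        D := D
        W := dbl (if z then outDigits v.neg c l else
          (outDigits v.neg c l).dropWhile (! ·)).reverse ++ R.W } := by
  induction l generalizing c z R with
  | nil =>
    simpa [writeFrac, outDigits, outCarry, show unary 0 = [] from rfl] using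
      rruns_loopTop_exit (φ := φ) (v := { v with nzF := z, o := false, c := c })
        (R := { R with K := [], D := D }) lK rfl
  | cons b l ih =>
    have p₁ := rruns_pop (φ := φ) (w := w) lK (fun v _ => v)
      { v with nzF := z, o := false, c := c }
      { R with K := unary (b :: l).length, D := b :: (l ++ D) }
    have p₂ := rruns_pop (φ := φ) (w := w) lD
      (fun v x => { nextDigit v x with nzF := v.nzF || (nextDigit v x).o })
      { v with nzF := z, o := false, c := c } { R with K := unary l.length, D := b :: (l ++ D) }
    by_cases hz : (z || digitSum c b) = true
    · have := rruns_loopTop_step (b := fun _ x => x.isSome) lK rfl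
        (p₁.seq (p₂.seq (rruns_iteTop_true (w := w)
          (G := mem fun v => { v with o := false })
          (b := fun v _ => v.nzF) lW hz (rruns_writeDigit _ _))))
        (ih (nextCarry v.neg c b) (z || digitSum c b)
          { R with W := digitSum c b :: digitSum c b :: R.W })
      have := this.mono (t₁ := 9 * (b :: l).length + 1) (by simp; omega)
      cases hb : digitSum c b <;> cases z
      · simp [hb] at hz
      all_goals simpa [writeFrac, outDigits, outCarry, hb, dbl_append] using this
    · have hz' : (z || digitSum c b) = false := by simpa using hz
      have := rruns_loopTop_step (b := fun _ x => x.isSome) lK rfl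
        (p₁.seq (p₂.seq (rruns_iteTop_false (w := w) (F := writeDigit)
          (b := fun v _ => v.nzF) lW hz' (rruns_mem _ _ _))))
        (ih (nextCarry v.neg c b) (z || digitSum c b) R)
      have := this.mono (t₁ := 9 * (b :: l).length + 1) (by simp; omega)
      obtain ⟨rfl, hb⟩ : z = false ∧ digitSum c b = false := by simpa using hz'
      simpa [writeFrac, outDigits, outCarry, hb] using this

/-- Compute and write the digits of the integer part. -/
def writeInt : Frag 1 2 (Fin w ⊕ WReg) Mem :=
  loopTop lD.tape (fun _ x => x.isSome)
    ((pop lD.tape fun v x => { nextDigit v x with nzI := v.nzI || (nextDigit v x).o }).seq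
      writeDigit)

/-- Zeros are kept here, since it is not yet known whether they are leading ones; `stripZeros`
removes these at the end. -/
theorem rruns_writeInt (l : List Bool) (c : Fin 3) (z : Bool) (v : Mem) (R : Regs) :
    (writeInt (w := w)).RRuns φ { v with nzI := z, o := false, c := c }
      { R with D := l } (9 * l.length + 1)
      { v with nzI := z || (outDigits v.neg c l).any id, o := false, c := outCarry v.neg c l }
      { R with D := [], W := dbl (outDigits v.neg c l).reverse ++ R.W } := by
  induction l generalizing c z R with
  | nil =>
    simpa [writeInt, outDigits, outCarry] using
      rruns_loopTop_exit (φ := φ) (v := { v with nzI := z, o := false, c := c })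
        (R := { R with D := [] }) lD rfl
  | cons b l ih =>
    have p₂ := rruns_pop (φ := φ) (w := w) lD
      (fun v x => { nextDigit v x with nzI := v.nzI || (nextDigit v x).o })
      { v with nzI := z, o := false, c := c } { R with D := b :: l }
    have := rruns_loopTop_step (b := fun _ x => x.isSome) lD rfl
        (p₂.seq (rruns_writeDigit _ _))
        (ih (nextCarry v.neg c b) (z || digitSum c b)
          { R with W := digitSum c b :: digitSum c b :: R.W })
    have := this.mono (t₁ := 9 * (b :: l).length + 1) (by simp; omega)
    simpa [writeInt, outDigits, outCarry, dbl_append, Bool.or_assoc] using this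

/-- Write the point. -/
def writePoint : Frag 1 2 (Fin w ⊕ WReg) Mem :=
  iteTop lW.tape (fun v _ => v.nzF)
    ((push lW.tape fun _ => false).seq (push lW.tape fun _ => true)) (mem id)

theorem rruns_writePoint (m : List Bool) (v : Mem) (R : Regs) (h : v.nzF = decide (m ≠ [])) :
    (writePoint (w := w)).RRuns φ v { R with W := dbl m } 5 v { R with W := fracWord m } := by
  by_cases hm : m = []
  · subst hm
    exact (rruns_iteTop_false lW (by simpa using h) (rruns_mem id v _)).mono (by norm_num)
  · have := (rruns_iteTop_true (φ := φ) (G := mem id) (b := fun v _ => v.nzF) (w := w)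
      (R := { R with W := dbl m }) lW
      (by simpa [hm] using h) ((rruns_push lW (fun _ => false) v _).seq
        (rruns_push lW (fun _ => true) v _))).mono (t₁ := 5) (by norm_num)
    rw [fracWord, if_neg hm]
    exact this

/-- Write the last carry. -/
def writeCarry : Frag 1 2 (Fin w ⊕ WReg) Mem :=
  iteTop lW.tape (fun v _ => decide (v.c = 0)) (mem id)
    ((push lW.tape fun _ => true).seq
      ((push lW.tape fun _ => true).seq (mem fun v => { v with nzI := true })))

theorem rruns_writeCarry (v : Mem) (R : Regs) :
    (writeCarry (w := w)).RRuns φ v R 6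
      { v with nzI := v.nzI || (carryDigits v.c).any id }
      { R with W := dbl (carryDigits v.c).reverse ++ R.W } := by
  by_cases hc : v.c = 0
  · have := (rruns_iteTop_true (φ := φ) (w := w) (F := mem id) (R := R)
      (G := (push lW.tape fun _ => true).seq
        ((push lW.tape fun _ => true).seq (mem fun v => { v with nzI := true })))
      (b := fun v _ => decide (v.c = 0)) lW (by simpa using hc) (rruns_mem id v _)).mono
      (t₁ := 6) (by norm_num)
    have h : carryDigits v.c = [] := by simp [carryDigits, hc]
    rw [h]
    simpa [writeCarry] using this
  · have := (rruns_iteTop_false (φ := φ) (w := w) (F := mem id) (R := R)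
      (b := fun v _ => decide (v.c = 0)) lW (by simpa using hc)
      ((rruns_push lW (fun _ => true) v _).seq ((rruns_push lW (fun _ => true) v _).seq
        (rruns_mem (fun v => { v with nzI := true }) v _)))).mono
      (t₁ := 6) (by norm_num)
    simpa [carryDigits, hc, writeCarry, lW] using this

/-- Remove the leading zeros. -/
def stripZeros : Frag 1 2 (Fin w ⊕ WReg) Mem :=
  loopTop lW.tape (fun _ x => decide (x = some false))
    ((pop lW.tape fun v _ => v).seq (pop lW.tape fun v _ => v))

/-- The codes `11` of a one and `10` of the point both begin with `1`, so a `0` on top always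
belongs to a leading zero. -/
theorem rruns_stripZeros (l m : List Bool) (v : Mem) (R : Regs) :
    (stripZeros (w := w)).RRuns φ v { R with W := dbl l ++ fracWord m } (3 * l.length + 1) v
      { R with W := dbl (l.dropWhile (! ·)) ++ fracWord m } := by
  induction l with
  | nil =>
    refine rruns_loopTop_exit lW ?_
    unfold fracWord
    split_ifs <;> simp [lW]
  | cons b l ih =>
    cases b with
    | true => exact (rruns_loopTop_exit lW rfl).mono (by omega)
    | false =>
      have := rruns_loopTop_step (b := fun _ x => decide (x = some false)) lW rfl
        ((rruns_pop (φ := φ) (w := w) lW (fun v _ => v) v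
          { R with W := false :: false :: (dbl l ++ fracWord m) }).seq
          (rruns_pop lW (fun v _ => v) v _)) ih
      have := this.mono (t₁ := 3 * (false :: l).length + 1) (by simp; omega)
      simpa [stripZeros] using this

/-- Write the digit zero if the integer part has no digits. -/
def writeZero : Frag 1 2 (Fin w ⊕ WReg) Mem :=
  iteTop lW.tape (fun v _ => v.nzI) (mem id)
    ((push lW.tape fun _ => false).seq (push lW.tape fun _ => false))

theorem rruns_writeZero (l m : List Bool) (v : Mem) (R : Regs) (h : v.nzI = l.any id) :
    (writeZero (w := w)).RRuns φ v { R with W := dbl (l.reverse.dropWhile (! ·)) ++ fracWord m } 5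
      v { R with W := dbl (intBits (val l)) ++ fracWord m } := by
  have hd : l.reverse.dropWhile (! ·) = [] ↔ l.any id = false := by simp
  rw [intBits_val]
  cases hl : l.any id with
  | false =>
    rw [if_pos (hd.2 hl), hd.2 hl]
    exact (rruns_iteTop_false lW (h.trans hl)
      ((rruns_push lW (fun _ => false) v _).seq (rruns_push lW (fun _ => false) v _))).mono
      (by norm_num)
  | true =>
    rw [if_neg (fun h => by simp [hd.1 h] at hl)]
    exact (rruns_iteTop_true lW (h.trans hl) (rruns_mem id v _)).mono (by norm_num)

/-- Write the sign. -/
def writeSign : Frag 1 2 (Fin w ⊕ WReg) Mem :=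
  iteTop lW.tape (fun v _ => v.neg && (v.nzI || v.nzF))
    ((push lW.tape fun _ => true).seq (push lW.tape fun _ => false)) (mem id)

theorem rruns_writeSign (v : Mem) (R : Regs) :
    (writeSign (w := w)).RRuns φ v R 5 v
      { R with W := signWord (v.neg && (v.nzI || v.nzF)) ++ R.W } := by
  cases h : v.neg && (v.nzI || v.nzF) with
  | true =>
    exact (rruns_iteTop_true lW h ((rruns_push lW (fun _ => true) v _).seq
      (rruns_push lW (fun _ => false) v _))).mono (by norm_num)
  | false => exact (rruns_iteTop_false lW h (rruns_mem id v _)).mono (by norm_num)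

/-! ### The rounded value of an oracle -/

/-- Ask the first oracle, with the precision on the query tape and on the registers `J` and `K`,
and write its answer, rounded up. -/
def writeRounded : Frag 1 2 (Fin w ⊕ WReg) Mem :=
  (askOracle 0).seq <| readInt.seq <| readFrac.seq <|
    (mem fun v => { neg := v.neg && v.nz, c := startCarry (v.neg && v.nz) }).seq <|
    writeFrac.seq <| writePoint.seq <| writeInt.seq <| writeCarry.seq <| stripZeros.seq <|
    writeZero.seq writeSign

/-- The time is linear in `j` and the number of integer digits, however long the answer is. Of the
final registers only `W` and `Y` matter, which are the arguments of the embedded machine. -/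
theorem exists_rruns_writeRounded (j : ℕ) (R : Regs) (e : Dyadic) (he : φ 0 j = e) (a : ℕ)
    (ha : (intBits (absNum e / 2 ^ fracLen e)).length = a) :
    ∃ v' R', (writeRounded (w := w)).RRuns φ {}
      { R with qry := unary j, J := unary j, K := unary j, D := [], W := [] }
      (19 * a + 18 * j + 50) v' R' ∧ R'.W = word (roundUp e j) ∧ R'.Y = R.Y := by
  obtain ⟨l, hl⟩ : ∃ l, l = (padTo j (fracBits (fracLen e) (absNum e))).reverse := ⟨_, rfl⟩
  obtain ⟨h, hh⟩ : ∃ h, h = (intBits (absNum e / 2 ^ fracLen e)).reverse := ⟨_, rfl⟩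
  have hl' : l.length = j := by rw [hl, List.length_reverse, length_padTo]
  have hv : val (l ++ h) = mag e j := by
    rw [hl, hh, val_padTo _ _ _ _ (val_reverse_intBits _), mag]
  -- The digits that have been read are those of `mag e j`, so the flag `nz` records whether the
  -- truncation is nonzero.
  have hn : (decide (e.toRat.num < 0) &&
      ((intBits (absNum e / 2 ^ fracLen e)).any id ||
        (padTo j (fracBits (fracLen e) (absNum e))).any id)) = negMag e j := by
    rw [negMag, ← hv]
    congr 1
    rw [Bool.eq_iff_iff, decide_eq_true_iff, val_ne_zero_iff, hl, hh, List.any_append,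
      List.any_reverse, List.any_reverse, Bool.or_comm]
  have hla : h.length = a := by rw [hh, List.length_reverse, ha]
  have s₁ := rruns_askOracle (φ := φ) (w := w) j {}
    { R with qry := unary j, J := unary j, K := unary j, D := [], W := [] } rfl
  rw [he, word_eq] at s₁
  have s₂ := rruns_readInt (φ := φ) (w := w) (decide (e.toRat.num < 0))
    (intBits (absNum e / 2 ^ fracLen e)) (fracBits (fracLen e) (absNum e))
    { R with qry := unary j, J := unary j, K := unary j, D := [], W := [] }
  rw [← hh, ha] at s₂
  have s₃ := rruns_readFrac (φ := φ) (w := w) j (fracBits (fracLen e) (absNum e))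
    { neg := decide (e.toRat.num < 0), nz := (intBits (absNum e / 2 ^ fracLen e)).any id,
      ended := fracBits (fracLen e) (absNum e) ≠ [] }
    { R with qry := unary j, K := unary j, D := h ++ [], W := [] }
  rw [← hl, List.append_nil] at s₃
  rw [List.append_nil] at s₂
  have s₄ := rruns_mem (φ := φ) (w := w)
    (fun v => { neg := v.neg && v.nz, c := startCarry (v.neg && v.nz) })
    { neg := decide (e.toRat.num < 0), nz := (intBits (absNum e / 2 ^ fracLen e)).any id ||
        (padTo j (fracBits (fracLen e) (absNum e))).any id,
      ended := fracBits (fracLen e) (absNum e) ≠ [] }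
    { R with
      qry := unary j, J := [], ans := dbl ((fracBits (fracLen e) (absNum e)).drop j)
      K := unary j, D := l ++ h, W := [] }
  simp only [hn] at s₄
  obtain ⟨o, ho⟩ : ∃ o, o = outDigits (negMag e j) (startCarry (negMag e j)) l := ⟨_, rfl⟩
  have s₅ := rruns_writeFrac (φ := φ) (w := w) l h (startCarry (negMag e j)) false
    { neg := negMag e j } { R with
      qry := unary j, J := [], ans := dbl ((fracBits (fracLen e) (absNum e)).drop j)
      W := [] }
  simp only [← ho, hl', Bool.false_eq_true, if_false, List.append_nil, Bool.false_or] at s₅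
  have s₆ := rruns_writePoint (φ := φ) (w := w) (o.dropWhile (! ·)).reverse
    { neg := negMag e j, nzF := o.any id,
      c := outCarry (negMag e j) (startCarry (negMag e j)) l }
    { R with
      qry := unary j, J := [], ans := dbl ((fracBits (fracLen e) (absNum e)).drop j)
      K := [], D := h } (by
        rw [Bool.eq_iff_iff]
        simp)
  have s₇ := rruns_writeInt (φ := φ) (w := w) h
    (outCarry (negMag e j) (startCarry (negMag e j)) l) false
    { neg := negMag e j, nzF := o.any id }
    { R with
      qry := unary j, J := [], ans := dbl ((fracBits (fracLen e) (absNum e)).drop j)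
      K := [], W := fracWord (o.dropWhile (! ·)).reverse }
  rw [hla, ← outCarry_append] at s₇
  obtain ⟨o₁, ho₁⟩ : ∃ o₁, o₁ =
    outDigits (negMag e j) (outCarry (negMag e j) (startCarry (negMag e j)) l) h := ⟨_, rfl⟩
  simp only [← ho₁, Bool.false_or] at s₇
  obtain ⟨c, hc⟩ : ∃ c, c = outCarry (negMag e j) (startCarry (negMag e j)) (l ++ h) := ⟨_, rfl⟩
  rw [← hc] at s₇
  have s₈ := rruns_writeCarry (φ := φ) (w := w)
    { neg := negMag e j, nzF := o.any id, nzI := o₁.any id, c := c }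
    { R with
      qry := unary j, J := [], ans := dbl ((fracBits (fracLen e) (absNum e)).drop j)
      K := [], D := [], W := dbl o₁.reverse ++ fracWord (o.dropWhile (! ·)).reverse }
  obtain ⟨o', ho'⟩ : ∃ o', o' = o₁ ++ carryDigits c := ⟨_, rfl⟩
  have e₁ : (o₁.any id || (carryDigits c).any id) = o'.any id := by rw [ho', List.any_append]
  have e₂ : dbl (carryDigits c).reverse ++ (dbl o₁.reverse ++
      fracWord (o.dropWhile (! ·)).reverse) =
      dbl o'.reverse ++ fracWord (o.dropWhile (! ·)).reverse := by
    rw [ho', List.reverse_append, dbl_append, List.append_assoc]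
  simp only [e₁, e₂] at s₈
  have s₉ := rruns_stripZeros (φ := φ) (w := w) o'.reverse (o.dropWhile (! ·)).reverse
    { neg := negMag e j, nzF := o.any id, nzI := o'.any id, c := c }
    { R with
      qry := unary j, J := [], ans := dbl ((fracBits (fracLen e) (absNum e)).drop j)
      K := [], D := [] }
  have s₁₀ := rruns_writeZero (φ := φ) (w := w) o' (o.dropWhile (! ·)).reverse
    { neg := negMag e j, nzF := o.any id, nzI := o'.any id, c := c }
    { R with
      qry := unary j, J := [], ans := dbl ((fracBits (fracLen e) (absNum e)).drop j)
      K := [], D := [] } rfl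
  have s₁₁ := rruns_writeSign (φ := φ) (w := w)
    { neg := negMag e j, nzF := o.any id, nzI := o'.any id, c := c }
    { R with
      qry := unary j, J := [], ans := dbl ((fracBits (fracLen e) (absNum e)).drop j)
      K := [], D := []
      W := dbl (intBits (val o')) ++ fracWord (o.dropWhile (! ·)).reverse }
  have hlen : o'.length ≤ a + 1 := by
    rw [ho', ho₁, List.length_append, length_outDigits, hla]
    unfold carryDigits
    split_ifs <;> simp
  refine ⟨_, _, (s₁.seq <| s₂.seq <| s₃.seq <| s₄.seq <| s₅.seq <| s₆.seq <| s₇.seq <|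
    s₈.seq <| s₉.seq <| s₁₀.seq s₁₁).mono ?_, ?_, rfl⟩
  · rw [List.length_reverse]
    omega
  · exact (word_roundUp e j l h o o' hl' (by simp [hh, intBits_ne_nil]) hv ho
      (by rw [ho', ho₁, hc])).symm

end Frag


open Turing

/-- The number of binary digits of the integer part. -/
def intLen (d : Dyadic) : ℕ := (intBits (absNum d / 2 ^ fracLen d)).length

namespace Frag

set_option linter.unusedSectionVars false

variable {w : ℕ}

/-! ### Preparing the arguments of an approximation function -/

/-- From the precision `n`, produce `n + 1` and a dyadic number close to the real number that is
given by the first oracle. -/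
def prepare (c C D : ℕ) : Frag 1 2 (Fin w ⊕ WReg) Mem :=
  (askOracle 0).seq <| readInt.seq <| (mem fun _ => {}).seq <| (pour lD [lN]).seq <|
    (pushWord lN.tape (unary (c + 1))).seq <| (pour lInp [lN, lY]).seq <|
    (push lY.tape fun _ => true).seq <| (pushWord lX.tape (unary C)).seq <| (mulPow D).seq <|
    (pour lX [lQry, lJ, lK]).seq writeRounded

/-- The machine cannot see the extension parameter of its argument and computes the precision `j`
from the number of integer digits of `φ 0 0` instead. -/
theorem exists_rruns_prepare (c C D : ℕ) : ∃ P : Polynomial ℕ,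
    ∀ (φ : Fin 2 → ℕ → Dyadic) (n j : ℕ), j = C * (c + 1 + intLen (φ 0 0) + n) ^ D →
      ∃ v' R', (prepare (w := w) c C D).RRuns φ {} { inp := unary n }
        (P.eval (intLen (φ 0 0) + n) + 19 * intLen (φ 0 j)) v' R' ∧
        R'.W = word (roundUp (φ 0 j) j) ∧ R'.Y = unary (n + 1) := by
  obtain ⟨P, hP⟩ := exists_rruns_mulPow (w := w) C D
  refine ⟨P.comp (Polynomial.X + Polynomial.C (c + 1)) + 12 * Polynomial.X +
    27 * Polynomial.C C * (Polynomial.X + Polynomial.C (c + 1)) ^ D +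
    Polynomial.C (2 * c + 2 * C + 100), fun φ n j hj => ?_⟩
  obtain ⟨L, hL⟩ : ∃ L, L = intLen (φ 0 0) := ⟨_, rfl⟩
  rw [← hL] at hj ⊢
  obtain ⟨m, hm⟩ : ∃ m, m = fracBits (fracLen (φ 0 0)) (absNum (φ 0 0)) := ⟨_, rfl⟩
  have s₁ := rruns_askOracle (φ := φ) (w := w) 0 {} { inp := unary n } rfl
  rw [word_eq, ← hm] at s₁
  have s₂ := rruns_readInt (φ := φ) (w := w) ((φ 0 0).toRat.num < 0)
    (intBits (absNum (φ 0 0) / 2 ^ fracLen (φ 0 0))) m { inp := unary n }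
  rw [List.append_nil] at s₂
  have s₃ := rruns_mem (φ := φ) (w := w) (fun _ => {})
  have s₄ := rruns_pour (φ := φ) (w := w) lD [lN]
    (fun u k => { inp := unary n, ans := dbl m, D := u, N := unary k })
    (fun _ _ => rfl) (fun _ _ _ => rfl)
    (intBits (absNum (φ 0 0) / 2 ^ fracLen (φ 0 0))).reverse 0 {}
  rw [List.length_reverse, show (intBits (absNum (φ 0 0) / 2 ^ fracLen (φ 0 0))).length = L from
    hL.symm, Nat.zero_add] at s₄
  have s₅ := rruns_pushWord (φ := φ) (w := w) lN (unary (c + 1)) {}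
    { inp := unary n, ans := dbl m, N := unary L }
  rw [show unary (c + 1) ++ (lN (w := w)).get { inp := unary n, ans := dbl m, N := unary L } =
    unary (c + 1 + L) from unary_add _ _] at s₅
  have s₆ := rruns_pour (φ := φ) (w := w) lInp [lN, lY]
    (fun u k => { inp := u, ans := dbl m, N := unary (c + 1 + L + k), Y := unary k })
    (fun _ _ => rfl) (fun _ _ _ => rfl) (unary n) 0 {}
  rw [length_unary, Nat.zero_add] at s₆
  have s₇ := rruns_push (φ := φ) (w := w) lY (fun _ => true) {}
    { ans := dbl m, N := unary (c + 1 + L + n), Y := unary n }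
  have s₈ := rruns_pushWord (φ := φ) (w := w) lX (unary C) {}
    { ans := dbl m, N := unary (c + 1 + L + n), Y := unary (n + 1) }
  rw [show unary C ++ (lX (w := w)).get
    { ans := dbl m, N := unary (c + 1 + L + n), Y := unary (n + 1) } = unary C from
      List.append_nil _] at s₈
  have s₉ := hP (c + 1 + L + n) φ {} { ans := dbl m, Y := unary (n + 1) }
  rw [← hj] at s₉
  have s₁₀ := rruns_pour (φ := φ) (w := w) lX [lQry, lJ, lK]
    (fun u k => { ans := dbl m, N := unary (c + 1 + L + n), Y := unary (n + 1), X := u,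
                  qry := unary k, J := unary k, K := unary k })
    (fun _ _ => rfl) (fun _ _ _ => rfl) (unary j) 0 {}
  rw [length_unary, Nat.zero_add] at s₁₀
  obtain ⟨v', R', s₁₁, hW, hY⟩ := exists_rruns_writeRounded (φ := φ) (w := w) j
    { ans := dbl m, N := unary (c + 1 + L + n), Y := unary (n + 1) } (φ 0 j) rfl
    (intLen (φ 0 j)) rfl
  refine ⟨v', R', (s₁.seq <| s₂.seq <| (s₃ _ _).seq <| s₄.seq <| s₅.seq <| s₆.seq <| s₇.seq <|
    s₈.seq <| s₉.seq <| s₁₀.seq s₁₁).mono ?_, hW, hY⟩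
  rw [length_unary, length_unary]
  simp only [Polynomial.eval_add, Polynomial.eval_mul, Polynomial.eval_X, Polynomial.eval_pow,
    Polynomial.eval_ofNat, Polynomial.eval_C, Polynomial.eval_comp, List.length_cons,
    List.length_nil]
  rw [show L + n + (c + 1) = c + 1 + L + n by ring, mul_assoc 27, ← hj,
    show (intBits (absNum (φ 0 0) / 2 ^ fracLen (φ 0 0))).length = L from hL.symm]
  omega

end Frag

/-! ### From a modulus and approximation functions to a machine for the real function -/

/-- The embedding of a machine for an approximation function: its arguments are on the tapes of the
registers `W` and `Y`, and it asks the second oracle. -/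
def preparedEmbedding (N : OracleTM 2 1) : Frag.Embedding N 1 2 (Fin N.w ⊕ Frag.WReg) where
  e
    | .input i => .work (.inr (if i = 0 then .W else .Y))
    | .output => .output
    | .query _ => .query 1
    | .answer _ => .answer 1
    | .work i => .work (.inl i)
  inj := by
    intro t t' h
    cases t <;> cases t' <;> simp at h <;>
      first | grind | exact congrArg _ (Subsingleton.elim _ _)
  ρ _ := some 1
  ans := .output
  mark := .work (.inr .mark)
  src := .work (.inr .src)
  mark_ne t := by
    cases t <;> simp
    split_ifs <;> simp
  src_ne t := by
    cases t <;> simp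
    split_ifs <;> simp
  src_ne_mark := by simp
  query_eq j i h := by simp at h; simp [h]
  answer_eq j i h := by simp at h; simp [h]
  ans_eq j := by simp


open Turing

theorem intLen_le {e : Dyadic} {k : ℕ} (h : |toReal e| < 2 ^ k) : intLen e ≤ k + 1 := by
  refine length_intBits_le _ _ ?_
  rw [Nat.div_lt_iff_lt_mul (by positivity)]
  rw [abs_toReal, div_lt_iff₀ (by positivity)] at h
  exact_mod_cast h

/-- A value of a Cauchy function has few digits before the point. -/
theorem intLen_cauchyFun_le {a x : ℝ} {c : ℕ} (hc : |a| + 3 ≤ 2 ^ c) (hx : a ≤ x)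
    {φ : ℕ → Dyadic} (hφ : φ ∈ CauchyFun x) (i : ℕ) :
    intLen (φ i) ≤ extension a x + c + 1 := by
  refine intLen_le ?_
  have h₁ := abs_le.1 ((hφ i).trans (zpow_le_one_of_nonpos₀ (by norm_num) (by simp)))
  have h₂ := (mem_Icc_extension hx).2
  have h₃ : (1 : ℝ) ≤ 2 ^ extension a x := one_le_pow₀ (by norm_num)
  have h₄ : |toReal (φ i)| ≤ 2 ^ extension a x + 2 ^ c - 2 :=
    abs_le.2 ⟨by linarith [neg_abs_le a], by linarith [le_abs_self a]⟩
  rw [pow_add]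
  -- Numbers `A, B ≥ 1` satisfy `A + B - 1 ≤ A * B`.
  nlinarith [abs_nonneg a]

/-- The rounded dyadic number lies to the right of the given real number and close to it. -/
theorem roundUp_mem {x : ℝ} {φ : ℕ → Dyadic} (hφ : φ ∈ CauchyFun x) (j : ℕ) :
    x ≤ toReal (roundUp (φ j) j) ∧ toReal (roundUp (φ j) j) ≤ x + 4 * (2 ^ j : ℝ)⁻¹ := by
  have h := abs_le.1 (hφ j)
  rw [zpow_neg, zpow_natCast] at h
  obtain ⟨h₁, h₂⟩ := roundUp_bounds (φ j) j
  constructor <;> linarith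

/-- The approximation function is evaluated with precision `n + 1` at a rounded oracle value `d ≥
x`; the modulus accounts for the other half of the error. -/
theorem polyTimeComputable_of_modulus {a : ℝ} {f : Set.Ici a → ℝ} {m : ℕ → ℕ → ℕ}
    {ψ : CauchyFun a → DyadicIci a → ℕ → Dyadic} (hm : IsModulus a f m) (hp : IsPolynomial m)
    (hψ : ∀ φ, IsApproximation a f (ψ φ)) (hN : PolyTimeApproxFrom a ψ) :
    PolyTimeComputable a f := by
  obtain ⟨p, hp⟩ := hp
  obtain ⟨N, q, hN⟩ := hN
  obtain ⟨c, hc⟩ := pow_unbounded_of_one_lt (|a| + 3) (one_lt_two (α := ℝ))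
  obtain ⟨Q, hQ⟩ := exists_polynomial_diag p 0 1
  obtain ⟨C, D, hCD⟩ := exists_polynomial_le Q
  obtain ⟨P, hP⟩ := Frag.exists_rruns_prepare (w := N.w) c (C + 2) D
  -- These bound, as functions of `k + n`, the integer digits of the oracle values, the precision
  -- `j`, and the time of `N` on the arguments `d` and `n + 1`.
  let len' : Polynomial ℕ := Polynomial.X + Polynomial.C (c + 1)
  let prec : Polynomial ℕ := Polynomial.C (C + 2) * (len' + Polynomial.C (c + 1)) ^ D
  let T : Polynomial ℕ := q.comp (2 * (len' + prec) + 10 + (Polynomial.X + 1))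
  obtain ⟨b, hb⟩ := exists_mvPolynomial_sum
    (P.comp len' + 19 * len' + (T * (8 * (T + 1) + 21) + 1))
  let E := preparedEmbedding N
  let F : Frag 1 2 (Fin N.w ⊕ Frag.WReg) (Frag.Mem × N.Q) :=
    ((Frag.prepare c (C + 2) D).lift Prod.fst fun v x => (x, v.2)).seq
      (E.run.lift Prod.snd fun v x => (v.1, x))
  refine ⟨F.toMachine ({}, N.start), b, fun φa ha x φx hφx n => ?_⟩
  obtain ⟨L, hL⟩ : ∃ L, L = intLen (φx 0) := ⟨_, rfl⟩
  obtain ⟨j, hj⟩ : ∃ j, j = (C + 2) * (c + 1 + L + n) ^ D := ⟨_, rfl⟩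
  obtain ⟨k, hk⟩ : ∃ k, k = extension a x := ⟨_, rfl⟩
  obtain ⟨v', R', hrun, hW, hY⟩ := hP ![φx, φa] n j (by rw [hj, hL]; rfl)
  simp only [Matrix.cons_val_zero, ← hL] at hrun hW
  -- the rounded argument
  obtain ⟨hd₁, hd₂⟩ := roundUp_mem hφx j
  obtain ⟨d, hd⟩ : ∃ d, d = roundUp (φx j) j := ⟨_, rfl⟩
  rw [← hd] at hd₁ hd₂ hW
  -- The summand `2` in the factor `C + 2` yields the two extra bits, because the power is at least
  -- `1`; they cancel the factor `4` in `roundUp_mem`.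
  have hmj : m (L + c) (n + 1) + 2 ≤ j := by
    have h₁ : m (L + c) (n + 1) ≤ C * (c + 1 + L + n) ^ D := by
      refine (hp _ _).trans_le (le_trans (eval₂_mono p ?_ ?_)
        ((hQ (L + c + n)).symm.le.trans ((hCD (L + c + n)).trans_eq ?_)))
      · omega
      · omega
      · congr 2
        omega
    have h₂ : 1 ≤ (c + 1 + L + n) ^ D := Nat.one_le_pow _ _ (by omega)
    rw [hj, add_mul]
    omega
  have hj₄ : 4 * (2 ^ j : ℝ)⁻¹ ≤ (2 : ℝ) ^ (-(m (L + c) (n + 1) : ℤ)) := by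
    rw [zpow_neg, zpow_natCast, ← div_eq_mul_inv, div_le_iff₀ (by positivity), inv_mul_eq_div,
      le_div_iff₀ (by positivity)]
    calc (4 : ℝ) * 2 ^ m (L + c) (n + 1) = 2 ^ (m (L + c) (n + 1) + 2) := by ring
      _ ≤ 2 ^ j := pow_le_pow_right₀ (by norm_num) hmj
  have hx : a ≤ x := x.2
  have hxL : (x : ℝ) ≤ 2 ^ L + 1 := by
    have h₁ := (abs_le.1 (hφx 0)).2
    have h₂ := (le_abs_self _).trans (abs_toReal_lt (φx 0)).le
    rw [show (intBits _).length = L from hL.symm] at h₂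
    norm_num at h₁
    linarith
  -- Here `d ≤ x + 1 ≤ 2^L + 2`, and `2^c > |a| + 3` makes `a + 2^(L+c)` at least as large. So the
  -- modulus for `L + c` applies to `d` and `x`.
  have hd₃ : toReal d ≤ a + 2 ^ (L + c) := by
    have h₁ : (2 : ℝ) ^ (-(m (L + c) (n + 1) : ℤ)) ≤ 1 :=
      zpow_le_one_of_nonpos₀ (by norm_num) (by simp)
    have h₂ : (1 : ℝ) ≤ 2 ^ L := one_le_pow₀ (by norm_num)
    rw [pow_add]
    nlinarith [neg_abs_le a, abs_nonneg a]
  have hda : toReal d ∈ Set.Ici a := hx.trans hd₁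
  -- the run of the embedded machine
  obtain ⟨y, T', hr, ho⟩ := E.runs_outputs (φ := ![φx, φa]) (u := [])
    (T := Frag.store R'.toStore)
    (fun j i h => by
      obtain rfl : 1 = i := by simpa [E, preparedEmbedding] using h
      fin_cases j
      rfl)
    (fun j h => by simp [E, preparedEmbedding] at h) (hN ⟨φa, ha⟩ ⟨d, hda⟩ (n + 1))
    (fun t => by
      cases t with
      | input i =>
        fin_cases i
        · exact congrArg OracleTM.tapeOf hW
        · exact congrArg OracleTM.tapeOf hY
      | _ => rfl)
    rfl rfl (by simp [E, preparedEmbedding])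
  have h₁ := Frag.Runs.lift (get := Prod.fst) (set := fun v x => (x, v.2)) (fun _ _ => rfl)
    (fun _ _ _ => rfl) (fun _ => rfl) (v := (({}, N.start) : Frag.Mem × N.Q)) hrun
  have h₂ := Frag.Runs.lift (get := Prod.snd) (set := fun v x => (v.1, x)) (fun _ _ => rfl)
    (fun _ _ _ => rfl) (fun _ => rfl) (v := ((v', N.start) : Frag.Mem × N.Q)) hr
  have h₃ := Frag.Runs.seq h₁ h₂
  have e : Frag.store (Frag.Regs.toStore (w := N.w) { inp := unary n }) =
      Frag.initTapes ![unary n] := by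
    rw [Frag.initTapes_eq]
    congr 1
    funext t
    rcases t with i | _ | j | j | k | k
    · fin_cases i; rfl
    · rfl
    · simp [Frag.Regs.toStore, Frag.initStore]
    · simp [Frag.Regs.toStore, Frag.initStore]
    · rfl
    · cases k <;> rfl
  rw [e] at h₃
  refine ⟨ψ ⟨φa, ha⟩ ⟨d, hda⟩ (n + 1), Frag.outputsWithin_toMachine h₃ ?_ ho, ?_⟩
  · -- the time bound
    have hlen : ∀ i, intLen (φx i) ≤ len'.eval (k + n) := fun i => by
      have := intLen_cauchyFun_le hc.le hx hφx i
      rw [← hk] at this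
      simp only [len', Polynomial.eval_add, Polynomial.eval_X, Polynomial.eval_C]
      omega
    have hL' : L + n ≤ len'.eval (k + n) := by
      have := intLen_cauchyFun_le hc.le hx hφx 0
      rw [← hk, ← hL] at this
      simp only [len', Polynomial.eval_add, Polynomial.eval_X, Polynomial.eval_C]
      omega
    have hj' : j ≤ prec.eval (k + n) := by
      simp only [prec, Polynomial.eval_mul, Polynomial.eval_pow, Polynomial.eval_add,
        Polynomial.eval_C, hj]
      refine Nat.mul_le_mul_left _ (Nat.pow_le_pow_left ?_ _)
      omega
    have hT : q.eval (len d + (n + 1)) ≤ T.eval (k + n) := by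
      simp only [T, Polynomial.eval_comp]
      refine polynomial_eval_mono q ?_
      have h₄ := len_roundUp_le (φx j) j
      have h₅ := hlen j
      rw [← hd] at h₄
      unfold intLen at h₅
      simp only [Polynomial.eval_add, Polynomial.eval_mul, Polynomial.eval_X,
        Polynomial.eval_ofNat, Polynomial.eval_one]
      omega
    rw [← hk, hb]
    simp only [Polynomial.eval_add, Polynomial.eval_mul, Polynomial.eval_ofNat,
      Polynomial.eval_one, Polynomial.eval_comp, List.length_nil, Nat.zero_add]
    have h₆ := polynomial_eval_mono P hL'
    have h₇ := hlen j
    gcongr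
  · -- the error bound
    have h₄ := hψ ⟨φa, ha⟩ ⟨d, hda⟩ (n + 1)
    have h₅ := hm (L + c) (n + 1) ⟨toReal d, hda⟩ x ⟨hda, hd₃⟩ ⟨hx, hd₁.trans hd₃⟩ (by
      rw [abs_of_nonneg (sub_nonneg.2 hd₁)]
      linarith)
    have h₆ : (2 : ℝ) ^ (-((n + 1 : ℕ) : ℤ)) + 2 ^ (-((n + 1 : ℕ) : ℤ)) = 2 ^ (-(n : ℤ)) := by
      rw [← mul_two, ← zpow_add_one₀ (by norm_num)]
      congr 1
      push_cast
      ring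
    rw [← h₆]
    exact (abs_sub_le _ _ _).trans (add_le_add h₄ h₅)

end PTimeReal

/-! ### The two equivalences -/

theorem mainTheorem1 (a : ℝ) (f : Set.Ici a → ℝ) :
    (PolyTimeComputable a f ↔
      ∃ (m : ℕ → ℕ → ℕ) (ψ : CauchyFun a → DyadicIci a → ℕ → Dyadic),
        (IsModulus a f m ∧ IsPolynomial m) ∧
        (∀ φ : CauchyFun a, IsApproximation a f (ψ φ)) ∧
        PolyTimeApproxFrom a ψ) ∧
    ((∃ c : Dyadic, toReal c = a) →
      (PolyTimeComputable a f ↔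
        ∃ (m : ℕ → ℕ → ℕ) (ψ : DyadicIci a → ℕ → Dyadic),
          (IsModulus a f m ∧ IsPolynomial m) ∧
          IsApproximation a f ψ ∧
          PolyTimeApprox a ψ)) := by
  have hto : PolyTimeComputable a f → ∃ (m : ℕ → ℕ → ℕ)
      (ψ : CauchyFun a → DyadicIci a → ℕ → Dyadic),
      (IsModulus a f m ∧ IsPolynomial m) ∧ (∀ φ : CauchyFun a, IsApproximation a f (ψ φ)) ∧
      PolyTimeApproxFrom a ψ := fun hf =>
    let ⟨m, hm⟩ := exists_modulus hf
    let ⟨ψ, hψ⟩ := exists_approximation hf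
    ⟨m, ψ, hm, hψ⟩
  refine ⟨⟨hto, ?_⟩, ?_⟩
  · rintro ⟨m, ψ, ⟨hm, hp⟩, hψ, hN⟩
    exact polyTimeComputable_of_modulus hm hp hψ hN
  · rintro ⟨c, rfl⟩
    constructor
    · intro hf
      obtain ⟨m, ψ, hm, hψ, hN⟩ := hto hf
      let φ : CauchyFun (toReal c) := ⟨fun _ => c, const_mem_cauchyFun c⟩
      exact ⟨m, ψ φ, hm, hψ φ, polyTimeApprox_of_const hN φ fun _ => rfl⟩
    · rintro ⟨m, ψ, ⟨hm, hp⟩, hψ, hN⟩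
      exact polyTimeComputable_of_modulus hm hp (fun _ => hψ) hN.polyTimeApproxFrom
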